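/- Let $p\ge 1$, $q\ge 0$ be integers, $Q=\{1,\dots,q\}$, and let $\nu>p$ be real. Write points of the Siegel domain as $z=(z',z_p)\in\mathbb U^p=\{\rho(z):=\operatorname{Im}z_p-|z'|^2>0\}\subset\mathbb C^{p-1}\times\mathbb C$. Let $\xi_i,\bar\xi_i$ $(i\in Q)$ be the generators of a complex Grassmann algebra (all of them anticommute); for $I=\{i_1<\dots<i_k\}$ put $\xi_I=\xi_{i_1}\cdots\xi_{i_k}$, $\xi_I^*=\bar\xi_{i_k}\cdots\bar\xi_{i_1}$. The Berezin integral is $\int_{\mathbb U^{p|q}}dz\,d\xi\,G=\int_{\mathbb U^p}g(z)\,dz$, where $g$ is the coefficient of $\xi_Q^*\xi_Q$ in $G$. For $\Phi=\sum_M\varphi_M\xi_M$ put $\Phi^*=\sum_M\overline{\varphi_M}\,\xi_M^*$, and for a super function $\Theta$ put $$(\Phi|\Theta)=\frac{\Gamma(\nu)}{4\pi^p\,\Gamma(\nu+q-p)}\int_{\mathbb U^{p|q}}dz\,d\xi\;\Big(\rho(z)-\sum_i\xi_i\bar\xi_i\Big)^{\nu+q-p-1}\Phi^*\,\Theta .$$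 The super Bergman space $H^2_\nu(\mathbb U^{p|q})$ consists of all $\Psi=\sum_{M\subset Q}\psi_M\xi_M$ with $\psi_M$ holomorphic on $\mathbb U^p$ for which the integral defining $(\Psi|\Psi)$ converges absolutely. For a super function $F=\sum_{I,J}F_{I,J}\,\xi_I\xi_J^*$ the super Toeplitz operator is $T_F^\nu\Psi=P^\nu(F\Psi)$: its domain consists of the $\Psi\in H^2_\nu$ for which $(\Phi|F\Psi)$ converges absolutely for all $\Phi\in H^2_\nu$ and is represented by an element $T_F^\nu\Psi\in H_\nu^2$, i.e. $(\Phi|F\Psi)=(\Phi|T_F^\nu\Psi)$ for all $\Phi\in H^2_\nu$. On $\mathcal L=(l_2(\mathbb Z_+^{p-1},L_2(\mathbb R_+)))^{2^q}$, whose elements are $b=(b_{M,n})_{M\subset Q,\,n\in\mathbb Z_+^{p-1}}$, use the inner product $\sum_M\frac{\Gamma(\nu)}{\Gamma(\nu+|M|)}\sum_n(a_{M,n},b_{M,n})_{L_2(\mathbb R_+)}$. The quasi-parabolic super Bargmann transform $R=R_{\nu,(p|q)}$ and its adjoint are $$(R^*b)(z)=\sum_{M}\Big((2\pi)^{-p/2}\sum_{n}\int_{\mathbb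 R_+}\Big(\tfrac{2(2\pi)^p(2\xi)^{|n|+\nu+|M|-1}}{n!\,\Gamma(\nu+|M|)}\Big)^{1/2}b_{M,n}(\xi)\,(z')^n e^{i\xi z_p}\,d\xi\Big)\xi_M ,$$ $$(R\Psi)_{M,n}(\xi)=(2\pi)^{-p/2}\Big(\tfrac{2(2\pi)^p(2\xi)^{|n|+\nu+|M|-1}}{n!\,\Gamma(\nu+|M|)}\Big)^{1/2}\int_{\mathbb U^p}\psi_M(z)\,\overline{(z')^n}\,e^{-i\xi\overline{z_p}}\;\tfrac{\Gamma(\nu+|M|)}{4\pi^p\Gamma(\nu+|M|-p)}\,\rho(z)^{\nu+|M|-p-1}\,dz ,$$ the last integral being the limit in $L_2(\mathbb R_+)$, as $N\to\infty$, of the absolutely convergent integrals over $|\operatorname{Re}z_p|\le N$. **Theorem.** Let $F=\sum F_{I,J}\,\xi_I\xi_J^*$ be a super function on $\mathbb U^{p|q}$ with bounded measurable components, invariant under the quasi-parabolic group $\mathbb T^{p-1}\times\mathbb R\times\mathbb T^q$ acting by $(t,h,s):(z',z_p,\xi)\mapsto(tz',z_p+h,s\xi)$, so that $F=\sum_I F_I(|z_1|,\dots,|z_{p-1}|,\operatorname{Im}z_p)\,\xi_I\xi_I^*$.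 The series and integrals in the formula for $R^*$ converge absolutely, $R^*$ is an isometric isomorphism of $\mathcal L$ onto $H^2_\nu(\mathbb U^{p|q})$, and $R$ is its inverse. On $R(\operatorname{dom}T_F^\nu)$ the operator $R\,T_F^\nu R^*$ is multiplication by $$\gamma_{F,\nu}(n,\xi,M)=\frac{(2\xi)^{|n|+\nu+|M|-1}}{n!}\sum_{M\subset K\subset Q}\frac{(-1)^{|K\setminus M|}}{\Gamma(\nu+|K|-p)}\int_{\mathbb R_+^p}F_{K\setminus M}(\sqrt r,\,v+\hat r)\,r^n e^{-2\xi(v+\hat r)}\,v^{\nu+|K|-p-1}\,dr\,dv ,$$ where $r=(r_1,\dots,r_{p-1})$, $\sqrt r=(\sqrt{r_1},\dots,\sqrt{r_{p-1}})$, $\hat r=r_1+\dots+r_{p-1}$; these integrals converge absolutely for $\xi>0$. The closure of $T_F^\nu$ is unitarily equivalent via $R$ to the operator of multiplication by $\gamma_{F,\nu}$ on $\mathcal L$ with its maximal domain $\{b\in\mathcal L:\gamma_{F,\nu}b\in\mathcal L\}$. If moreover $\rho^{|I|}F_I$ is bounded on $\mathbb U^p$ for every $I\subset Q$, then $T_F^\nu$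 is defined on all of $H^2_\nu(\mathbb U^{p|q})$, $\gamma_{F,\nu}$ is bounded, and $R\,T_F^\nu R^*=\gamma_{F,\nu}I$ on all of $\mathcal L$. -/

import Mathlib

open MeasureTheory Set Filter Topology

noncomputable section

/-- Points `(z', z_p)` of `ℂ^p = ℂ^(p-1) × ℂ`. -/
abbrev CSpace (p : ℕ) : Type := (Fin (p - 1) → ℂ) × ℂ

/-- The defining function `Im z_p - |z'|²` of the Siegel domain. -/
def siegelHeight {p : ℕ} (z : CSpace p) : ℝ := z.2.im - ∑ k, ‖z.1 k‖ ^ 2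

/-- The Siegel domain `𝕌^p`. -/
def siegelDomain (p : ℕ) : Set (CSpace p) := {z | 0 < siegelHeight z}

/-- The complex Grassmann algebra with generators `ξ_1, …, ξ_q, ξ̄_1, …, ξ̄_q`. -/
abbrev Grassmann (q : ℕ) : Type := ExteriorAlgebra ℂ (Fin q ⊕ Fin q → ℂ)

/-- The generator `ξ_i`. -/
def grXi {q : ℕ} (i : Fin q) : Grassmann q := ExteriorAlgebra.ι ℂ (Pi.single (Sum.inl i) 1)

/-- The generator `ξ̄_i`. -/
def grXiBar {q : ℕ} (i : Fin q) : Grassmann q := ExteriorAlgebra.ι ℂ (Pi.single (Sum.inr i) 1)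

/-- `ξ_I = ξ_{i_1} ⋯ ξ_{i_k}` for `I = {i_1 < ⋯ < i_k}`. -/
def grXiProd {q : ℕ} (I : Finset (Fin q)) : Grassmann q :=
  ((I.sort (· ≤ ·)).map grXi).prod

/-- `ξ_J^* = ξ̄_{j_l} ⋯ ξ̄_{j_1}` for `J = {j_1 < ⋯ < j_l}`. -/
def grXiStar {q : ℕ} (J : Finset (Fin q)) : Grassmann q :=
  ((J.sort (· ≤ ·)).reverse.map grXiBar).prod

/-- The places of `ξ_i` (`Sum.inl i`) and of `ξ̄_i` (`Sum.inr i`) in the word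
`ξ_Q^* ξ_Q = ξ̄_q ⋯ ξ̄_1 ξ_1 ⋯ ξ_q`. -/
def berezinOrder (q : ℕ) : Fin q ⊕ Fin q ≃ Fin (q + q) :=
  (Equiv.sumComm _ _).trans ((Fin.revPerm.sumCongr (Equiv.refl _)).trans finSumFinEquiv)

/-- The Berezin integral over the odd variables: the linear functional that vanishes on all
elements of degree `< 2q` and takes the value `1` on `ξ_Q^* ξ_Q`. -/
def berezin (q : ℕ) : Grassmann q →ₗ[ℂ] ℂ :=
  ExteriorAlgebra.liftAlternating
    (Pi.single (q + q) ((Pi.basisFun ℂ (Fin q ⊕ Fin q)).det.domDomCongr (berezinOrder q)))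

/-- The letters of the word `ξ_Q^* ξ_Q`. -/
def berezinWord (q : ℕ) : Fin (q + q) → (Fin q ⊕ Fin q → ℂ) :=
  Fin.append (fun i => Pi.single (Sum.inr (Fin.rev i)) 1) (fun i => Pi.single (Sum.inl i) 1)

theorem grXiStar_mul_grXiProd_univ (q : ℕ) : grXiStar (Finset.univ : Finset (Fin q)) * grXiProd Finset.univ =
    ExteriorAlgebra.ιMulti ℂ (q + q) (berezinWord q) := by
  have hs : (Finset.univ : Finset (Fin q)).sort (· ≤ ·) = List.finRange q := by
    exact Fin.sort_univ q
  rw [grXiStar, grXiProd, hs, ExteriorAlgebra.ιMulti_apply, ← List.prod_append]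
  congr 1
  have : (fun i => ExteriorAlgebra.ι ℂ (berezinWord q i)) = Fin.append (fun i : Fin q => grXiBar (Fin.rev i)) (fun i => grXi i) := by
    funext i
    refine Fin.addCases (fun j => ?_) (fun j => ?_) i 
    · simp only [berezinWord, Fin.append_left]; rfl
    · simp only [berezinWord, Fin.append_right]; rfl
  rw [this, List.ofFn_fin_append, List.ofFn_eq_map, List.ofFn_eq_map]
  congr 1
  have h : (fun i : Fin q => (grXiBar i.rev : Grassmann q)) = grXiBar ∘ Fin.rev := rfl
  rw [h, ← List.map_map, List.finRange_reverse]

/-- The normalization `∫ dξ ξ_Q^* ξ_Q = 1`. -/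
theorem berezin_top (q : ℕ) : berezin q (grXiStar Finset.univ * grXiProd Finset.univ) = 1 := by
  rw [grXiStar_mul_grXiProd_univ, berezin, ExteriorAlgebra.liftAlternating_apply_ιMulti, Pi.single_eq_same, AlternatingMap.domDomCongr_apply]
  change (Pi.basisFun ℂ (Fin q ⊕ Fin q)).det (berezinWord q ∘ berezinOrder q) = 1
  have : (berezinWord q ∘ berezinOrder q) = Pi.basisFun ℂ (Fin q ⊕ Fin q) := by
    funext i
    rcases i with i | i
    · have : berezinOrder q (Sum.inl i) = Fin.natAdd q i := rfl
      rw [Function.comp_apply, this, berezinWord, Fin.append_right, Pi.basisFun_apply]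
    · have : berezinOrder q (Sum.inr i) = Fin.castAdd q i.rev := rfl
      rw [Function.comp_apply, this, berezinWord, Fin.append_left, Fin.rev_rev, Pi.basisFun_apply]
  rw [this, Module.Basis.det_self]

/-- The power `(ρ - ξ ξ̄)^a`, with `ξ ξ̄ = ∑ ξ_i ξ̄_i`, for real `a` and `ρ > 0`: the (finite)
binomial series in the nilpotent even element `- ξ ξ̄`. -/
def superPow (q : ℕ) (a ρ : ℝ) : Grassmann q :=
  ∑ k ∈ Finset.range (q + 1),
    (((descPochhammer ℝ k).eval a / (k.factorial : ℝ) * ρ ^ (a - k) : ℝ) : ℂ) •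
      (-∑ i : Fin q, grXi i * grXiBar i) ^ k

/-- The components `Ψ_M` of `Ψ = ∑_M Ψ_M ξ_M`. -/
abbrev HolComponents (p q : ℕ) : Type := Finset (Fin q) → CSpace p → ℂ

/-- The components `F_{I,J}` of a super function `F = ∑ F_{I,J} ξ_I ξ_J^*`. -/
abbrev SuperComponents (p q : ℕ) : Type := Finset (Fin q) → Finset (Fin q) → CSpace p → ℂ

/-- The Grassmann valued function `Ψ = ∑_M Ψ_M ξ_M`. -/
def HolComponents.toGrassmann {p q : ℕ} (Ψ : HolComponents p q) (z : CSpace p) : Grassmann q :=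
  ∑ M, Ψ M z • grXiProd M

/-- The Grassmann valued function `Ψ^* = ∑_M conj Ψ_M ξ_M^*`. -/
def HolComponents.starGrassmann {p q : ℕ} (Ψ : HolComponents p q) (z : CSpace p) : Grassmann q :=
  ∑ M, (starRingEnd ℂ) (Ψ M z) • grXiStar M

/-- The Grassmann valued function `F = ∑ F_{I,J} ξ_I ξ_J^*`. -/
def SuperComponents.toGrassmann {p q : ℕ} (F : SuperComponents p q) (z : CSpace p) : Grassmann q :=
  ∑ I, ∑ J, F I J z • (grXiProd I * grXiStar J)

/-- The integrand `∫ dω (Im z_p - |z'|² - ω ω̄)^(ν+q-p-1) Φ^* Θ` (odd variables integrated out). -/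
def superIntegrand {p q : ℕ} (ν : ℝ) (Φ : HolComponents p q) (Θ : CSpace p → Grassmann q)
    (z : CSpace p) : ℂ :=
  berezin q (superPow q (ν + q - p - 1) (siegelHeight z) * Φ.starGrassmann z * Θ z)

/-- The form `(Φ|Θ)` on `𝕌^{p|q}` with parameter `ν`. -/
def superInner {p q : ℕ} (ν : ℝ) (Φ : HolComponents p q) (Θ : CSpace p → Grassmann q) : ℂ :=
  ((Real.Gamma ν / (4 * Real.pi ^ p * Real.Gamma (ν + q - p)) : ℝ) : ℂ) *
    ∫ z in siegelDomain p, superIntegrand ν Φ Θ z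

/-- The super Bergman space `H²_ν(𝕌^{p|q})`: square integrable super holomorphic functions.
A function on `𝕌^p` is represented by its extension by zero. -/
def superBergman (p q : ℕ) (ν : ℝ) : Set (HolComponents p q) :=
  {Ψ | (∀ M, DifferentiableOn ℂ (Ψ M) (siegelDomain p)) ∧
    (∀ M, ∀ z ∉ siegelDomain p, Ψ M z = 0) ∧
    IntegrableOn (superIntegrand ν Ψ Ψ.toGrassmann) (siegelDomain p)}

/-- The graph of the super Toeplitz operator: `T_F^ν Ψ = Θ` means that `Θ ∈ H²_ν` is the
orthogonal projection of `F Ψ`, i.e. that `(Φ|F Ψ)` converges absolutely and equals `(Φ|Θ)`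
for all `Φ ∈ H²_ν`. -/
def IsSuperToeplitz {p q : ℕ} (ν : ℝ) (F : SuperComponents p q) (Ψ Θ : HolComponents p q) : Prop :=
  Ψ ∈ superBergman p q ν ∧ Θ ∈ superBergman p q ν ∧
    ∀ Φ ∈ superBergman p q ν,
      IntegrableOn (superIntegrand ν Φ (fun z => F.toGrassmann z * Ψ.toGrassmann z))
        (siegelDomain p) ∧
      superInner ν Φ (fun z => F.toGrassmann z * Ψ.toGrassmann z) = superInner ν Φ Θ.toGrassmann

/-- Invariance under the action `(t, h, s) : (z', z_p, ξ) ↦ (t z', z_p + h, s ξ)` of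
`𝕋^(p-1) × ℝ × 𝕋^q`; the pull-back multiplies `ξ_I ξ_J^*` by `∏_{i ∈ I} s_i ∏_{j ∈ J} conj s_j`. -/
def IsQuasiParabolic {p q : ℕ} (F : SuperComponents p q) : Prop :=
  ∀ (t : Fin (p - 1) → Circle) (h : ℝ) (s : Fin q → Circle), ∀ z ∈ siegelDomain p, ∀ I J,
    (∏ i ∈ I, (s i : ℂ)) * (∏ j ∈ J, (starRingEnd ℂ) (s j : ℂ)) *
      F I J (fun k => (t k : ℂ) * z.1 k, z.2 + (h : ℂ)) = F I J z

/-- `L_2(ℝ_+)`. -/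
abbrev HalfLineL2 : Type := Lp ℂ 2 (volume.restrict (Ioi (0 : ℝ)))

/-- `(l_2(ℤ_+^(p-1), L_2(ℝ_+)))^(2^q)`. -/
abbrev SeqSpace (p q : ℕ) : Type :=
  Finset (Fin q) → lp (fun _ : Fin (p - 1) → ℕ => HalfLineL2) 2

/-- The weighted inner product of `(l_2(ℤ_+^(p-1), L_2(ℝ_+)))^(2^q)`. -/
def seqInner {p q : ℕ} (ν : ℝ) (a b : SeqSpace p q) : ℂ :=
  ∑ M, ((Real.Gamma ν / Real.Gamma (ν + (M.card : ℝ)) : ℝ) : ℂ) * inner ℂ (a M) (b M)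

/-- The factor `(2π)^(-p/2) (2 (2π)^p (2ξ)^(|n|+ν-1) / (n! Γ(ν)))^(1/2)`. -/
def bargmannFactor (p : ℕ) (ν : ℝ) (n : Fin (p - 1) → ℕ) (ξ : ℝ) : ℝ :=
  (2 * Real.pi) ^ (-(p : ℝ) / 2) *
    Real.sqrt (2 * (2 * Real.pi) ^ p * (2 * ξ) ^ (((∑ k, n k : ℕ) : ℝ) + ν - 1) /
      (((∏ k, (n k).factorial : ℕ) : ℝ) * Real.Gamma ν))

/-- The integrand of the `(M, n)` term of the adjoint super Bargmann transform. -/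
def bargmannAdjIntegrand {p q : ℕ} (ν : ℝ) (b : SeqSpace p q) (M : Finset (Fin q))
    (n : Fin (p - 1) → ℕ) (z : CSpace p) (ξ : ℝ) : ℂ :=
  (bargmannFactor p (ν + M.card) n ξ : ℂ) * (b M n : ℝ → ℂ) ξ * (∏ k, z.1 k ^ n k) *
    Complex.exp (Complex.I * ξ * z.2)

open Classical in
/-- The adjoint quasi-parabolic super Bargmann transform `R_{ν,(p|q)}^*`. -/
def bargmannAdj {p q : ℕ} (ν : ℝ) (b : SeqSpace p q) : HolComponents p q := fun M z =>
  if z ∈ siegelDomain p then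
    ∑' n : Fin (p - 1) → ℕ, ∫ ξ in Ioi (0 : ℝ), bargmannAdjIntegrand ν b M n z ξ
  else 0

/-- The integrand of the quasi-parabolic super Bargmann transform, including the density of the
weighted measure with parameter `ν + |M|`. -/
def bargmannIntegrand {p q : ℕ} (ν : ℝ) (Ψ : HolComponents p q) (M : Finset (Fin q))
    (n : Fin (p - 1) → ℕ) (ξ : ℝ) (z : CSpace p) : ℂ :=
  Ψ M z * (∏ k, (starRingEnd ℂ) (z.1 k) ^ n k) *
    Complex.exp (-(Complex.I * ξ * (starRingEnd ℂ) z.2)) *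
    ((Real.Gamma (ν + M.card) / (4 * Real.pi ^ p * Real.Gamma (ν + M.card - p)) *
      siegelHeight z ^ (ν + M.card - p - 1) : ℝ) : ℂ)

/-- The part `|Re z_p| ≤ N` of the Siegel domain. -/
def siegelTrunc (p : ℕ) (N : ℝ) : Set (CSpace p) := siegelDomain p ∩ {z | |z.2.re| ≤ N}

/-- The integral defining the super Bargmann transform, over `|Re z_p| ≤ N`. -/
def bargmannTrunc {p q : ℕ} (ν : ℝ) (Ψ : HolComponents p q) (N : ℝ) (M : Finset (Fin q))
    (n : Fin (p - 1) → ℕ) (ξ : ℝ) : ℂ :=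
  (bargmannFactor p (ν + M.card) n ξ : ℂ) *
    ∫ z in siegelTrunc p N, bargmannIntegrand ν Ψ M n ξ z

/-- `b = R_{ν,(p|q)} Ψ`. As for the Fourier transform on `L_2(ℝ)`, the integral over `𝕌^p` is the
limit in `L_2(ℝ_+)` of the absolutely convergent integrals over `|Re z_p| ≤ N`. -/
def IsBargmannTransform {p q : ℕ} (ν : ℝ) (Ψ : HolComponents p q) (b : SeqSpace p q) : Prop :=
  ∀ M n, (∀ N : ℝ, ∀ ξ > (0 : ℝ), IntegrableOn (bargmannIntegrand ν Ψ M n ξ) (siegelTrunc p N)) ∧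
    Tendsto (fun N : ℝ => eLpNorm (fun ξ => bargmannTrunc ν Ψ N M n ξ - (b M n : ℝ → ℂ) ξ) 2
      (volume.restrict (Ioi (0 : ℝ)))) atTop (𝓝 0)

/-- `ℝ_+^p`, with points `(r, v)`, `r ∈ ℝ_+^(p-1)`, `v ∈ ℝ_+`. -/
def posOrthant (p : ℕ) : Set ((Fin (p - 1) → ℝ) × ℝ) := {x | (∀ k, 0 < x.1 k) ∧ 0 < x.2}

/-- The integrand `F_I(√r, v + r̂) r^n e^{-2ξ(v + r̂)} v^(a-1)` with `r̂ = r_1 + ⋯ + r_{p-1}`, where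
`F_I(ρ, y)` is the value of `F_{I,I}` at any point with `|z_k| = ρ_k`, `Im z_p = y`. -/
def gammaIntegrand {p q : ℕ} (F : SuperComponents p q) (I : Finset (Fin q)) (a : ℝ)
    (n : Fin (p - 1) → ℕ) (ξ : ℝ) (x : (Fin (p - 1) → ℝ) × ℝ) : ℂ :=
  F I I (fun k => (Real.sqrt (x.1 k) : ℂ), Complex.I * ((x.2 + ∑ k, x.1 k : ℝ) : ℂ)) *
    (((∏ k, x.1 k ^ n k) * Real.exp (-2 * ξ * (x.2 + ∑ k, x.1 k)) * x.2 ^ (a - 1) : ℝ) : ℂ)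

/-- The multiplier `γ_{F,ν}(n, ξ, M)`. -/
def gammaSymbol {p q : ℕ} (ν : ℝ) (F : SuperComponents p q) (n : Fin (p - 1) → ℕ) (ξ : ℝ)
    (M : Finset (Fin q)) : ℂ :=
  (((2 * ξ) ^ (((∑ k, n k : ℕ) : ℝ) + ν + M.card - 1) / ((∏ k, (n k).factorial : ℕ) : ℝ) : ℝ) : ℂ) *
    ∑ K ∈ Finset.univ.filter (fun K : Finset (Fin q) => M ⊆ K),
      (((-1) ^ (K \ M).card / Real.Gamma (ν + K.card - p) : ℝ) : ℂ) *
        ∫ x in posOrthant p, gammaIntegrand F (K \ M) (ν + K.card - p) n ξ x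

/-- The graph of the (maximal) operator of multiplication by `γ_{F,ν}`. -/
def multiplicationGraph {p q : ℕ} (ν : ℝ) (F : SuperComponents p q) :
    Set (SeqSpace p q × SeqSpace p q) :=
  {x | ∀ M n, (x.2 M n : ℝ → ℂ) =ᵐ[volume.restrict (Ioi (0 : ℝ))]
    fun ξ => gammaSymbol ν F n ξ M * (x.1 M n : ℝ → ℂ) ξ}

/-- The graph of `R_{ν,(p|q)} T_F^ν R_{ν,(p|q)}^*`. -/
def transformedToeplitzGraph {p q : ℕ} (ν : ℝ) (F : SuperComponents p q) :
    Set (SeqSpace p q × SeqSpace p q) :=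
  {x | IsSuperToeplitz ν F (bargmannAdj ν x.1) (bargmannAdj ν x.2)}

end

/-! Odd variables. The products ξ̄_i ξ_i are central and square to zero, so (ρ - ξξ̄)^a is a
polynomial in them, and the Berezin integral pairs φ_M only with ψ_M. Invariance leaves F only its
diagonal components, and ξ_I ξ_I^* is again a signed product of the ξ̄_i ξ_i. Hence everything
splits over M ⊂ Q (`superIntegrand_mul`): the super Bergman space is a sum of ordinary weighted
Bergman spaces with parameters l = ν + |M|, and T_F acts on the M-th summand through the form of a
scalar symbol `toeplitzSymbol` that depends only on the |z_k| and on Im z_p.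

One component. Let T be the M-th component of R^*. Evaluation of Tb at z is the inner product with a
vector κ_z of squared norm at most ρ(z)^(-l) (`compAdj_eq_inner`), so convergence is Cauchy-Schwarz,
and questions of holomorphy and norm reduce to vectors with one nonzero coordinate supported in a
compact band of frequencies. On these, Plancherel in Re z_p and rotation of the z_k diagonalise
every form ∫ conj(Ta) Tb σ with invariant σ (`core_single`); the multiplier `specGamma` is a Laplace
type integral. When σ is the weight, Euler's Gamma integral gives the multiplier 1, so T is
isometric.

T is onto because a holomorphic g orthogonal to its range vanishes (`eq_zero_of_orthogonal`). The
function Tκ_w is the explicit Bergman kernel. A Heisenberg translation takes (0, iρ(w)) to w, and in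
the translated variable the kernel depends on z_p alone. The mean value property in z', and then in
the unit disc after a Cayley transform, turns the orthogonality to Tκ_w into g(w) = 0. The integral
formula for R is T^* applied to the restriction to |Re z_p| ≤ N, where Fubini is available.

Toeplitz operators. If c represents the form of b, testing with band-limited vectors and moving the
conjugate symbol onto them gives c = γb, with no regularity of b (`IsCompToeplitz.ae_eq`).
Conversely band-limited vectors lie in the domain, and frequency cut-offs commute with
multiplication, so the graph of the maximal multiplication operator lies in the closure
(`mem_closure_compToeplitzGraph`); that graph is closed, hence equals the closure. If the ρ^|I| F_I
are bounded, the symbol is at most a constant times the weight w: then σ Tb / w is square integrable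
for every b, its projection gives T_F, and γ is bounded by comparison with the multiplier 1 of the
weight. -/

noncomputable section

/-! ### Grassmann algebra: splitting of the Berezin integral over the components. -/

section Grassmann

open ExteriorAlgebra

variable {q : ℕ}

/-- The part of degree n is spanned by n-fold products of vectors, and the alternating family
defining `berezin` is zero except in degree 2q. -/
theorem berezin_eq_zero_of_mem_pow {n : ℕ} (hn : n ≠ q + q) {x : Grassmann q}
    (hx : x ∈ LinearMap.range (ι ℂ : (Fin q ⊕ Fin q → ℂ) →ₗ[ℂ] Grassmann q) ^ n) :
    berezin q x = 0 := by
  have hs := ιMulti_span_fixedDegree ℂ (M := Fin q ⊕ Fin q → ℂ) n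
  change x ∈ ⋀[ℂ]^n (Fin q ⊕ Fin q → ℂ) at hx
  rw [← hs] at hx
  induction hx using Submodule.span_induction with
  | mem x h =>
    obtain ⟨v, rfl⟩ := h
    rw [berezin, liftAlternating_apply_ιMulti, Pi.single_eq_of_ne hn]
    rfl
  | zero => exact map_zero _
  | add x y _ _ h1 h2 => rw [map_add, h1, h2, add_zero]
  | smul a x _ h => rw [map_smul, h, smul_zero]

theorem exteriorAlgebra_ι_mul_comm {V : Type*} [AddCommGroup V] [Module ℂ V] (v w : V) :
    ι ℂ v * ι ℂ w = -(ι ℂ w * ι ℂ v) := by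
  rw [eq_neg_iff_add_eq_zero]
  exact ι_add_mul_swap v w

/-- A vector that passes a product of two vectors changes sign twice. -/
theorem ι_mul_ι_mem_center {V : Type*} [AddCommGroup V] [Module ℂ V] (a b : V) :
    ι ℂ a * ι ℂ b ∈ Subalgebra.center ℂ (ExteriorAlgebra ℂ V) := by
  rw [Subalgebra.mem_center_iff]
  intro x
  induction x using ExteriorAlgebra.induction with
  | algebraMap r => exact Algebra.commutes r _
  | ι v =>
    rw [← mul_assoc, exteriorAlgebra_ι_mul_comm v a, mul_assoc, neg_mul, mul_assoc,
      exteriorAlgebra_ι_mul_comm v b]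
    simp
  | mul x y hx hy => rw [mul_assoc, hy, ← mul_assoc, hx, mul_assoc]
  | add x y hx hy => rw [add_mul, mul_add, hx, hy]

/-- The central element `ξ̄_i ξ_i`. -/
def grPair (i : Fin q) : Subalgebra.center ℂ (Grassmann q) :=
  ⟨grXiBar i * grXi i, ι_mul_ι_mem_center _ _⟩

theorem grXi_mul_self (i : Fin q) : grXi i * grXi i = 0 := ι_sq_zero _

theorem grXiBar_mul_self (i : Fin q) : grXiBar i * grXiBar i = 0 := ι_sq_zero _

theorem grXi_mul_grXiBar (i : Fin q) : grXi i * grXiBar i = -(grPair i : Grassmann q) :=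
  exteriorAlgebra_ι_mul_comm _ _

theorem grPair_comm (i : Fin q) (x : Grassmann q) :
    (grPair i : Grassmann q) * x = x * grPair i :=
  (Subalgebra.mem_center_iff.1 (grPair i).2 x).symm

theorem grPair_mul_grXi (i : Fin q) : (grPair i : Grassmann q) * grXi i = 0 := by
  rw [grPair, mul_assoc, grXi_mul_self, mul_zero]

theorem grPair_mul_grXiBar (i : Fin q) : (grPair i : Grassmann q) * grXiBar i = 0 := by
  rw [grPair_comm, grPair, ← mul_assoc, grXiBar_mul_self, zero_mul]

theorem grPair_sq (i : Fin q) : grPair i * grPair i = 0 := by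
  apply Subtype.ext
  change (grPair i : Grassmann q) * (grXiBar i * grXi i) = 0
  rw [← mul_assoc, grPair_mul_grXiBar, zero_mul]

/-- The central element `∏_{i ∈ L} ξ̄_i ξ_i`. -/
def grPairs (L : Finset (Fin q)) : Subalgebra.center ℂ (Grassmann q) := ∏ i ∈ L, grPair i

theorem grPairs_comm (L : Finset (Fin q)) (x : Grassmann q) :
    (grPairs L : Grassmann q) * x = x * grPairs L :=
  (Subalgebra.mem_center_iff.1 (grPairs L).2 x).symm

theorem grPairs_eq_list (L : Finset (Fin q)) :
    grPairs L = ((L.sort (· ≤ ·)).map grPair).prod := by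
  rw [grPairs, ← List.prod_toFinset _ (Finset.sort_nodup _ _), Finset.sort_toFinset]

/-- Reversing the order in ξ_M^* makes the product nested: the innermost pair ξ̄_a ξ_a is adjacent,
central, and can be pulled out without a sign. -/
theorem grXiStar_mul_grXiProd_self (M : Finset (Fin q)) :
    grXiStar M * grXiProd M = (grPairs M : Grassmann q) := by
  rw [grPairs_eq_list, grXiStar, grXiProd]
  induction M.sort (· ≤ ·) with
  | nil => simp
  | cons a t ih =>
    simp only [List.reverse_cons, List.map_append, List.prod_append, List.map_cons, List.map_nil,
      List.prod_cons, List.prod_nil, mul_one]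
    have : ((t.reverse.map grXiBar).prod * grXiBar a) * (grXi a * (t.map grXi).prod) =
        (grPair a : Grassmann q) * ((t.reverse.map grXiBar).prod * (t.map grXi).prod) := by
      rw [← mul_assoc (grPair a : Grassmann q), grPair_comm, grPair]
      simp only [mul_assoc]
    rw [this, ih]
    rfl

/-- The same nesting, but each adjacent pair is now ξ_a ξ̄_a = -ξ̄_a ξ_a. This is the origin of the
sign (-1)^|K \ M| in the multiplier. -/
theorem grXiProd_mul_grXiStar_self (M : Finset (Fin q)) :
    grXiProd M * grXiStar M = (-1 : ℂ) ^ M.card • (grPairs M : Grassmann q) := by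
  rw [grPairs_eq_list, grXiStar, grXiProd, ← Finset.length_sort (· ≤ ·)]
  induction M.sort (· ≤ ·) with
  | nil => simp
  | cons a t ih =>
    simp only [List.reverse_cons, List.map_append, List.prod_append, List.map_cons, List.map_nil,
      List.prod_cons, List.prod_nil, mul_one]
    have h1 : grXi a * (t.map grXi).prod * ((t.reverse.map grXiBar).prod * grXiBar a) =
        grXi a * ((t.map grXi).prod * (t.reverse.map grXiBar).prod) * grXiBar a := by
      simp only [mul_assoc]
    rw [h1, ih, mul_smul_comm, smul_mul_assoc]
    have h2 := Subalgebra.mem_center_iff.1 (t.map grPair).prod.2 (grXi a)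
    rw [h2, mul_assoc, grXi_mul_grXiBar, List.length_cons, pow_succ, mul_neg, smul_neg]
    rw [mul_smul, neg_one_smul, smul_neg, ← grPair_comm]
    rfl

theorem grPair_mul_list_bar {i : Fin q} {l : List (Fin q)} (h : i ∈ l) :
    (grPair i : Grassmann q) * (l.map grXiBar).prod = 0 := by
  induction l with
  | nil => simp at h
  | cons a t ih =>
    rw [List.map_cons, List.prod_cons]
    rcases List.mem_cons.1 h with rfl | h
    · rw [← mul_assoc, grPair_mul_grXiBar, zero_mul]
    · rw [← mul_assoc, grPair_comm, mul_assoc, ih h, mul_zero]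

theorem grPair_mul_list_xi {i : Fin q} {l : List (Fin q)} (h : i ∈ l) :
    (grPair i : Grassmann q) * (l.map grXi).prod = 0 := by
  induction l with
  | nil => simp at h
  | cons a t ih =>
    rw [List.map_cons, List.prod_cons]
    rcases List.mem_cons.1 h with rfl | h
    · rw [← mul_assoc, grPair_mul_grXi, zero_mul]
    · rw [← mul_assoc, grPair_comm, mul_assoc, ih h, mul_zero]

theorem grPairs_eq_mul_of_mem {i : Fin q} {L : Finset (Fin q)} (h : i ∈ L) :
    (grPairs L : Grassmann q) = grPairs (L.erase i) * grPair i := by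
  rw [grPairs, ← Finset.prod_erase_mul _ _ h]
  rfl

theorem grPairs_mul_grXiStar {L M : Finset (Fin q)} (h : ¬Disjoint L M) :
    (grPairs L : Grassmann q) * grXiStar M = 0 := by
  obtain ⟨i, hL, hM⟩ := Finset.not_disjoint_iff.1 h
  rw [grPairs_eq_mul_of_mem hL, mul_assoc, grXiStar, grPair_mul_list_bar (by simpa using hM),
    mul_zero]

theorem grPairs_mul_grXiProd {L M : Finset (Fin q)} (h : ¬Disjoint L M) :
    (grPairs L : Grassmann q) * grXiProd M = 0 := by
  obtain ⟨i, hL, hM⟩ := Finset.not_disjoint_iff.1 h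
  rw [grPairs_eq_mul_of_mem hL, mul_assoc, grXiProd, grPair_mul_list_xi (by simpa using hM),
    mul_zero]

theorem grPairs_mul_grPairs {L M : Finset (Fin q)} (h : Disjoint L M) :
    grPairs L * grPairs M = grPairs (L ∪ M) := (Finset.prod_union h).symm

theorem grPairs_mul_grPairs_of_not_disjoint {L M : Finset (Fin q)} (h : ¬Disjoint L M) :
    (grPairs L : Grassmann q) * grPairs M = 0 := by
  rw [← grXiStar_mul_grXiProd_self M, ← mul_assoc, grPairs_mul_grXiStar h, zero_mul]

theorem list_prod_mem_range_pow {f : Fin q → Grassmann q}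
    (hf : ∀ i, f i ∈ LinearMap.range (ι ℂ : (Fin q ⊕ Fin q → ℂ) →ₗ[ℂ] Grassmann q))
    (l : List (Fin q)) : (l.map f).prod ∈
      LinearMap.range (ι ℂ : (Fin q ⊕ Fin q → ℂ) →ₗ[ℂ] Grassmann q) ^ l.length := by
  induction l with
  | nil => simp [Submodule.one_eq_range]
  | cons a t ih =>
    rw [List.map_cons, List.prod_cons, List.length_cons, pow_succ']
    exact Submodule.mul_mem_mul (hf a) ih

theorem grXiProd_mem (M : Finset (Fin q)) : grXiProd M ∈
    LinearMap.range (ι ℂ : (Fin q ⊕ Fin q → ℂ) →ₗ[ℂ] Grassmann q) ^ M.card := by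
  rw [← Finset.length_sort (· ≤ ·)]
  exact list_prod_mem_range_pow (fun i => ⟨_, rfl⟩) _

theorem grXiStar_mem (M : Finset (Fin q)) : grXiStar M ∈
    LinearMap.range (ι ℂ : (Fin q ⊕ Fin q → ℂ) →ₗ[ℂ] Grassmann q) ^ M.card := by
  rw [← Finset.length_sort (· ≤ ·), ← List.length_reverse]
  exact list_prod_mem_range_pow (fun i => ⟨_, rfl⟩) _

/-- If L meets M or M', some generator occurs twice and the product vanishes; otherwise a degree
count decides. -/
theorem berezin_grPairs_mul (L M M' : Finset (Fin q)) :
    berezin q ((grPairs L : Grassmann q) * grXiStar M * grXiProd M') =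
      if L = Mᶜ ∧ M = M' then 1 else 0 := by
  by_cases hc : L = Mᶜ ∧ M = M'
  · obtain ⟨rfl, rfl⟩ := hc
    rw [if_pos ⟨rfl, rfl⟩, mul_assoc, grXiStar_mul_grXiProd_self]
    have : (grPairs Mᶜ : Grassmann q) * (grPairs M : Grassmann q) =
        (grPairs (Finset.univ : Finset (Fin q)) : Grassmann q) := by
      have h : grPairs Mᶜ * grPairs M = grPairs (Finset.univ : Finset (Fin q)) := by
        rw [grPairs_mul_grPairs (disjoint_compl_left), Finset.union_comm, Finset.union_compl]
      rw [← h]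
      rfl
    rw [this, ← grXiStar_mul_grXiProd_self, berezin_top]
  rw [if_neg hc]
  by_cases h1 : Disjoint L M
  swap
  · rw [grPairs_mul_grXiStar h1, zero_mul, map_zero]
  by_cases h2 : Disjoint L M'
  swap
  · rw [grPairs_comm, mul_assoc, grPairs_mul_grXiProd h2, mul_zero, map_zero]
  have hmem := Submodule.mul_mem_mul (Submodule.mul_mem_mul (Submodule.mul_mem_mul
    (grXiStar_mem L) (grXiProd_mem L)) (grXiStar_mem M)) (grXiProd_mem M')
  rw [grXiStar_mul_grXiProd_self, ← pow_add, ← pow_add, ← pow_add] at hmem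
  -- In degree 2q both bounds |L ∪ M| ≤ q and |L ∪ M'| ≤ q are equalities, as the two cardinalities
  -- add up to 2|L| + |M| + |M'|. So M and M' are both the complement of L.
  refine berezin_eq_zero_of_mem_pow (fun h => hc ?_) hmem
  have c1 := Finset.card_union_of_disjoint h1
  have c2 := Finset.card_union_of_disjoint h2
  have d1 : (L ∪ M).card ≤ q := by simpa using Finset.card_le_univ (L ∪ M)
  have d2 : (L ∪ M').card ≤ q := by simpa using Finset.card_le_univ (L ∪ M')
  have e1 : L ∪ M = Finset.univ := by
    rw [← Finset.card_eq_iff_eq_univ, Fintype.card_fin]; omega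
  have e2 : L ∪ M' = Finset.univ := by
    rw [← Finset.card_eq_iff_eq_univ, Fintype.card_fin]; omega
  have f1 : IsCompl L M := ⟨h1, codisjoint_iff.2 e1⟩
  have f2 : IsCompl L M' := ⟨h2, codisjoint_iff.2 e2⟩
  exact ⟨f1.eq_compl, f1.compl_eq.symm.trans f2.compl_eq⟩

/-- Multinomial expansion: products with a repeated factor vanish, and a product over a k-element
set L arises from its k! orderings. -/
theorem sum_pow_of_sq_zero {R ι : Type*} [CommRing R] [DecidableEq ι] (s : Finset ι) (e : ι → R)
    (he : ∀ i, e i * e i = 0) (k : ℕ) :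
    (∑ i ∈ s, e i) ^ k = (k.factorial : R) * ∑ L ∈ s.powersetCard k, ∏ i ∈ L, e i := by
  induction s using Finset.induction_on generalizing k with
  | empty =>
    cases k with
    | zero => simp
    | succ k => simp [Finset.powersetCard_eq_empty.2 (show (∅ : Finset ι).card < k + 1 by simp)]
  | insert a s ha ih =>
    cases k with
    | zero => simp
    | succ k =>
      -- As e_a² = 0, only two terms of the binomial expansion survive.
      have hb : ∀ n : ℕ, (e a + ∑ i ∈ s, e i) ^ (n + 1) =
          (∑ i ∈ s, e i) ^ (n + 1) + (n + 1) * e a * (∑ i ∈ s, e i) ^ n := by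
        intro n
        induction n with
        | zero => ring
        | succ n ih =>
          rw [pow_succ, ih]
          push_cast
          linear_combination ((n + 1) * (∑ i ∈ s, e i) ^ n) * he a
      rw [Finset.sum_insert ha, hb, ih, ih, Finset.powersetCard_succ_insert ha,
        Finset.sum_union, Finset.sum_image]
      · have : ∀ L ∈ s.powersetCard k, ∏ i ∈ insert a L, e i = e a * ∏ i ∈ L, e i := by
          intro L hL
          exact Finset.prod_insert fun h => ha ((Finset.mem_powersetCard.1 hL).1 h)
        rw [Finset.sum_congr rfl this, ← Finset.mul_sum, Nat.factorial_succ]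
        push_cast
        ring
      · intro L hL L' hL' h
        have h1 : a ∉ L := fun h => ha ((Finset.mem_powersetCard.1 hL).1 h)
        have h2 : a ∉ L' := fun h => ha ((Finset.mem_powersetCard.1 hL').1 h)
        rw [← Finset.erase_insert h1, ← Finset.erase_insert h2, h]
      · rw [Finset.disjoint_left]
        intro L hL hL'
        obtain ⟨L', _, rfl⟩ := Finset.mem_image.1 hL'
        exact ha ((Finset.mem_powersetCard.1 hL).1 (Finset.mem_insert_self _ _))

/-- The coefficient of `∏_{i ∈ L} ξ̄_i ξ_i` with `|L| = k` in `(ρ - ξ ξ̄)^a`. -/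
def superPowCoeff (a ρ : ℝ) (k : ℕ) : ℝ := (descPochhammer ℝ k).eval a * ρ ^ (a - k)

/-- Here -ξξ̄ = ∑ ξ̄_i ξ_i, and the k! of `sum_pow_of_sq_zero` cancels the denominator of the
binomial coefficient. -/
theorem superPow_eq_sum (a ρ : ℝ) :
    superPow q a ρ = ∑ L : Finset (Fin q), ((superPowCoeff a ρ L.card : ℝ) : ℂ) •
      (grPairs L : Grassmann q) := by
  have h1 : (-∑ i : Fin q, grXi i * grXiBar i) =
      ((∑ i : Fin q, grPair i : Subalgebra.center ℂ (Grassmann q)) : Grassmann q) := by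
    rw [AddSubmonoidClass.coe_finsetSum, ← Finset.sum_neg_distrib]
    simp only [grXi_mul_grXiBar, neg_neg]
  have h2 : ∀ k, (-∑ i : Fin q, grXi i * grXiBar i) ^ k =
      (k.factorial : ℂ) • ∑ L ∈ (Finset.univ : Finset (Fin q)).powersetCard k,
        (grPairs L : Grassmann q) := by
    intro k
    rw [h1, ← SubmonoidClass.coe_pow, sum_pow_of_sq_zero _ _ grPair_sq]
    rw [← nsmul_eq_mul, AddSubmonoidClass.coe_nsmul, AddSubmonoidClass.coe_finsetSum,
      Nat.cast_smul_eq_nsmul]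
    rfl
  have h3 : (Finset.univ : Finset (Finset (Fin q))) = (Finset.range (q + 1)).biUnion
      fun k => (Finset.univ : Finset (Fin q)).powersetCard k := by
    ext L
    simp only [Finset.mem_univ, Finset.mem_biUnion, Finset.mem_range, Finset.mem_powersetCard_univ,
      true_iff]
    exact ⟨L.card, Nat.lt_succ_of_le (by simpa using Finset.card_le_univ L), rfl⟩
  rw [superPow, h3, Finset.sum_biUnion]
  · refine Finset.sum_congr rfl fun k _ => ?_
    rw [h2, smul_smul, Finset.smul_sum]
    refine Finset.sum_congr rfl fun L hL => ?_
    rw [(Finset.mem_powersetCard_univ.1 hL), superPowCoeff]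
    congr 1
    have : (k.factorial : ℝ) ≠ 0 := Nat.cast_ne_zero.2 k.factorial_ne_zero
    norm_cast
    field_simp
  · intro k _ k' _ hk
    exact Finset.disjoint_left.2 fun L h h' =>
      hk ((Finset.mem_powersetCard_univ.1 h).symm.trans (Finset.mem_powersetCard_univ.1 h'))

/-- The integral survives exactly when M = M' and L, I, M partition Q. In terms of K = Lᶜ this reads
M ⊆ K, I = K \ M, which is the index set of the sum in the multiplier. -/
theorem berezin_grPairs_mul_grPairs (L I M M' : Finset (Fin q)) :
    berezin q ((grPairs L : Grassmann q) * grXiStar M *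
      ((grPairs I : Grassmann q) * grXiProd M')) =
      if (M ⊆ Lᶜ ∧ I = Lᶜ \ M) ∧ M = M' then 1 else 0 := by
  have h0 : (grPairs L : Grassmann q) * grXiStar M * ((grPairs I : Grassmann q) * grXiProd M') =
      ((grPairs L : Grassmann q) * grPairs I) * grXiStar M * grXiProd M' := by
    rw [← mul_assoc, mul_assoc (grPairs L : Grassmann q) (grXiStar M), ← grPairs_comm I]
    simp only [mul_assoc]
  rw [h0]
  by_cases hd : Disjoint L I
  · have h1 : (grPairs L : Grassmann q) * grPairs I = grPairs (L ∪ I) := by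
      rw [← grPairs_mul_grPairs hd]; rfl
    rw [h1, berezin_grPairs_mul]
    congr 2
    rw [eq_iff_iff]
    constructor
    · intro h
      have h' : ∀ i, (i ∈ L ∨ i ∈ I) ↔ i ∉ M := by
        intro i; rw [← Finset.mem_union, h, Finset.mem_compl]
      have hd' : ∀ i, i ∈ L → i ∉ I := fun i hi hi' => Finset.disjoint_left.1 hd hi hi'
      refine ⟨fun i hi => ?_, ?_⟩
      · have := h' i; have := hd' i; simp; tauto
      · ext i; have := h' i; have := hd' i; simp; tauto
    · rintro ⟨h, rfl⟩
      ext i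
      have := @h i
      simp at this ⊢; tauto
  · rw [grPairs_mul_grPairs_of_not_disjoint hd, zero_mul, zero_mul, map_zero, if_neg]
    rintro ⟨⟨_, rfl⟩, _⟩
    exact hd (Finset.disjoint_left.2 fun i hi => by simp [hi])

/-- The function `S_M` with `∫ dξ (ρ - ξξ̄)^a Φ^* F Ψ = ∑_M conj φ_M ψ_M S_M`, for a super function
`F` with vanishing off-diagonal components. -/
def componentSymbol {p : ℕ} (ν : ℝ) (F : SuperComponents p q) (M : Finset (Fin q))
    (z : CSpace p) : ℂ :=
  ∑ K ∈ Finset.univ.filter (fun K : Finset (Fin q) => M ⊆ K),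
    (((-1) ^ (K \ M).card * superPowCoeff (ν + q - p - 1) (siegelHeight z) (Kᶜ).card : ℝ) : ℂ) *
      F (K \ M) (K \ M) z

/-- The weight and F are combinations of central products, so only the pairings of ξ_M^* with ξ_M
contribute: the components of Φ and Ψ decouple. -/
theorem superIntegrand_mul {p : ℕ} (ν : ℝ) (F : SuperComponents p q) (Φ Ψ : HolComponents p q)
    (z : CSpace p) (hF : ∀ I J, I ≠ J → F I J z = 0) :
    superIntegrand ν Φ (fun z => F.toGrassmann z * Ψ.toGrassmann z) z =
      ∑ M, (starRingEnd ℂ) (Φ M z) * Ψ M z * componentSymbol ν F M z := by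
  have h1 : F.toGrassmann z = ∑ I, (F I I z * (-1) ^ I.card) • (grPairs I : Grassmann q) := by
    refine Finset.sum_congr rfl fun I _ => ?_
    rw [Finset.sum_eq_single I (fun J _ h => by rw [hF I J h.symm, zero_smul]) (by simp),
      grXiProd_mul_grXiStar_self, smul_smul]
  rw [superIntegrand, superPow_eq_sum, h1, HolComponents.toGrassmann, HolComponents.starGrassmann]
  simp only [Finset.sum_mul, Finset.mul_sum, smul_mul_assoc, mul_smul_comm, map_sum, map_smul,
    berezin_grPairs_mul_grPairs, smul_eq_mul, componentSymbol]
  -- The sum over the factor L of the weight is rewritten as a sum over K = Lᶜ.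
  have h2 : ∀ (f : Finset (Fin q) → ℂ), ∑ L, f L = ∑ K, f Kᶜ := fun f =>
    ((Equiv.mk compl compl compl_compl compl_compl : Equiv.Perm (Finset (Fin q))).sum_comp f).symm
  refine Finset.sum_congr rfl fun M _ => ?_
  rw [Finset.sum_comm, Finset.sum_eq_single M]
  rotate_left
  · intro M' _ h
    refine Finset.sum_eq_zero fun I _ => Finset.sum_eq_zero fun L _ => ?_
    rw [if_neg (fun h' => h h'.2)]
    simp
  · simp
  rw [Finset.sum_comm, h2, Finset.sum_filter]
  refine Finset.sum_congr rfl fun K _ => ?_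
  simp only [compl_compl, and_true]
  by_cases hK : M ⊆ K
  · rw [Finset.sum_eq_single (K \ M), if_pos hK, if_pos ⟨hK, rfl⟩]
    · push_cast
      ring
    · intro I _ h
      rw [if_neg (fun h' => h h'.2)]
      simp
    · simp
  · rw [if_neg hK]
    refine Finset.sum_eq_zero fun I _ => ?_
    rw [if_neg (fun h' => hK h'.1)]
    simp

/-- The super function `1`. -/
def SuperComponents.unit (p q : ℕ) : SuperComponents p q :=
  fun I J _ => if I = ∅ ∧ J = ∅ then 1 else 0

theorem SuperComponents.unit_toGrassmann {p : ℕ} (z : CSpace p) :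
    (SuperComponents.unit p q).toGrassmann z = 1 := by
  rw [SuperComponents.toGrassmann, Finset.sum_eq_single ∅, Finset.sum_eq_single ∅]
  · simp [SuperComponents.unit, grXiProd, grXiStar]
  · intro J _ h
    simp [SuperComponents.unit, h]
  · simp
  · intro I _ h
    simp [SuperComponents.unit, h]
  · simp

theorem componentSymbol_unit {p : ℕ} (ν : ℝ) (M : Finset (Fin q)) (z : CSpace p) :
    componentSymbol ν (SuperComponents.unit p q) M z =
      ((superPowCoeff (ν + q - p - 1) (siegelHeight z) (Mᶜ).card : ℝ) : ℂ) := by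
  rw [componentSymbol, Finset.sum_eq_single M]
  · simp [SuperComponents.unit]
  · intro K hK h
    have hne : K \ M ≠ ∅ := fun h' => h (Finset.Subset.antisymm
      (Finset.sdiff_eq_empty_iff_subset.1 h') (Finset.mem_filter.1 hK).2)
    simp [SuperComponents.unit, hne]
  · intro h
    exact absurd (Finset.mem_filter.2 ⟨Finset.mem_univ _, Finset.Subset.refl _⟩) h

theorem superIntegrand_toGrassmann {p : ℕ} (ν : ℝ) (Φ Ψ : HolComponents p q) (z : CSpace p) :
    superIntegrand ν Φ Ψ.toGrassmann z =
      ∑ M, (starRingEnd ℂ) (Φ M z) * Ψ M z *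
        ((superPowCoeff (ν + q - p - 1) (siegelHeight z) (Mᶜ).card : ℝ) : ℂ) := by
  have h := superIntegrand_mul ν (SuperComponents.unit p q) Φ Ψ z (fun I J h => by
    rw [SuperComponents.unit, if_neg]
    rintro ⟨rfl, rfl⟩
    exact h rfl)
  simp only [componentSymbol_unit] at h
  rw [← h, superIntegrand, superIntegrand, SuperComponents.unit_toGrassmann, one_mul]

theorem descPochhammer_eval_eq_gamma_div (x : ℝ) (k : ℕ) (hx : 0 < x - k) :
    (descPochhammer ℝ k).eval (x - 1) = Real.Gamma x / Real.Gamma (x - k) := by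
  induction k with
  | zero =>
    have : Real.Gamma x ≠ 0 := (Real.Gamma_pos_of_pos (by simpa using hx)).ne'
    simp [this]
  | succ k ih =>
    push_cast at hx
    have h1 : 0 < x - k := by linarith
    have h2 : Real.Gamma (x - k) = (x - (k + 1)) * Real.Gamma (x - (k + 1)) := by
      rw [← Real.Gamma_add_one hx.ne']
      congr 1
      ring
    have h3 : Real.Gamma (x - (k + 1)) ≠ 0 := (Real.Gamma_pos_of_pos hx).ne'
    rw [descPochhammer_succ_eval, ih h1, h2]
    push_cast
    field_simp
    ring

/-- Since |Kᶜ| = q - |K|, the exponent becomes ν + |K| - p - 1: up to a constant, the weight of the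
Bergman space with parameter ν + |K|. -/
theorem superPowCoeff_compl {p : ℕ} {ν : ℝ} (hν : (p : ℝ) < ν) (K : Finset (Fin q)) (ρ : ℝ) :
    superPowCoeff (ν + q - p - 1) ρ (Kᶜ).card =
      Real.Gamma (ν + q - p) / Real.Gamma (ν + K.card - p) * ρ ^ (ν + K.card - p - 1) := by
  have hc : ((Kᶜ).card : ℝ) = q - K.card := by
    rw [Finset.card_compl, Fintype.card_fin, Nat.cast_sub]
    simpa using Finset.card_le_univ K
  have hx : 0 < ν + q - p - (Kᶜ).card := by
    rw [hc]
    have : (0 : ℝ) ≤ K.card := Nat.cast_nonneg _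
    linarith
  rw [superPowCoeff, descPochhammer_eval_eq_gamma_div _ _ hx, hc]
  congr 2 <;> [congr 1; skip] <;> ring_nf

end Grassmann

/-! ### Consequences of quasi-parabolic invariance. -/

section Invariance

variable {p q : ℕ}

/-- Take an index i in exactly one of I and J. Turning ξ_i by the angle π changes the sign of ξ_I
ξ_J^*, so the coefficient equals its own negative. -/
theorem IsQuasiParabolic.eq_zero {F : SuperComponents p q} (hF : IsQuasiParabolic F)
    {z : CSpace p} (hz : z ∈ siegelDomain p) {I J : Finset (Fin q)} (h : I ≠ J) :
    F I J z = 0 := by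
  obtain ⟨i, hi⟩ : ∃ i, ¬(i ∈ I ↔ i ∈ J) := by
    by_contra! hc
    exact h (Finset.ext hc)
  have key := hF (fun _ => 1) 0
    (Function.update (fun _ => 1) i (Circle.exp Real.pi)) z hz I J
  simp only [Circle.coe_one, one_mul, Complex.ofReal_zero, add_zero] at key
  have e1 : ∀ K : Finset (Fin q), i ∈ K →
      (∏ j ∈ K, ((Function.update (fun _ => 1) i (Circle.exp Real.pi) : Fin q → Circle) j : ℂ)) = -1 := by
    intro K hK
    rw [Finset.prod_eq_single_of_mem i hK]
    · simp [Circle.coe_exp]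
    · intro j _ hj
      simp [Function.update_of_ne hj]
  have e2 : ∀ K : Finset (Fin q), i ∉ K →
      (∏ j ∈ K, ((Function.update (fun _ => 1) i (Circle.exp Real.pi) : Fin q → Circle) j : ℂ)) = 1 := by
    intro K hK
    refine Finset.prod_eq_one fun j hj => ?_
    rw [Function.update_of_ne (fun h : j = i => hK (h ▸ hj))]
    simp
  rw [← map_prod] at key
  have : (F I J z) = -F I J z := by
    by_cases hI : i ∈ I
    · have hJ : i ∉ J := by tauto
      rw [e1 I hI, e2 J hJ] at key
      simpa using key.symm
    · have hJ : i ∈ J := by tauto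
      rw [e1 J hJ, e2 I hI] at key
      simpa using key.symm
  exact self_eq_neg.1 this

theorem IsQuasiParabolic.rotate_shift {F : SuperComponents p q} (hF : IsQuasiParabolic F)
    {z : CSpace p} (hz : z ∈ siegelDomain p) (I : Finset (Fin q))
    (t : Fin (p - 1) → Circle) (h : ℝ) :
    F I I (fun k => (t k : ℂ) * z.1 k, z.2 + (h : ℂ)) = F I I z := by
  simpa using hF t h (fun _ => 1) z hz I I

end Invariance

/-! ### Plancherel's theorem for the integral Fourier transform. -/

section Plancherel

open FourierTransform

/-- Both sides define the same distribution: against a smooth compactly supported function, the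
transform can be moved to the test function, for L² by the definition on tempered distributions and
for L¹ by Fubini. -/
theorem fourier_toLp_ae_eq {f : ℝ → ℂ} (h1 : Integrable f) (h2 : MemLp f 2) :
    (𝓕 (h2.toLp f) : Lp ℂ 2 (volume : Measure ℝ)) =ᵐ[volume] 𝓕 f := by
  have hc : Continuous (𝓕 f) := VectorFourier.fourierIntegral_continuous
    Real.continuous_fourierChar (by exact continuous_inner) h1
  refine ae_eq_of_integral_contDiff_smul_eq ?_ hc.locallyIntegrable fun g hg hgc => ?_
  · exact (Lp.memLp _).locallyIntegrable (by norm_num)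
  have hgc' : HasCompactSupport (fun x => (g x : ℂ)) := hgc.comp_left Complex.ofReal_zero
  have hg' : ContDiff ℝ (↑(⊤ : ℕ∞)) (fun x => (g x : ℂ)) := Complex.ofRealCLM.contDiff.comp hg
  set G : SchwartzMap ℝ ℂ := hgc'.toSchwartzMap hg' with hG
  have hGx : ∀ x, G x = g x := fun x => rfl
  have e1 := congrArg (fun T => T G) (Lp.fourier_toTemperedDistribution_eq (h2.toLp f))
  simp only [TemperedDistribution.fourier_apply, Lp.toTemperedDistribution_apply, hGx] at e1
  have e2 : ∫ x, (𝓕 G) x • (h2.toLp f) x = ∫ x, (𝓕 G) x • f x :=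
    integral_congr_ae (by filter_upwards [h2.coeFn_toLp] with x hx; rw [hx])
  have e3 : ∫ x, (𝓕 G) x • f x = ∫ x, G x • 𝓕 f x := by
    have := VectorFourier.integral_fourierIntegral_smul_eq_flip (e := Real.fourierChar)
      (L := innerₗ ℝ) (μ := volume) (ν := volume) (f := (G : ℝ → ℂ)) (g := f)
      Real.continuous_fourierChar (by exact continuous_inner) G.integrable h1
    rw [flip_innerₗ] at this
    exact this
  have e4 := e1.symm.trans (e2.trans e3)
  simpa [hGx] using e4

/-- The function `x ↦ ∫ h(ξ) e^{iξx} dξ`. -/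
def expIntegral (h : ℝ → ℂ) (x : ℝ) : ℂ := ∫ ξ, h ξ * Complex.exp (Complex.I * ξ * x)

theorem expIntegral_eq_fourier (h : ℝ → ℂ) (x : ℝ) :
    expIntegral h x = 𝓕 h (-(2 * Real.pi)⁻¹ * x) := by
  rw [Real.fourier_real_eq_integral_exp_smul, expIntegral]
  congr 1
  ext ξ
  rw [smul_eq_mul, mul_comm]
  congr 2
  have : (Real.pi : ℂ) ≠ 0 := Complex.ofReal_ne_zero.2 Real.pi_ne_zero
  push_cast
  field_simp

theorem memLp_fourier {f : ℝ → ℂ} (h1 : Integrable f) (h2 : MemLp f 2) : MemLp (𝓕 f) 2 :=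
  (memLp_congr_ae (fourier_toLp_ae_eq h1 h2)).1 (Lp.memLp _)

theorem integral_conj_fourier_mul_fourier {f g : ℝ → ℂ} (hf1 : Integrable f) (hf2 : MemLp f 2)
    (hg1 : Integrable g) (hg2 : MemLp g 2) :
    ∫ x, (starRingEnd ℂ) (𝓕 f x) * 𝓕 g x = ∫ x, (starRingEnd ℂ) (f x) * g x := by
  have h := Lp.inner_fourier_eq (hf2.toLp f) (hg2.toLp g)
  rw [L2.inner_def, L2.inner_def] at h
  have e1 : ∫ x, (starRingEnd ℂ) (𝓕 f x) * 𝓕 g x =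
      ∫ x, inner ℂ ((𝓕 (hf2.toLp f) : Lp ℂ 2 (volume : Measure ℝ)) x)
        ((𝓕 (hg2.toLp g) : Lp ℂ 2 (volume : Measure ℝ)) x) := by
    refine integral_congr_ae ?_
    filter_upwards [fourier_toLp_ae_eq hf1 hf2, fourier_toLp_ae_eq hg1 hg2] with x hx hy
    rw [hx, hy, RCLike.inner_apply, mul_comm]
  rw [e1, h]
  refine integral_congr_ae ?_
  filter_upwards [hf2.coeFn_toLp, hg2.coeFn_toLp] with x hx hy
  rw [hx, hy, RCLike.inner_apply, mul_comm]

theorem memLp_expIntegral {h : ℝ → ℂ} (h1 : Integrable h) (h2 : MemLp h 2) :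
    MemLp (expIntegral h) 2 := by
  have hne : -(2 * Real.pi)⁻¹ ≠ 0 := by simp [Real.pi_ne_zero]
  have : expIntegral h = 𝓕 h ∘ fun x => -(2 * Real.pi)⁻¹ * x :=
    funext (expIntegral_eq_fourier h)
  rw [this]
  have hF := memLp_fourier h1 h2
  have hm : Measure.map (fun x : ℝ => -(2 * Real.pi)⁻¹ * x) volume =
      ENNReal.ofReal |(-(2 * Real.pi)⁻¹)⁻¹| • volume := Real.map_volume_mul_left hne
  refine MemLp.comp_of_map ?_ (by fun_prop)
  rw [hm]
  exact hF.smul_measure ENNReal.ofReal_ne_top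

/-- The factor 2π is the Jacobian of the substitution x ↦ -x/(2π), which passes from e^{iξx} to the
normalisation e^{-2πiξx}. -/
theorem integral_conj_expIntegral_mul {f g : ℝ → ℂ} (hf1 : Integrable f) (hf2 : MemLp f 2)
    (hg1 : Integrable g) (hg2 : MemLp g 2) :
    ∫ x, (starRingEnd ℂ) (expIntegral f x) * expIntegral g x =
      (2 * Real.pi : ℝ) * ∫ x, (starRingEnd ℂ) (f x) * g x := by
  simp only [expIntegral_eq_fourier]
  rw [Measure.integral_comp_mul_left (fun x => (starRingEnd ℂ) (𝓕 f x) * 𝓕 g x),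
    integral_conj_fourier_mul_fourier hf1 hf2 hg1 hg2]
  simp [abs_of_pos Real.pi_pos]

end Plancherel

/-! ### Coordinates r_k = |z_k|², v = ρ(z), x = Re z_p. -/

section Coordinates

theorem volume_norm_sq_Ioo (a b : ℝ) :
    volume ((fun z : ℂ => ‖z‖ ^ 2) ⁻¹' Ioo a b) =
      ENNReal.ofReal Real.pi * volume (Ioo a b ∩ Ioi (0 : ℝ)) := by
  have hball : ∀ b : ℝ, 0 < b → (fun z : ℂ => ‖z‖ ^ 2) ⁻¹' Iio b = Metric.ball 0 (√b) := by
    intro b hb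
    ext z
    simp [Real.lt_sqrt (norm_nonneg z)]
  have hvol : ∀ b : ℝ, 0 ≤ b →
      ENNReal.ofReal √b ^ 2 * (NNReal.pi : ENNReal) = ENNReal.ofReal (Real.pi * b) := by
    intro b hb
    rw [← ENNReal.ofReal_pow (Real.sqrt_nonneg _), Real.sq_sqrt hb, ENNReal.ofReal_mul
      Real.pi_pos.le, mul_comm, ← NNReal.coe_real_pi, ENNReal.ofReal_coe_nnreal]
  rcases le_or_gt b 0 with hb | hb
  · have e1 : (fun z : ℂ => ‖z‖ ^ 2) ⁻¹' Ioo a b = ∅ := by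
      ext z
      simp only [mem_preimage, mem_Ioo, mem_empty_iff_false, iff_false, not_and, not_lt]
      intro _
      exact hb.trans (by positivity)
    have e2 : Ioo a b ∩ Ioi (0 : ℝ) = ∅ := by
      ext x
      simp only [mem_inter_iff, mem_Ioo, mem_Ioi, mem_empty_iff_false, iff_false]
      rintro ⟨⟨_, h⟩, h'⟩
      linarith
    rw [e1, e2]
    simp
  rcases lt_or_ge a 0 with ha | ha
  · have e1 : (fun z : ℂ => ‖z‖ ^ 2) ⁻¹' Ioo a b = Metric.ball 0 √b := by
      rw [← hball b hb]
      ext z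
      simp only [mem_preimage, mem_Ioo, mem_Iio, and_iff_right_iff_imp]
      intro _
      exact ha.trans_le (by positivity)
    rw [e1, Ioo_inter_Ioi, max_eq_right ha.le, Complex.volume_ball, Real.volume_Ioo, hvol b hb.le,
      ENNReal.ofReal_mul Real.pi_pos.le, sub_zero]
  · rw [Ioo_inter_Ioi, max_eq_left ha, Real.volume_Ioo, ← ENNReal.ofReal_mul Real.pi_pos.le]
    rcases le_or_gt b a with hab | hab
    · rw [Ioo_eq_empty (not_lt.2 hab), preimage_empty, measure_empty, ENNReal.ofReal_of_nonpos]
      exact mul_nonpos_of_nonneg_of_nonpos Real.pi_pos.le (by linarith)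
    have e1 : (fun z : ℂ => ‖z‖ ^ 2) ⁻¹' Ioo a b =
        Metric.ball 0 √b \ Metric.closedBall 0 √a := by
      rw [← hball b hb]
      ext z
      simp only [mem_preimage, mem_Ioo, mem_Iio, Set.mem_sdiff, mem_closedBall_zero_iff, not_le,
        Real.sqrt_lt ha (norm_nonneg z)]
      tauto
    rw [e1, measure_sdiff _ measurableSet_closedBall.nullMeasurableSet, Complex.volume_ball,
      Complex.volume_closedBall, hvol b hb.le, hvol a ha, ← ENNReal.ofReal_sub _ (by positivity)]
    · ring_nf
    · rw [Complex.volume_closedBall, hvol a ha]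
      exact ENNReal.ofReal_ne_top
    · exact Metric.closedBall_subset_ball (Real.sqrt_lt_sqrt ha hab)

/-- The annulus a < |z|² < b with 0 ≤ a < b has area π(b - a), and intervals with rational endpoints
determine the measure. -/
theorem map_norm_sq_volume : Measure.map (fun z : ℂ => ‖z‖ ^ 2) volume =
    ENNReal.ofReal Real.pi • (volume.restrict (Ioi (0 : ℝ))) := by
  symm
  have : IsLocallyFiniteMeasure (ENNReal.ofReal Real.pi • volume.restrict (Ioi (0 : ℝ))) :=
    (inferInstance : IsLocallyFiniteMeasure (Real.toNNReal Real.pi • volume.restrict (Ioi (0 : ℝ))))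
  refine Real.measure_ext_Ioo_rat fun a b => ?_
  rw [Measure.map_apply (by fun_prop) measurableSet_Ioo, volume_norm_sq_Ioo, Measure.smul_apply,
    Measure.restrict_apply measurableSet_Ioo, smul_eq_mul]

/-- The map `(z', v) ↦ ((|z_k|²)_k, v)`. -/
def normSqMap (p : ℕ) (w : (Fin (p - 1) → ℂ) × ℝ) : (Fin (p - 1) → ℝ) × ℝ :=
  (fun k => ‖w.1 k‖ ^ 2, w.2)

theorem volume_restrict_posOrthant (p : ℕ) :
    (volume : Measure ((Fin (p - 1) → ℝ) × ℝ)).restrict (posOrthant p) =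
      (Measure.pi fun _ => volume.restrict (Ioi (0 : ℝ))).prod (volume.restrict (Ioi (0 : ℝ))) := by
  rw [← Measure.restrict_pi_pi, Measure.prod_restrict]
  congr 1
  ext x
  simp [posOrthant]

theorem measurableSet_posOrthant (p : ℕ) : MeasurableSet (posOrthant p) := by
  have : posOrthant p = (univ.pi fun _ => Ioi (0 : ℝ)) ×ˢ Ioi (0 : ℝ) := by
    ext x
    simp [posOrthant]
  rw [this]
  exact (MeasurableSet.univ_pi fun _ => measurableSet_Ioi).prod measurableSet_Ioi

theorem pi_smul_measure {ι : Type*} [Fintype ι] {X : ι → Type*} [∀ i, MeasurableSpace (X i)]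
    (μ : ∀ i, Measure (X i)) [∀ i, SigmaFinite (μ i)] (c : NNReal) :
    Measure.pi (fun i => (c : ENNReal) • μ i) = ((c : ENNReal) ^ Fintype.card ι) • Measure.pi μ := by
  have : ∀ i, SigmaFinite ((c : ENNReal) • μ i) := fun i =>
    (inferInstance : SigmaFinite (c • μ i))
  refine (Measure.pi_eq fun s hs => ?_)
  simp only [Measure.smul_apply, Measure.pi_pi, smul_eq_mul, Finset.prod_mul_distrib,
    Finset.prod_const, Finset.card_univ]

/-- Each of the p - 1 complex coordinates contributes one factor π; v is untouched. -/
theorem measurePreserving_normSqMap (p : ℕ) : MeasurePreserving (normSqMap p)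
    (volume.restrict {w | 0 < w.2})
    (ENNReal.ofReal Real.pi ^ (p - 1) • volume.restrict (posOrthant p)) := by
  have h0 : (volume : Measure ((Fin (p - 1) → ℂ) × ℝ)).restrict {w | 0 < w.2} =
      (Measure.pi fun _ => volume).prod (volume.restrict (Ioi (0 : ℝ))) := by
    rw [← Measure.restrict_univ (μ := Measure.pi fun _ : Fin (p - 1) => (volume : Measure ℂ)),
      Measure.prod_restrict]
    congr 1
    ext x
    simp
  have h1 : (ENNReal.ofReal Real.pi ^ (p - 1) • volume.restrict (posOrthant p)) =
      (Measure.pi fun _ : Fin (p - 1) => Measure.map (fun z : ℂ => ‖z‖ ^ 2) volume).prod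
        (volume.restrict (Ioi (0 : ℝ))) := by
    simp only [map_norm_sq_volume]
    have := pi_smul_measure (fun _ : Fin (p - 1) => volume.restrict (Ioi (0 : ℝ)))
      (Real.toNNReal Real.pi)
    rw [Fintype.card_fin] at this
    rw [volume_restrict_posOrthant]
    change _ = (Measure.pi fun _ : Fin (p - 1) => ((Real.toNNReal Real.pi : NNReal) : ENNReal) •
      volume.restrict (Ioi (0 : ℝ))).prod _
    rw [this, Measure.prod_smul_left]
    rfl
  rw [h0, h1]
  have : SigmaFinite (Measure.map (fun z : ℂ => ‖z‖ ^ 2) volume) := by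
    rw [map_norm_sq_volume]
    exact (inferInstance : SigmaFinite (Real.toNNReal Real.pi • volume.restrict (Ioi (0 : ℝ))))
  have hA : MeasurePreserving (fun (a : Fin (p - 1) → ℂ) i => ‖a i‖ ^ 2)
      (Measure.pi fun _ => volume)
      (Measure.pi fun _ => Measure.map (fun z : ℂ => ‖z‖ ^ 2) volume) :=
    measurePreserving_pi (fun _ => volume) (fun _ => Measure.map (fun z : ℂ => ‖z‖ ^ 2) volume)
      (f := fun _ z => ‖z‖ ^ 2) fun i => ⟨by fun_prop, rfl⟩
  exact hA.prod (MeasurePreserving.id _)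

theorem integrableOn_comp_normSqMap {p : ℕ} {E : Type*} [NormedAddCommGroup E]
    {f : (Fin (p - 1) → ℝ) × ℝ → E} (hf : IntegrableOn f (posOrthant p)) :
    IntegrableOn (fun w => f (normSqMap p w)) {w | 0 < w.2} := by
  refine (measurePreserving_normSqMap p).integrable_comp_of_integrable ?_
  exact hf.smul_measure (ENNReal.pow_ne_top ENNReal.ofReal_ne_top)

theorem integral_comp_normSqMap {p : ℕ} {f : (Fin (p - 1) → ℝ) × ℝ → ℂ}
    (hf : AEStronglyMeasurable f (volume.restrict (posOrthant p))) :
    ∫ w in {w | 0 < w.2}, f (normSqMap p w) =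
      (Real.pi ^ (p - 1) : ℝ) * ∫ x in posOrthant p, f x := by
  have h := measurePreserving_normSqMap p
  rw [← integral_map h.measurable.aemeasurable, h.map_eq, integral_smul_measure]
  · rw [ENNReal.toReal_pow, ENNReal.toReal_ofReal Real.pi_pos.le, Complex.real_smul]
  · rw [h.map_eq]
    exact hf.smul_measure _

theorem measurable_siegelHeight {p : ℕ} : Measurable (siegelHeight : CSpace p → ℝ) := by
  unfold siegelHeight
  fun_prop

theorem continuous_siegelHeight {p : ℕ} : Continuous (siegelHeight : CSpace p → ℝ) := by
  unfold siegelHeight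
  fun_prop

theorem isOpen_siegelDomain (p : ℕ) : IsOpen (siegelDomain p) :=
  isOpen_lt continuous_const continuous_siegelHeight

theorem measurableSet_siegelDomain (p : ℕ) : MeasurableSet (siegelDomain p) :=
  (isOpen_siegelDomain p).measurableSet

/-- The coordinates `(z', v, x)` on `ℂ^p`, with `v = Im z_p - |z'|²` and `x = Re z_p`. -/
def siegelCoord (p : ℕ) : (((Fin (p - 1) → ℂ) × ℝ) × ℝ) ≃ᵐ CSpace p where
  toFun w := (w.1.1, ⟨w.2, w.1.2 + ∑ k, ‖w.1.1 k‖ ^ 2⟩)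
  invFun z := ((z.1, siegelHeight z), z.2.re)
  left_inv w := by simp [siegelHeight]
  right_inv z := by simp [siegelHeight]
  measurable_toFun := by
    refine Measurable.prodMk (by fun_prop) ?_
    exact Complex.measurableEquivRealProd.symm.measurable.comp
      (Measurable.prodMk (by fun_prop) (by fun_prop) :
        Measurable fun w : ((Fin (p - 1) → ℂ) × ℝ) × ℝ => (w.2, w.1.2 + ∑ k, ‖w.1.1 k‖ ^ 2))
  measurable_invFun := by
    refine Measurable.prodMk (Measurable.prodMk (by fun_prop) measurable_siegelHeight) ?_
    exact Complex.measurable_re.comp measurable_snd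

theorem siegelHeight_siegelCoord {p : ℕ} (w) : siegelHeight (siegelCoord p w) = w.1.2 := by
  simp [siegelHeight, siegelCoord]

/-- A shear: for fixed z' the passage from v to Im z_p = v + |z'|² is a translation, so the Jacobian
is 1. -/
theorem measurePreserving_siegelCoord (p : ℕ) : MeasurePreserving (siegelCoord p) := by
  have h1 : MeasurePreserving (fun w : ((Fin (p - 1) → ℂ) × ℝ) × ℝ => (w.1.1, (w.1.2, w.2)))
      volume volume := measurePreserving_prodAssoc volume volume volume
  have h2 : MeasurePreserving (fun w : (Fin (p - 1) → ℂ) × (ℝ × ℝ) =>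
      (id w.1, (Complex.measurableEquivRealProd.symm (w.2.2, w.2.1 + ∑ k, ‖w.1 k‖ ^ 2))))
      (volume.prod volume) (volume.prod volume) := by
    refine MeasurePreserving.skew_product (μa := volume) (μb := volume) (μc := volume)
      (μd := volume) (f := id) (g := fun (z : Fin (p - 1) → ℂ) (v : ℝ × ℝ) =>
        (Complex.measurableEquivRealProd.symm (v.2, v.1 + ∑ k, ‖z k‖ ^ 2)))
      (MeasurePreserving.id _) ?_ ?_
    · exact Complex.measurableEquivRealProd.symm.measurable.comp
        (Measurable.prodMk (by fun_prop) (by fun_prop))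
    · refine ae_of_all _ fun z => ?_
      have a1 : MeasurePreserving (fun v : ℝ × ℝ => (v.1 + ∑ k, ‖z k‖ ^ 2, v.2))
          (volume.prod volume) (volume.prod volume) :=
        (measurePreserving_add_right volume (∑ k, ‖z k‖ ^ 2)).prod (MeasurePreserving.id volume)
      have a2 := (Complex.volume_preserving_equiv_real_prod.symm).comp
        ((Measure.measurePreserving_swap (μ := (volume : Measure ℝ)) (ν := (volume : Measure ℝ))).comp a1)
      exact a2.map_eq
  exact h2.comp h1

theorem integrableOn_siegelDomain_iff {p : ℕ} {E : Type*} [NormedAddCommGroup E]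
    {f : CSpace p → E} : IntegrableOn f (siegelDomain p) ↔
      Integrable (fun w => f (siegelCoord p w))
        ((volume.restrict {w : (Fin (p - 1) → ℂ) × ℝ | 0 < w.2}).prod volume) := by
  have h := (measurePreserving_siegelCoord p).restrict_preimage (measurableSet_siegelDomain p)
  have hs : siegelCoord p ⁻¹' siegelDomain p =
      {w : (Fin (p - 1) → ℂ) × ℝ | 0 < w.2} ×ˢ univ := by
    ext w
    simp [siegelDomain, siegelHeight_siegelCoord]
  rw [IntegrableOn, ← h.integrable_comp_emb (siegelCoord p).measurableEmbedding, hs]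
  conv_rhs => rw [← Measure.restrict_univ (μ := (volume : Measure ℝ)), Measure.prod_restrict]
  rfl

theorem setIntegral_siegelDomain {p : ℕ} {E : Type*} [NormedAddCommGroup E] [NormedSpace ℝ E]
    (f : CSpace p → E) : ∫ z in siegelDomain p, f z =
      ∫ w, f (siegelCoord p w)
        ∂((volume.restrict {w : (Fin (p - 1) → ℂ) × ℝ | 0 < w.2}).prod volume) := by
  have h := (measurePreserving_siegelCoord p).restrict_preimage (measurableSet_siegelDomain p)
  have hs : siegelCoord p ⁻¹' siegelDomain p =
      {w : (Fin (p - 1) → ℂ) × ℝ | 0 < w.2} ×ˢ univ := by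
    ext w
    simp [siegelDomain, siegelHeight_siegelCoord]
  rw [← h.integral_comp (siegelCoord p).measurableEmbedding, hs]
  conv_rhs => rw [← Measure.restrict_univ (μ := (volume : Measure ℝ)), Measure.prod_restrict]
  rfl

/-- The integrand `∏ r_k^(s_k) e^{-c(v + r̂)} v^α`. -/
def orthantGamma (p : ℕ) (s : Fin (p - 1) → ℝ) (α c : ℝ) (x : (Fin (p - 1) → ℝ) × ℝ) : ℝ :=
  (∏ k, x.1 k ^ s k) * Real.exp (-c * (x.2 + ∑ k, x.1 k)) * x.2 ^ α

theorem orthantGamma_eq (p : ℕ) (s : Fin (p - 1) → ℝ) (α c : ℝ) (x : (Fin (p - 1) → ℝ) × ℝ) :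
    orthantGamma p s α c x = (∏ k, (x.1 k ^ s k * Real.exp (-(c * x.1 k)))) *
      (x.2 ^ α * Real.exp (-(c * x.2))) := by
  rw [orthantGamma, Finset.prod_mul_distrib, ← Real.exp_sum]
  have : Real.exp (-c * (x.2 + ∑ k, x.1 k)) = Real.exp (∑ k, -(c * x.1 k)) *
      Real.exp (-(c * x.2)) := by
    rw [← Real.exp_add, Finset.sum_neg_distrib, ← Finset.mul_sum]
    ring_nf
  rw [this]
  ring

theorem integrableOn_rpow_mul_exp_neg {s c : ℝ} (hs : -1 < s) (hc : 0 < c) :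
    IntegrableOn (fun r : ℝ => r ^ s * Real.exp (-(c * r))) (Ioi 0) := by
  have := integrableOn_rpow_mul_exp_neg_mul_rpow hs one_pos hc
  simpa only [Real.rpow_one, neg_mul] using this

theorem integrableOn_orthantGamma {p : ℕ} {s : Fin (p - 1) → ℝ} {α c : ℝ} (hs : ∀ k, -1 < s k)
    (hα : -1 < α) (hc : 0 < c) : IntegrableOn (orthantGamma p s α c) (posOrthant p) := by
  rw [IntegrableOn, volume_restrict_posOrthant]
  simp only [funext (orthantGamma_eq p s α c)]
  exact (Integrable.fintype_prod (f := fun k r => r ^ s k * Real.exp (-(c * r))) fun k =>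
    integrableOn_rpow_mul_exp_neg (hs k) hc).mul_prod (integrableOn_rpow_mul_exp_neg hα hc)

theorem integral_orthantGamma {p : ℕ} {s : Fin (p - 1) → ℝ} {α c : ℝ} (hs : ∀ k, -1 < s k)
    (hα : -1 < α) (hc : 0 < c) : ∫ x in posOrthant p, orthantGamma p s α c x =
      (∏ k, ((1 / c) ^ (s k + 1) * Real.Gamma (s k + 1))) *
        ((1 / c) ^ (α + 1) * Real.Gamma (α + 1)) := by
  have key : ∀ β : ℝ, -1 < β → ∫ r in Ioi (0 : ℝ), r ^ β * Real.exp (-(c * r)) =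
      (1 / c) ^ (β + 1) * Real.Gamma (β + 1) := by
    intro β hβ
    have := Real.integral_rpow_mul_exp_neg_mul_Ioi (a := β + 1) (by linarith) hc
    simpa using this
  rw [volume_restrict_posOrthant]
  simp only [orthantGamma_eq p s α c]
  rw [integral_prod_mul (fun r : Fin (p - 1) → ℝ => ∏ k, (r k ^ s k * Real.exp (-(c * r k))))
    (fun v : ℝ => v ^ α * Real.exp (-(c * v))), key α hα,
    integral_fintype_prod_eq_prod (fun k r => r ^ s k * Real.exp (-(c * r)))]
  simp only [key _ (hs _)]

end Coordinates

/-! ### The kernel vectors κ_z and pointwise evaluation of R^*. -/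

section Kernel

theorem hasSum_fin_prod {d : ℕ} (f : Fin d → ℕ → ℂ) (hf : ∀ k, Summable fun j => ‖f k j‖) :
    Summable (fun n : Fin d → ℕ => ‖∏ k, f k (n k)‖) ∧
      HasSum (fun n : Fin d → ℕ => ∏ k, f k (n k)) (∏ k, ∑' j, f k j) := by
  induction d with
  | zero =>
    simp only [Finset.univ_eq_empty, Finset.prod_empty, norm_one]
    exact ⟨(hasSum_unique _).summable, hasSum_unique (fun _ : Fin 0 → ℕ => (1 : ℂ))⟩
  | succ d ih =>
    obtain ⟨h1, h2⟩ := ih (fun k => f k.succ) (fun k => hf k.succ)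
    let e : ℕ × (Fin d → ℕ) ≃ (Fin (d + 1) → ℕ) := Fin.consEquiv fun _ => ℕ
    have he : (fun n : Fin (d + 1) → ℕ => ∏ k, f k (n k)) ∘ e =
        fun x => f 0 x.1 * ∏ k : Fin d, f k.succ (x.2 k) := by
      ext x
      simp [e, Fin.prod_univ_succ, Fin.consEquiv]
    have he' : (fun n : Fin (d + 1) → ℕ => ‖∏ k, f k (n k)‖) ∘ e =
        fun x => ‖f 0 x.1 * ∏ k : Fin d, f k.succ (x.2 k)‖ := by
      ext x
      exact congrArg norm (congrFun he x)
    have hs : Summable fun x : ℕ × (Fin d → ℕ) => ‖f 0 x.1 * ∏ k : Fin d, f k.succ (x.2 k)‖ :=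
      Summable.mul_norm (f := f 0) (g := fun n : Fin d → ℕ => ∏ k : Fin d, f k.succ (n k)) (hf 0) h1
    constructor
    · rw [← e.summable_iff, he']
      exact hs
    · rw [← e.hasSum_iff, he, Fin.prod_univ_succ, ← h2.tsum_eq,
        tsum_mul_tsum_of_summable_norm (f := f 0)
          (g := fun n : Fin d → ℕ => ∏ k : Fin d, f k.succ (n k)) (hf 0) h1]
      exact hs.of_norm.hasSum

theorem hasSum_fin_exp {d : ℕ} (x : Fin d → ℂ) :
    Summable (fun n : Fin d → ℕ => ‖∏ k, (x k ^ n k / (n k).factorial : ℂ)‖) ∧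
      HasSum (fun n : Fin d → ℕ => ∏ k, (x k ^ n k / (n k).factorial : ℂ))
        (Complex.exp (∑ k, x k)) := by
  have h := hasSum_fin_prod (fun k j => (x k ^ j / j.factorial : ℂ)) (fun k => by
    exact NormedSpace.norm_expSeries_div_summable (x k))
  refine ⟨h.1, ?_⟩
  have h2 := h.2
  rw [Complex.exp_sum]
  convert h2 using 2 with k
  rw [Complex.exp_eq_exp_ℂ, NormedSpace.exp_eq_tsum_div]

variable {p : ℕ} {l : ℝ}

theorem bargmannFactor_nonneg (n : Fin (p - 1) → ℕ) (ξ : ℝ) : 0 ≤ bargmannFactor p l n ξ := by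
  unfold bargmannFactor
  positivity

theorem measurable_bargmannFactor (n : Fin (p - 1) → ℕ) : Measurable (bargmannFactor p l n) := by
  unfold bargmannFactor
  fun_prop

/-- The powers of 2π cancel, and (2ξ)^|n| / n! factors over the coordinates, so that sums over n
become products of exponential series. -/
theorem bargmannFactor_sq (hl : 0 < l) (n : Fin (p - 1) → ℕ) {ξ : ℝ} (hξ : 0 < ξ) :
    bargmannFactor p l n ξ ^ 2 =
      2 * (2 * ξ) ^ (l - 1) / Real.Gamma l * ∏ k, ((2 * ξ) ^ n k / (n k).factorial) := by
  have h1 : ((2 * Real.pi) ^ (-(p : ℝ) / 2)) ^ 2 = ((2 * Real.pi) ^ p)⁻¹ := by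
    rw [← Real.rpow_natCast, ← Real.rpow_mul (by positivity)]
    norm_num
  have h2 : (0 : ℝ) < Real.Gamma l := Real.Gamma_pos_of_pos hl
  have h3 : (2 * ξ) ^ (((∑ k, n k : ℕ) : ℝ) + l - 1) = (2 * ξ) ^ (l - 1) * ∏ k, (2 * ξ) ^ n k := by
    rw [Finset.prod_pow_eq_pow_sum, ← Real.rpow_natCast, ← Real.rpow_add (by positivity)]
    ring_nf
  have h4 : (0 : ℝ) < ((∏ k, (n k).factorial : ℕ) : ℝ) := by
    exact_mod_cast Finset.prod_pos fun k _ => (n k).factorial_pos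
  rw [bargmannFactor, mul_pow, h1, Real.sq_sqrt (by positivity), h3, Finset.prod_div_distrib]
  have h5 : (0 : ℝ) < (2 * Real.pi) ^ p := by positivity
  push_cast at h4 ⊢
  field_simp

/-- The function `ξ ↦ k_n(ξ) (z')^n e^{iξ z_p}`. -/
def bargmannKernel (p : ℕ) (l : ℝ) (n : Fin (p - 1) → ℕ) (z : CSpace p) (ξ : ℝ) : ℂ :=
  (bargmannFactor p l n ξ : ℂ) * (∏ k, z.1 k ^ n k) * Complex.exp (Complex.I * ξ * z.2)

theorem measurable_bargmannKernel (n : Fin (p - 1) → ℕ) :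
    Measurable (fun x : CSpace p × ℝ => bargmannKernel p l n x.1 x.2) := by
  unfold bargmannKernel
  have := measurable_bargmannFactor (p := p) (l := l) n
  fun_prop

theorem exp_sum_siegelHeight (z : CSpace p) (ξ : ℝ) :
    Real.exp (-2 * ξ * z.2.im) * Real.exp (∑ k, 2 * ξ * ‖z.1 k‖ ^ 2) =
      Real.exp (-(2 * siegelHeight z * ξ)) := by
  rw [← Real.exp_add, ← Finset.mul_sum, siegelHeight]
  ring_nf

theorem bargmannKernel_mul_conj (hl : 0 < l) (n : Fin (p - 1) → ℕ) (z w : CSpace p) {ξ : ℝ}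
    (hξ : 0 < ξ) : bargmannKernel p l n z ξ * (starRingEnd ℂ) (bargmannKernel p l n w ξ) =
      ((2 * (2 * ξ) ^ (l - 1) / Real.Gamma l : ℝ) : ℂ) *
        Complex.exp (Complex.I * ξ * (z.2 - (starRingEnd ℂ) w.2)) *
        ∏ k, ((2 * ξ * (z.1 k * (starRingEnd ℂ) (w.1 k))) ^ n k / (n k).factorial : ℂ) := by
  have h := congrArg (fun x : ℝ => (x : ℂ)) (bargmannFactor_sq (p := p) hl n hξ)
  simp only [Complex.ofReal_pow, Complex.ofReal_mul (2 * (2 * ξ) ^ (l - 1) / Real.Gamma l),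
    Complex.ofReal_prod] at h
  have e1 : Complex.exp (Complex.I * ξ * (z.2 - (starRingEnd ℂ) w.2)) =
      Complex.exp (Complex.I * ξ * z.2) * (starRingEnd ℂ) (Complex.exp (Complex.I * ξ * w.2)) := by
    rw [← Complex.exp_conj, ← Complex.exp_add]
    simp
    ring_nf
  have e2 : ∏ k, ((2 * ξ * (z.1 k * (starRingEnd ℂ) (w.1 k))) ^ n k / (n k).factorial : ℂ) =
      (∏ k, (((2 * ξ) ^ n k / (n k).factorial : ℝ) : ℂ)) * (∏ k, z.1 k ^ n k) *
        ∏ k, (starRingEnd ℂ) (w.1 k) ^ n k := by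
    rw [← Finset.prod_mul_distrib, ← Finset.prod_mul_distrib]
    refine Finset.prod_congr rfl fun k _ => ?_
    push_cast
    rw [mul_pow, mul_pow]
    ring
  rw [e1, e2, bargmannKernel, bargmannKernel]
  simp only [map_mul, map_prod, map_pow, Complex.conj_ofReal]
  linear_combination ((∏ k, z.1 k ^ n k) * Complex.exp (Complex.I * ξ * z.2) *
    (∏ k, (starRingEnd ℂ) (w.1 k) ^ n k) * (starRingEnd ℂ) (Complex.exp (Complex.I * ξ * w.2))) * h

theorem hasSum_bargmannKernel_mul_conj (hl : 0 < l) (z w : CSpace p) {ξ : ℝ} (hξ : 0 < ξ) :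
    HasSum (fun n => bargmannKernel p l n z ξ * (starRingEnd ℂ) (bargmannKernel p l n w ξ))
      (((2 * (2 * ξ) ^ (l - 1) / Real.Gamma l : ℝ) : ℂ) *
        Complex.exp (Complex.I * ξ * (z.2 - (starRingEnd ℂ) w.2)) *
        Complex.exp (∑ k, 2 * ξ * (z.1 k * (starRingEnd ℂ) (w.1 k)))) := by
  simp only [bargmannKernel_mul_conj hl _ z w hξ]
  exact (hasSum_fin_exp _).2.mul_left _

/-- The series over n sums to e^{2ξ|z'|²}, which joins |e^{iξ z_p}|² = e^{-2ξ Im z_p} to give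
e^{-2ξρ(z)}. This decays in ξ precisely because ρ(z) > 0. -/
theorem hasSum_norm_bargmannKernel_sq (hl : 0 < l) (z : CSpace p) {ξ : ℝ} (hξ : 0 < ξ) :
    HasSum (fun n => ‖bargmannKernel p l n z ξ‖ ^ 2)
      (2 * (2 * ξ) ^ (l - 1) / Real.Gamma l * Real.exp (-(2 * siegelHeight z * ξ))) := by
  have h := hasSum_bargmannKernel_mul_conj hl z z hξ
  rw [← Complex.hasSum_ofReal]
  convert h using 1
  · ext n
    rw [Complex.mul_conj, Complex.normSq_eq_norm_sq]
  · have e1 : Complex.I * ξ * (z.2 - (starRingEnd ℂ) z.2) = ((-2 * ξ * z.2.im : ℝ) : ℂ) := by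
      rw [Complex.sub_conj]
      push_cast
      linear_combination (2 * ξ * z.2.im : ℂ) * Complex.I_mul_I
    have e2 : (∑ k, 2 * ξ * (z.1 k * (starRingEnd ℂ) (z.1 k)) : ℂ) =
        ((∑ k, 2 * ξ * ‖z.1 k‖ ^ 2 : ℝ) : ℂ) := by
      push_cast
      refine Finset.sum_congr rfl fun k _ => ?_
      rw [Complex.mul_conj, Complex.normSq_eq_norm_sq]
      push_cast
      ring
    rw [e1, e2, ← exp_sum_siegelHeight]
    push_cast
    ring

theorem integrableOn_kernel_bound (hl : 0 < l) {c : ℝ} (hc : 0 < c) :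
    IntegrableOn (fun ξ => 2 * (2 * ξ) ^ (l - 1) / Real.Gamma l * Real.exp (-(2 * c * ξ)))
      (Ioi 0) := by
  have h := (integrableOn_rpow_mul_exp_neg (s := l - 1) (c := 2 * c) (by linarith)
    (by linarith)).const_mul (2 * 2 ^ (l - 1) / Real.Gamma l)
  refine IntegrableOn.congr_fun h (fun ξ hξ => ?_) measurableSet_Ioi
  rw [Real.mul_rpow (by norm_num) (le_of_lt hξ)]
  ring

theorem integral_kernel_bound (hl : 0 < l) {c : ℝ} (hc : 0 < c) :
    ∫ ξ in Ioi (0 : ℝ), 2 * (2 * ξ) ^ (l - 1) / Real.Gamma l * Real.exp (-(2 * c * ξ)) =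
      c ^ (-l) := by
  have h := Real.integral_rpow_mul_exp_neg_mul_Ioi hl (r := 2 * c) (by linarith)
  have e : ∀ ξ ∈ Ioi (0 : ℝ), 2 * (2 * ξ) ^ (l - 1) / Real.Gamma l * Real.exp (-(2 * c * ξ)) =
      2 ^ l / Real.Gamma l * (ξ ^ (l - 1) * Real.exp (-(2 * c * ξ))) := by
    intro ξ hξ
    rw [Real.mul_rpow (by norm_num) (le_of_lt hξ), Real.rpow_sub_one two_ne_zero]
    ring
  rw [setIntegral_congr_fun measurableSet_Ioi e, integral_const_mul, h, one_div,
    Real.inv_rpow (by positivity), Real.mul_rpow (by norm_num) hc.le, Real.rpow_neg hc.le]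
  have h1 := (Real.Gamma_pos_of_pos hl).ne'
  have h2 : (2 : ℝ) ^ l ≠ 0 := by positivity
  have h3 : c ^ l ≠ 0 := by positivity
  field_simp

theorem integrableOn_norm_bargmannKernel_sq (hl : 0 < l) (n : Fin (p - 1) → ℕ) {z : CSpace p}
    (hz : z ∈ siegelDomain p) :
    IntegrableOn (fun ξ => ‖bargmannKernel p l n z ξ‖ ^ 2) (Ioi 0) := by
  refine (integrableOn_kernel_bound hl hz).mono' ?_ ?_
  · exact (((measurable_bargmannKernel n).comp (measurable_const.prodMk
      measurable_id)).norm.pow_const 2).aestronglyMeasurable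
  · refine (ae_restrict_iff' measurableSet_Ioi).2 (ae_of_all _ fun ξ hξ => ?_)
    rw [Real.norm_of_nonneg (by positivity)]
    exact le_hasSum (hasSum_norm_bargmannKernel_sq hl z hξ) n fun _ _ => by positivity

theorem memLp_bargmannKernel (hl : 0 < l) (n : Fin (p - 1) → ℕ) {z : CSpace p}
    (hz : z ∈ siegelDomain p) :
    MemLp (bargmannKernel p l n z) 2 (volume.restrict (Ioi 0)) := by
  rw [memLp_two_iff_integrable_sq_norm]
  · exact integrableOn_norm_bargmannKernel_sq hl n hz
  · exact ((measurable_bargmannKernel n).comp (measurable_const.prodMk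
      measurable_id)).aestronglyMeasurable

/-- Integrating e^{-2ξρ(z)} against the density in ξ by Euler's integral gives ρ(z)^(-l). This makes
κ_z an element of the sequence space. -/
theorem sum_integral_norm_bargmannKernel_sq_le (hl : 0 < l) {z : CSpace p}
    (hz : z ∈ siegelDomain p) (s : Finset (Fin (p - 1) → ℕ)) :
    ∑ n ∈ s, ∫ ξ in Ioi (0 : ℝ), ‖bargmannKernel p l n z ξ‖ ^ 2 ≤ siegelHeight z ^ (-l) := by
  rw [← integral_finsetSum _ fun n _ => integrableOn_norm_bargmannKernel_sq hl n hz,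
    ← integral_kernel_bound hl hz]
  refine setIntegral_mono_on (integrable_finsetSum _ fun n _ =>
    integrableOn_norm_bargmannKernel_sq hl n hz) (integrableOn_kernel_bound hl hz)
    measurableSet_Ioi fun ξ hξ => ?_
  exact sum_le_hasSum s (fun _ _ => by positivity) (hasSum_norm_bargmannKernel_sq hl z hξ)

/-- `l_2(ℤ_+^(p-1), L_2(ℝ_+))`. -/
abbrev CompSpace (p : ℕ) : Type := lp (fun _ : Fin (p - 1) → ℕ => HalfLineL2) 2

theorem memLp_conj {α : Type*} [MeasurableSpace α] {μ : Measure α} {f : α → ℂ} {r : ENNReal}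
    (hf : MemLp f r μ) : MemLp (fun x => (starRingEnd ℂ) (f x)) r μ :=
  hf.of_le (Complex.continuous_conj.comp_aestronglyMeasurable hf.1)
    (ae_of_all _ fun x => by simp)

theorem norm_toLp_sq {α : Type*} [MeasurableSpace α] {μ : Measure α} {f : α → ℂ}
    (hf : MemLp f 2 μ) : ‖hf.toLp f‖ ^ 2 = ∫ x, ‖f x‖ ^ 2 ∂μ := by
  have h := inner_self_eq_norm_sq_to_K (𝕜 := ℂ) (hf.toLp f)
  rw [L2.inner_def] at h
  have h2 : ∫ x, inner ℂ ((hf.toLp f) x) ((hf.toLp f) x) ∂μ = ((∫ x, ‖f x‖ ^ 2 ∂μ : ℝ) : ℂ) := by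
    rw [← integral_complex_ofReal]
    refine integral_congr_ae ?_
    filter_upwards [hf.coeFn_toLp] with x hx
    rw [hx, inner_self_eq_norm_sq_to_K]
    simp
  rw [h2] at h
  exact (Complex.ofReal_injective (by simpa using h)).symm

/-- The vector `κ_z` of `l_2(ℤ_+^(p-1), L_2(ℝ_+))` with components `conj (k_n (z')^n e^{iξ z_p})`. -/
def kernelVec (hl : 0 < l) {z : CSpace p} (hz : z ∈ siegelDomain p) : CompSpace p :=
  ⟨fun n => (memLp_conj (memLp_bargmannKernel hl n hz)).toLp _, by
    refine memℓp_gen' (C := siegelHeight z ^ (-l)) fun s => ?_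
    refine le_of_eq_of_le ?_ (sum_integral_norm_bargmannKernel_sq_le hl hz s)
    refine Finset.sum_congr rfl fun n _ => ?_
    have := norm_toLp_sq (memLp_conj (memLp_bargmannKernel hl n hz))
    simpa using this⟩

theorem kernelVec_apply (hl : 0 < l) {z : CSpace p} (hz : z ∈ siegelDomain p) (n) :
    kernelVec hl hz n = (memLp_conj (memLp_bargmannKernel hl n hz)).toLp _ := rfl

theorem norm_kernelVec_sq_le (hl : 0 < l) {z : CSpace p} (hz : z ∈ siegelDomain p) :
    ‖kernelVec hl hz‖ ^ 2 ≤ siegelHeight z ^ (-l) := by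
  have h := lp.norm_rpow_eq_tsum (p := 2) (by simp) (kernelVec hl hz)
  simp only [ENNReal.toReal_ofNat, Real.rpow_ofNat] at h
  rw [h]
  refine Real.tsum_le_of_sum_le (fun n => by positivity) fun s => ?_
  refine le_of_eq_of_le ?_ (sum_integral_norm_bargmannKernel_sq_le hl hz s)
  refine Finset.sum_congr rfl fun n _ => ?_
  have := norm_toLp_sq (memLp_conj (memLp_bargmannKernel hl n hz))
  simpa [kernelVec_apply] using this

open Classical in
/-- The component `L → A²_λ` of the adjoint super Bargmann transform. -/
def compAdj (l : ℝ) (b : CompSpace p) (z : CSpace p) : ℂ :=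
  if z ∈ siegelDomain p then
    ∑' n : Fin (p - 1) → ℕ, ∫ ξ in Ioi (0 : ℝ), (bargmannFactor p l n ξ : ℂ) * (b n : ℝ → ℂ) ξ *
      (∏ k, z.1 k ^ n k) * Complex.exp (Complex.I * ξ * z.2)
  else 0

theorem compAdj_of_notMem (b : CompSpace p) {z : CSpace p} (hz : z ∉ siegelDomain p) :
    compAdj l b z = 0 := if_neg hz

theorem bargmannAdj_eq_compAdj {q : ℕ} (ν : ℝ) (b : SeqSpace p q) (M : Finset (Fin q)) :
    bargmannAdj ν b M = compAdj (ν + M.card) (b M) := rfl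

theorem integrableOn_bargmannKernel_mul (hl : 0 < l) {z : CSpace p} (hz : z ∈ siegelDomain p)
    (n : Fin (p - 1) → ℕ) (f : HalfLineL2) : IntegrableOn (fun ξ =>
      (bargmannFactor p l n ξ : ℂ) * (f : ℝ → ℂ) ξ *
        (∏ k, z.1 k ^ n k) * Complex.exp (Complex.I * ξ * z.2)) (Ioi 0) := by
  have h := (memLp_bargmannKernel hl n hz).integrable_mul (Lp.memLp f)
  refine h.congr (ae_of_all _ fun ξ => ?_)
  simp only [Pi.mul_apply, bargmannKernel]
  ring

theorem inner_kernelVec_apply (hl : 0 < l) {z : CSpace p} (hz : z ∈ siegelDomain p)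
    (n : Fin (p - 1) → ℕ) (f : HalfLineL2) : inner ℂ (kernelVec hl hz n) f =
      ∫ ξ in Ioi (0 : ℝ), (bargmannFactor p l n ξ : ℂ) * (f : ℝ → ℂ) ξ *
        (∏ k, z.1 k ^ n k) * Complex.exp (Complex.I * ξ * z.2) := by
  rw [kernelVec_apply, L2.inner_def]
  refine integral_congr_ae ?_
  filter_upwards [(memLp_conj (memLp_bargmannKernel hl n hz)).coeFn_toLp] with ξ hξ
  rw [hξ, RCLike.inner_apply, Complex.conj_conj, bargmannKernel]
  ring

theorem summable_compAdj (hl : 0 < l) {z : CSpace p} (hz : z ∈ siegelDomain p) (b : CompSpace p) :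
    Summable fun n => ∫ ξ in Ioi (0 : ℝ), (bargmannFactor p l n ξ : ℂ) * (b n : ℝ → ℂ) ξ *
      (∏ k, z.1 k ^ n k) * Complex.exp (Complex.I * ξ * z.2) := by
  have h := lp.summable_inner (𝕜 := ℂ) (kernelVec hl hz) b
  simpa only [inner_kernelVec_apply hl hz] using h

/-- Evaluation at a point is a bounded functional. Linearity, the growth bound and pointwise
continuity in b are all read off from this. -/
theorem compAdj_eq_inner (hl : 0 < l) {z : CSpace p} (hz : z ∈ siegelDomain p) (b : CompSpace p) :
    compAdj l b z = inner ℂ (kernelVec hl hz) b := by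
  rw [compAdj, if_pos hz, lp.inner_eq_tsum]
  simp only [inner_kernelVec_apply hl hz]

theorem compAdj_add (hl : 0 < l) (a b : CompSpace p) :
    compAdj l (a + b) = compAdj l a + compAdj l b := by
  ext z
  by_cases hz : z ∈ siegelDomain p
  · simp only [Pi.add_apply, compAdj_eq_inner hl hz, inner_add_right]
  · simp only [Pi.add_apply, compAdj_of_notMem _ hz, add_zero]

theorem compAdj_smul (hl : 0 < l) (c : ℂ) (b : CompSpace p) :
    compAdj l (c • b) = c • compAdj l b := by
  ext z
  by_cases hz : z ∈ siegelDomain p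
  · simp only [Pi.smul_apply, compAdj_eq_inner hl hz, inner_smul_right, smul_eq_mul]
  · simp only [Pi.smul_apply, compAdj_of_notMem _ hz, smul_zero]

theorem norm_compAdj_le (hl : 0 < l) {z : CSpace p} (hz : z ∈ siegelDomain p) (b : CompSpace p) :
    ‖compAdj l b z‖ ≤ √(siegelHeight z ^ (-l)) * ‖b‖ := by
  rw [compAdj_eq_inner hl hz]
  refine (norm_inner_le_norm _ _).trans ?_
  gcongr
  exact Real.le_sqrt_of_sq_le (norm_kernelVec_sq_le hl hz)

end Kernel

/-! ### Cauchy estimates and locally uniform limits in several variables. -/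

section Holomorphy

/-- The one-variable Cauchy estimate on the complex line t ↦ y + tv. -/
theorem norm_fderiv_le_of_ball {E : Type*} [NormedAddCommGroup E] [NormedSpace ℂ E] {g : E → ℂ}
    {y : E} {r C : ℝ} (hr : 0 < r) (hg : DifferentiableOn ℂ g (Metric.ball y r))
    (hC : ∀ z ∈ Metric.ball y r, ‖g z‖ ≤ C) : ‖fderiv ℂ g y‖ ≤ 2 * C / r := by
  have hC0 : 0 ≤ C := (norm_nonneg _).trans (hC y (Metric.mem_ball_self hr))
  refine ContinuousLinearMap.opNorm_le_bound _ (by positivity) fun v => ?_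
  rcases eq_or_ne v 0 with rfl | hv
  · simp
  have hv' : 0 < ‖v‖ := norm_pos_iff.2 hv
  -- With this radius the closed disc stays within distance r/2 of y.
  set R : ℝ := r / (2 * ‖v‖) with hR
  have hR0 : 0 < R := by positivity
  have hmem : ∀ t ∈ Metric.closedBall (0 : ℂ) R, y + t • v ∈ Metric.ball y r := by
    intro t ht
    rw [mem_closedBall_zero_iff] at ht
    rw [mem_ball_iff_norm, add_sub_cancel_left, norm_smul]
    calc ‖t‖ * ‖v‖ ≤ R * ‖v‖ := by gcongr
      _ = r / 2 := by rw [hR]; field_simp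
      _ < r := by linarith
  have hline : ∀ t ∈ Metric.closedBall (0 : ℂ) R,
      HasDerivAt (fun t : ℂ => g (y + t • v)) (fderiv ℂ g (y + t • v) v) t := by
    intro t ht
    have h1 := ((hg _ (hmem t ht)).differentiableAt
      (Metric.isOpen_ball.mem_nhds (hmem t ht))).hasFDerivAt
    have h2 : HasDerivAt (fun t : ℂ => y + t • v) v t := by
      simpa using ((hasDerivAt_id t).smul_const v).const_add y
    exact h1.comp_hasDerivAt t h2
  have hd : DiffContOnCl ℂ (fun t : ℂ => g (y + t • v)) (Metric.ball 0 R) := by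
    refine DifferentiableOn.diffContOnCl fun t ht => ?_
    rw [closure_ball _ hR0.ne'] at ht
    exact (hline t ht).differentiableAt.differentiableWithinAt
  have hb := Complex.norm_deriv_le_of_forall_mem_sphere_norm_le hR0 hd (C := C) fun t ht =>
    hC _ (hmem t (Metric.sphere_subset_closedBall ht))
  have h0 := (hline 0 (Metric.mem_closedBall_self hR0.le)).deriv
  rw [zero_smul, add_zero] at h0
  rw [h0] at hb
  refine hb.trans (le_of_eq ?_)
  rw [hR]
  field_simp

/-- Weierstrass' theorem: Cauchy estimates on balls of radius r/2 make the derivatives uniformly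
Cauchy on the concentric ball of radius r/2, so the limit may be differentiated. -/
theorem differentiableAt_of_uniform_limit {E : Type*} [NormedAddCommGroup E] [NormedSpace ℂ E]
    {F : ℕ → E → ℂ} {f : E → ℂ} {x : E} {r : ℝ} (hr : 0 < r) {ε : ℕ → ℝ}
    (hε : Tendsto ε atTop (𝓝 0)) (hF : ∀ j, DifferentiableOn ℂ (F j) (Metric.ball x r))
    (hb : ∀ j, ∀ z ∈ Metric.ball x r, ‖F j z - f z‖ ≤ ε j) : DifferentiableAt ℂ f x := by
  set s := Metric.ball x (r / 2) with hs
  have hsub : ∀ y ∈ s, Metric.ball y (r / 2) ⊆ Metric.ball x r := by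
    intro y hy
    refine Metric.ball_subset_ball' ?_
    have := Metric.mem_ball.1 hy
    linarith
  have hself : ∀ y ∈ s, y ∈ Metric.ball x r := fun y hy =>
    hsub y hy (Metric.mem_ball_self (by positivity))
  have hd : ∀ j, ∀ y ∈ s, DifferentiableAt ℂ (F j) y := fun j y hy =>
    (hF j _ (hself y hy)).differentiableAt (Metric.isOpen_ball.mem_nhds (hself y hy))
  have key : ∀ i j, ∀ y ∈ s, ‖fderiv ℂ (F i) y - fderiv ℂ (F j) y‖ ≤ 2 * (ε i + ε j) / (r / 2) := by
    intro i j y hy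
    rw [← fderiv_sub (hd i y hy) (hd j y hy)]
    refine norm_fderiv_le_of_ball (by positivity)
      (((hF i).sub (hF j)).mono (hsub y hy)) fun z hz => ?_
    have h1 := hb i z (hsub y hy hz)
    have h2 := hb j z (hsub y hy hz)
    calc ‖F i z - F j z‖ = ‖(F i z - f z) - (F j z - f z)‖ := by congr 1; ring
      _ ≤ _ := (norm_sub_le _ _).trans (add_le_add h1 h2)
  have hU : UniformCauchySeqOn (fun j => fderiv ℂ (F j)) atTop s := by
    rw [Metric.uniformCauchySeqOn_iff]
    intro δ hδ
    -- The bound in `key` equals 4(ε_i + ε_j)/r, which is then below δ/2.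
    have hη : 0 < δ * r / 16 := by positivity
    obtain ⟨N, hN⟩ := Metric.tendsto_atTop.1 hε _ hη
    refine ⟨N, fun i hi j hj y hy => ?_⟩
    rw [dist_eq_norm]
    refine (key i j y hy).trans_lt ?_
    have h1 := hN i hi
    have h2 := hN j hj
    rw [Real.dist_eq, sub_zero] at h1 h2
    have h3 := (le_abs_self _).trans_lt h1
    have h4 := (le_abs_self _).trans_lt h2
    rw [div_lt_iff₀ (by positivity)]
    nlinarith
  have hlim : ∀ y ∈ s, ∃ L, Tendsto (fun j => fderiv ℂ (F j) y) atTop (𝓝 L) := fun y hy =>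
    cauchySeq_tendsto_of_complete (hU.cauchySeq hy)
  choose! g' hg' using hlim
  have hT := hU.tendstoUniformlyOn_of_tendsto hg'
  refine (hasFDerivAt_of_tendstoUniformlyOn Metric.isOpen_ball hT
    (fun j y hy => (hd j y hy).hasFDerivAt) (fun y hy => ?_)
    (Metric.mem_ball_self (by positivity))).differentiableAt
  rw [tendsto_iff_norm_sub_tendsto_zero]
  exact squeeze_zero (fun _ => norm_nonneg _) (fun j => hb j y (hself y hy)) hε

end Holomorphy

/-! ### Band-limited functions, their density, and holomorphy of R^* b. -/

section Band

/-- `h` is in `L¹ ∩ L²` and supported in `[ε, ε⁻¹]`. -/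
structure IsBand (ε : ℝ) (h : ℝ → ℂ) : Prop where
  pos : 0 < ε
  integrable : Integrable h
  memLp : MemLp h 2
  supp : ∀ ξ, ξ ∉ Icc ε ε⁻¹ → h ξ = 0

/-- The function `ζ ↦ ∫ h(ξ) e^{iξζ} dξ`. -/
def bandIntegral (h : ℝ → ℂ) (ζ : ℂ) : ℂ := ∫ ξ, h ξ * Complex.exp (Complex.I * ξ * ζ)

theorem norm_exp_I_mul (ξ : ℝ) (ζ : ℂ) : ‖Complex.exp (Complex.I * ξ * ζ)‖ =
    Real.exp (-(ξ * ζ.im)) := by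
  rw [Complex.norm_exp]
  simp

theorem IsBand.norm_mul_exp_le {ε : ℝ} {h : ℝ → ℂ} (hh : IsBand ε h) (ξ : ℝ) {ζ : ℂ} {R : ℝ}
    (hR : |ζ.im| ≤ R) :
    ‖h ξ * Complex.exp (Complex.I * ξ * ζ)‖ ≤ ‖h ξ‖ * Real.exp (ε⁻¹ * R) := by
  rw [norm_mul, norm_exp_I_mul]
  by_cases hξ : ξ ∈ Icc ε ε⁻¹
  · refine mul_le_mul_of_nonneg_left (Real.exp_le_exp.2 ?_) (norm_nonneg _)
    have h1 : -(ξ * ζ.im) ≤ ξ * |ζ.im| := by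
      rw [← mul_neg]
      exact mul_le_mul_of_nonneg_left (neg_le_abs _) (hh.pos.le.trans hξ.1)
    exact h1.trans (mul_le_mul hξ.2 hR (abs_nonneg _) (inv_nonneg.2 hh.pos.le))
  · rw [hh.supp ξ hξ]
    simp

theorem IsBand.integrable_mul_exp {ε : ℝ} {h : ℝ → ℂ} (hh : IsBand ε h) (ζ : ℂ) :
    Integrable fun ξ : ℝ => h ξ * Complex.exp (Complex.I * ξ * ζ) := by
  refine (hh.integrable.norm.mul_const (Real.exp (ε⁻¹ * |ζ.im|))).mono' ?_
    (ae_of_all _ fun ξ => hh.norm_mul_exp_le ξ le_rfl)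
  exact hh.integrable.1.mul (by fun_prop : Measurable _).aestronglyMeasurable

/-- Differentiation under the integral sign; on the band the extra factor ξ is at most ε⁻¹, and the
exponential is bounded locally in ζ. -/
theorem IsBand.differentiable_bandIntegral {ε : ℝ} {h : ℝ → ℂ} (hh : IsBand ε h) :
    Differentiable ℂ (bandIntegral h) := by
  intro ζ
  have key := hasDerivAt_integral_of_dominated_loc_of_deriv_le (μ := volume) (𝕜 := ℂ)
    (F := fun ζ (ξ : ℝ) => h ξ * Complex.exp (Complex.I * ξ * ζ))
    (F' := fun ζ (ξ : ℝ) => h ξ * (Complex.exp (Complex.I * ξ * ζ) * (Complex.I * ξ)))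
    (x₀ := ζ) (s := Metric.ball ζ 1)
    (bound := fun ξ => ‖h ξ‖ * Real.exp (ε⁻¹ * (|ζ.im| + 1)) * ε⁻¹) (Metric.ball_mem_nhds _ one_pos)
    (Eventually.of_forall fun ζ => (hh.integrable_mul_exp ζ).1) (hh.integrable_mul_exp ζ)
    (hh.integrable.1.mul (by fun_prop : Measurable _).aestronglyMeasurable)
    (ae_of_all _ fun ξ w hw => ?_) ((hh.integrable.norm.mul_const _).mul_const _)
    (ae_of_all _ fun ξ w hw => ?_)
  · exact key.2.differentiableAt
  · have hw' : |w.im| ≤ |ζ.im| + 1 := by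
      have h1 : |(w - ζ).im| ≤ 1 := (Complex.abs_im_le_norm _).trans (by
        rw [← dist_eq_norm]; exact (Metric.mem_ball.1 hw).le)
      rw [Complex.sub_im] at h1
      have h2 := abs_add_le ζ.im (w.im - ζ.im)
      rw [add_sub_cancel] at h2
      linarith
    by_cases hξ : ξ ∈ Icc ε ε⁻¹
    · rw [← mul_assoc, norm_mul]
      refine mul_le_mul (hh.norm_mul_exp_le ξ hw') ?_ (norm_nonneg _) (by positivity)
      simp only [norm_mul, Complex.norm_I, one_mul, Complex.norm_real, Real.norm_eq_abs]
      rw [abs_of_nonneg (hh.pos.le.trans hξ.1)]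
      exact hξ.2
    · rw [hh.supp ξ hξ]
      simp
  · have h1 : HasDerivAt (fun w : ℂ => Complex.I * ξ * w) (Complex.I * ξ) w := by
      simpa using (hasDerivAt_id w).const_mul (Complex.I * (ξ : ℂ))
    exact h1.cexp.const_mul (h ξ)

theorem bandIntegral_eq_expIntegral (h : ℝ → ℂ) (x y : ℝ) :
    bandIntegral h ⟨x, y⟩ = expIntegral (fun ξ => h ξ * (Real.exp (-(ξ * y)) : ℂ)) x := by
  rw [bandIntegral, expIntegral]
  congr 1
  ext ξ
  rw [mul_assoc (h ξ), Complex.ofReal_exp, ← Complex.exp_add]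
  congr 2
  apply Complex.ext <;> simp

/-- An element of `L_2(ℝ_+)` supported in a compact subset of `(0, ∞)`. -/
def IsNice (f : HalfLineL2) : Prop :=
  ∃ ε > 0, ∀ᵐ ξ ∂(volume.restrict (Ioi (0 : ℝ))), ξ ∉ Icc ε ε⁻¹ → (f : ℝ → ℂ) ξ = 0

theorem Icc_inv_subset_Ioi {ε : ℝ} (hε : 0 < ε) : Icc ε ε⁻¹ ⊆ Ioi 0 := fun _ h =>
  hε.trans_le h.1

theorem memLp_indicator_band {ε : ℝ} (f : HalfLineL2) :
    MemLp ((Icc ε ε⁻¹).indicator (f : ℝ → ℂ)) 2 (volume.restrict (Ioi (0 : ℝ))) :=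
  (Lp.memLp f).indicator measurableSet_Icc

/-- The truncation of `f` to `[ε, ε⁻¹]`. -/
def bandTrunc (ε : ℝ) (f : HalfLineL2) : HalfLineL2 := (memLp_indicator_band (ε := ε) f).toLp _

theorem bandTrunc_ae (ε : ℝ) (f : HalfLineL2) : (bandTrunc ε f : ℝ → ℂ) =ᵐ[volume.restrict (Ioi 0)]
    (Icc ε ε⁻¹).indicator (f : ℝ → ℂ) := MemLp.coeFn_toLp _

theorem isNice_bandTrunc {ε : ℝ} (hε : 0 < ε) (f : HalfLineL2) : IsNice (bandTrunc ε f) := by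
  refine ⟨ε, hε, ?_⟩
  filter_upwards [bandTrunc_ae ε f] with ξ h1 h2
  rw [h1, indicator_of_notMem h2]

/-- Dominated convergence along the bands [1/(j+1), j+1], which exhaust the half-line. -/
theorem tendsto_bandTrunc (f : HalfLineL2) :
    Tendsto (fun j : ℕ => bandTrunc ((j : ℝ) + 1)⁻¹ f) atTop (𝓝 f) := by
  rw [tendsto_iff_norm_sub_tendsto_zero]
  have e : ∀ j : ℕ, ‖bandTrunc ((j : ℝ) + 1)⁻¹ f - f‖ ^ 2 = ∫ ξ in Ioi (0 : ℝ),
      ‖(Icc ((j : ℝ) + 1)⁻¹ ((j : ℝ) + 1)⁻¹⁻¹).indicator (f : ℝ → ℂ) ξ - f ξ‖ ^ 2 := by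
    intro j
    have h := (memLp_indicator_band (ε := ((j : ℝ) + 1)⁻¹) f).sub (Lp.memLp f)
    rw [← Lp.toLp_coeFn f (Lp.memLp f), bandTrunc, Lp.toLp_coeFn f (Lp.memLp f)]
    conv_lhs => rw [← Lp.toLp_coeFn f (Lp.memLp f)]
    simp only [Lp.toLp_coeFn]
    conv_lhs => enter [1, 1, 2]; rw [← Lp.toLp_coeFn f (Lp.memLp f)]
    rw [← MemLp.toLp_sub, norm_toLp_sq]
    rfl
  have h2 : Tendsto (fun j : ℕ => ‖bandTrunc ((j : ℝ) + 1)⁻¹ f - f‖ ^ 2) atTop (𝓝 0) := by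
    simp only [e]
    have hi := (Lp.memLp f).integrable_norm_pow (by norm_num)
    have := tendsto_integral_of_dominated_convergence (μ := volume.restrict (Ioi (0 : ℝ)))
      (F := fun (j : ℕ) ξ =>
        ‖(Icc ((j : ℝ) + 1)⁻¹ ((j : ℝ) + 1)⁻¹⁻¹).indicator (f : ℝ → ℂ) ξ - f ξ‖ ^ 2)
      (f := fun _ => (0 : ℝ)) (fun ξ => ‖(f : ℝ → ℂ) ξ‖ ^ 2) (fun j => ?_) hi (fun j => ?_) ?_
    · simpa using this
    · exact (((memLp_indicator_band f).sub (Lp.memLp f)).1.norm.pow 2)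
    · refine ae_of_all _ fun ξ => ?_
      rw [Real.norm_of_nonneg (by positivity)]
      by_cases hξ : ξ ∈ Icc ((j : ℝ) + 1)⁻¹ ((j : ℝ) + 1)⁻¹⁻¹
      · rw [indicator_of_mem hξ]; simp
      · rw [indicator_of_notMem hξ]; simp
    · refine (ae_restrict_iff' measurableSet_Ioi).2 (ae_of_all _ fun ξ hξ => ?_)
      refine tendsto_const_nhds.congr' ?_
      -- From this index on, ξ lies in the band, and the truncation does not change f at ξ.
      obtain ⟨N, hN⟩ := exists_nat_ge (max ξ ξ⁻¹)
      filter_upwards [eventually_ge_atTop N] with j hj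
      have hj' : max ξ ξ⁻¹ ≤ (j : ℝ) + 1 := hN.trans (by
        have : (N : ℝ) ≤ j := by exact_mod_cast hj
        linarith)
      have hmem : ξ ∈ Icc ((j : ℝ) + 1)⁻¹ ((j : ℝ) + 1)⁻¹⁻¹ := by
        refine ⟨?_, ?_⟩
        · exact inv_le_of_inv_le₀ hξ ((le_max_right _ _).trans hj')
        · rw [inv_inv]
          exact (le_max_left _ _).trans hj'
      rw [indicator_of_mem hmem]
      simp
  have h3 := (Real.continuous_sqrt.tendsto 0).comp h2
  simpa [Function.comp_def, Real.sqrt_sq] using h3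

/-- Truncations approximate each coordinate in L², and finite sums of single coordinates approximate
b, so closedness and additivity suffice. -/
theorem compSpace_induction {p : ℕ} {C : Set (CompSpace p)} (hc : IsClosed C)
    (hadd : ∀ a ∈ C, ∀ b ∈ C, a + b ∈ C)
    (hsingle : ∀ n (f : HalfLineL2), IsNice f → lp.single 2 n f ∈ C) (b : CompSpace p) : b ∈ C := by
  have h1 : ∀ n (f : HalfLineL2), lp.single 2 n f ∈ C := by
    intro n f
    have hcont : Continuous fun f : HalfLineL2 =>
        (lp.single 2 n f : CompSpace p) := 
      (lp.isometry_single (E := fun _ : Fin (p - 1) → ℕ => HalfLineL2) (p := 2) n).continuous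
    refine hc.mem_of_tendsto ((hcont.tendsto f).comp (tendsto_bandTrunc f))
      (Eventually.of_forall fun j => hsingle n _ (isNice_bandTrunc (by positivity) f))
  have h0 : (0 : CompSpace p) ∈ C := by
    have := h1 0 0
    rwa [lp.single_zero] at this
  refine hc.mem_of_tendsto (lp.hasSum_single (by norm_num) b) (Eventually.of_forall fun s => ?_)
  exact Finset.sum_induction _ (· ∈ C) (fun a b ha hb => hadd a ha b hb) h0 fun n _ => h1 n _

variable {p : ℕ} {l : ℝ}

/-- The function `k_n f`, cut off to `[ε, ε⁻¹]`. -/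
def bandFun (p : ℕ) (l : ℝ) (ε : ℝ) (n : Fin (p - 1) → ℕ) (f : HalfLineL2) (ξ : ℝ) : ℂ :=
  (Icc ε ε⁻¹).indicator (fun ξ => (bargmannFactor p l n ξ : ℂ) * (f : ℝ → ℂ) ξ) ξ

theorem continuousOn_bargmannFactor (n : Fin (p - 1) → ℕ) :
    ContinuousOn (bargmannFactor p l n) (Ioi 0) := by
  unfold bargmannFactor
  refine continuousOn_const.mul (ContinuousOn.sqrt (ContinuousOn.div_const
    (continuousOn_const.mul (ContinuousOn.rpow_const (by fun_prop) fun ξ hξ => Or.inl ?_)) _))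
  exact mul_ne_zero two_ne_zero (ne_of_gt hξ)

theorem exists_bargmannFactor_le {ε : ℝ} (hε : 0 < ε) (n : Fin (p - 1) → ℕ) :
    ∃ C, ∀ ξ ∈ Icc ε ε⁻¹, bargmannFactor p l n ξ ≤ C := by
  obtain ⟨C, hC⟩ := isCompact_Icc.bddAbove_image
    ((continuousOn_bargmannFactor (l := l) n).mono (Icc_inv_subset_Ioi hε))
  exact ⟨C, fun ξ hξ => hC (mem_image_of_mem _ hξ)⟩

theorem isBand_bandFun {ε : ℝ} (hε : 0 < ε) (n : Fin (p - 1) → ℕ) (f : HalfLineL2) :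
    IsBand ε (bandFun p l ε n f) := by
  obtain ⟨C, hC⟩ := exists_bargmannFactor_le (l := l) hε n
  have hf : MemLp (f : ℝ → ℂ) 2 (volume.restrict (Icc ε ε⁻¹)) :=
    (Lp.memLp f).mono_measure (Measure.restrict_mono (Icc_inv_subset_Ioi hε) le_rfl)
  have hm : MemLp (fun ξ => (bargmannFactor p l n ξ : ℂ) * (f : ℝ → ℂ) ξ) 2
      (volume.restrict (Icc ε ε⁻¹)) := by
    refine hf.of_le_mul (c := C) ((Complex.measurable_ofReal.comp
      (measurable_bargmannFactor n)).aestronglyMeasurable.mul hf.1) ?_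
    refine (ae_restrict_iff' measurableSet_Icc).2 (ae_of_all _ fun ξ hξ => ?_)
    rw [norm_mul, Complex.norm_real, Real.norm_of_nonneg (bargmannFactor_nonneg _ _)]
    exact mul_le_mul_of_nonneg_right (hC ξ hξ) (norm_nonneg _)
  refine ⟨hε, ?_, ?_, fun ξ hξ => indicator_of_notMem hξ _⟩
  · exact (integrable_indicator_iff measurableSet_Icc).2 (hm.integrable (by norm_num))
  · exact (memLp_indicator_iff_restrict measurableSet_Icc).2 hm

/-- A single band-limited coordinate gives a monomial in z' times an entire function of z_p. This is
the form on which Plancherel can act. -/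
theorem compAdj_single (hl : 0 < l) {ε : ℝ} (hε : 0 < ε) (n : Fin (p - 1) → ℕ) {f : HalfLineL2}
    (hf : ∀ᵐ ξ ∂(volume.restrict (Ioi (0 : ℝ))), ξ ∉ Icc ε ε⁻¹ → (f : ℝ → ℂ) ξ = 0)
    {z : CSpace p} (hz : z ∈ siegelDomain p) :
    compAdj l (lp.single 2 n f) z = (∏ k, z.1 k ^ n k) * bandIntegral (bandFun p l ε n f) z.2 := by
  rw [compAdj_eq_inner hl hz, lp.inner_single_right, inner_kernelVec_apply, bandIntegral,
    ← integral_const_mul]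
  have e : ∀ ξ : ℝ, (∏ k, z.1 k ^ n k) *
      (bandFun p l ε n f ξ * Complex.exp (Complex.I * ξ * z.2)) =
      (Icc ε ε⁻¹).indicator (fun ξ => (bargmannFactor p l n ξ : ℂ) * (f : ℝ → ℂ) ξ *
        (∏ k, z.1 k ^ n k) * Complex.exp (Complex.I * ξ * z.2)) ξ := by
    intro ξ
    by_cases hξ : ξ ∈ Icc ε ε⁻¹
    · rw [bandFun, indicator_of_mem hξ, indicator_of_mem hξ]
      ring
    · rw [bandFun, indicator_of_notMem hξ, indicator_of_notMem hξ]
      ring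
  simp only [e]
  rw [integral_indicator measurableSet_Icc]
  refine setIntegral_eq_of_subset_of_ae_sdiff_eq_zero measurableSet_Ioi.nullMeasurableSet
    (Icc_inv_subset_Ioi hε) ?_
  filter_upwards [(ae_restrict_iff' measurableSet_Ioi).1 hf] with ξ h1 h2
  rw [h1 h2.1 h2.2]
  ring

/-- Holomorphy is clear for single band-limited coordinates and survives norm limits, which by
`norm_compAdj_le` are locally uniform limits. -/
theorem differentiableOn_compAdj (hl : 0 < l) (b : CompSpace p) :
    DifferentiableOn ℂ (compAdj l b) (siegelDomain p) := by
  let C : Set (CompSpace p) := {b | DifferentiableOn ℂ (compAdj l b) (siegelDomain p)}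
  have hC : IsClosed C := by
    refine IsSeqClosed.isClosed fun u b hu hub z hz => ?_
    have hz' : 0 < siegelHeight z := hz
    -- On this ball the height stays above half its value at the centre, so the factor ρ^(-l) in the
    -- growth bound is uniformly bounded.
    obtain ⟨r, hr, hball⟩ := Metric.isOpen_iff.1
      (continuous_siegelHeight.isOpen_preimage _ (isOpen_Ioi (a := siegelHeight z / 2))) z
      (show siegelHeight z / 2 < siegelHeight z by linarith)
    have hsub : Metric.ball z r ⊆ siegelDomain p := fun w hw =>
      (half_pos hz').trans (hball hw)
    refine (differentiableAt_of_uniform_limit (F := fun j => compAdj l (u j)) hr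
      (ε := fun j => √((siegelHeight z / 2) ^ (-l)) * ‖u j - b‖) ?_
      (fun j => (hu j).mono hsub) fun j w hw => ?_).differentiableWithinAt
    · simpa using (tendsto_iff_norm_sub_tendsto_zero.1 hub).const_mul
        (√((siegelHeight z / 2) ^ (-l)))
    · have e : compAdj l (u j) w - compAdj l b w = compAdj l (u j - b) w := by
        rw [compAdj_eq_inner hl (hsub hw), compAdj_eq_inner hl (hsub hw),
          compAdj_eq_inner hl (hsub hw), inner_sub_right]
      rw [e]
      refine (norm_compAdj_le hl (hsub hw) _).trans ?_
      refine mul_le_mul_of_nonneg_right (Real.sqrt_le_sqrt ?_) (norm_nonneg _)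
      exact Real.rpow_le_rpow_of_nonpos (half_pos hz') (le_of_lt (hball hw)) (neg_nonpos.2 hl.le)
  refine compSpace_induction (C := C) hC (fun a ha b hb => ?_) (fun n f hf => ?_) b
  · change DifferentiableOn ℂ (compAdj l (a + b)) _
    rw [compAdj_add hl]
    exact DifferentiableOn.add ha hb
  · obtain ⟨ε, hε, hf⟩ := hf
    have h2 : DifferentiableOn ℂ (fun z : CSpace p => (∏ k, z.1 k ^ n k) *
        bandIntegral (bandFun p l ε n f) z.2) (siegelDomain p) := by
      have h3 := (isBand_bandFun (l := l) hε n f).differentiable_bandIntegral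
      have h4 : Differentiable ℂ fun z : CSpace p => (∏ k, z.1 k ^ n k) := by fun_prop
      exact (h4.mul (h3.comp differentiable_snd)).differentiableOn
    exact h2.congr fun z hz => compAdj_single hl hε n hf hz

end Band

/-! ### Plancherel on the lines Im z_p = y. -/

section Slices

theorem IsBand.mul_exp {ε : ℝ} {h : ℝ → ℂ} (hh : IsBand ε h) (y : ℝ) :
    IsBand ε (fun ξ => h ξ * (Real.exp (-(ξ * y)) : ℂ)) := by
  have hm : AEStronglyMeasurable (fun ξ => h ξ * (Real.exp (-(ξ * y)) : ℂ)) volume :=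
    hh.integrable.1.mul (by fun_prop : Measurable _).aestronglyMeasurable
  have hb : ∀ ξ, ‖h ξ * (Real.exp (-(ξ * y)) : ℂ)‖ ≤ Real.exp (ε⁻¹ * |y|) * ‖h ξ‖ := by
    intro ξ
    have := hh.norm_mul_exp_le ξ (ζ := ⟨0, y⟩) (R := |y|) le_rfl
    rw [norm_mul, norm_exp_I_mul] at this
    rw [norm_mul, Complex.norm_real, Real.norm_of_nonneg (Real.exp_pos _).le]
    linarith
  exact ⟨hh.pos, hh.integrable.norm.const_mul _ |>.mono' hm (ae_of_all _ hb),
    hh.memLp.of_le_mul hm (ae_of_all _ hb), fun ξ hξ => by rw [hh.supp ξ hξ, zero_mul]⟩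

theorem IsBand.memLp_slice {ε : ℝ} {h : ℝ → ℂ} (hh : IsBand ε h) (y : ℝ) :
    MemLp (fun x : ℝ => bandIntegral h ⟨x, y⟩) 2 := by
  simp only [bandIntegral_eq_expIntegral]
  exact memLp_expIntegral (hh.mul_exp y).integrable (hh.mul_exp y).memLp

/-- On the line Im ζ = y each factor has density h(ξ)e^{-ξy}; the two exponentials combine to
e^{-2ξy}. -/
theorem IsBand.integral_slice {ε₁ ε₂ : ℝ} {h₁ h₂ : ℝ → ℂ} (hh₁ : IsBand ε₁ h₁)
    (hh₂ : IsBand ε₂ h₂) (y : ℝ) :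
    ∫ x : ℝ, (starRingEnd ℂ) (bandIntegral h₁ ⟨x, y⟩) * bandIntegral h₂ ⟨x, y⟩ =
      (2 * Real.pi : ℝ) * ∫ ξ, (starRingEnd ℂ) (h₁ ξ) * h₂ ξ * (Real.exp (-(2 * ξ * y)) : ℂ) := by
  simp only [bandIntegral_eq_expIntegral]
  rw [integral_conj_expIntegral_mul (hh₁.mul_exp y).integrable (hh₁.mul_exp y).memLp
    (hh₂.mul_exp y).integrable (hh₂.mul_exp y).memLp]
  congr 2
  ext ξ
  rw [map_mul, Complex.conj_ofReal]
  have : Real.exp (-(2 * ξ * y)) = Real.exp (-(ξ * y)) * Real.exp (-(ξ * y)) := by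
    rw [← Real.exp_add]; ring_nf
  rw [this]
  push_cast
  ring

/-- Frequencies below ε are absent. The resulting decay e^{-2εy} is what makes the integrals over
(z', v) converge for polynomially growing symbols. -/
theorem IsBand.integral_norm_slice_sq_le {ε : ℝ} {h : ℝ → ℂ} (hh : IsBand ε h) {y : ℝ}
    (hy : 0 ≤ y) : ∫ x : ℝ, ‖bandIntegral h ⟨x, y⟩‖ ^ 2 ≤
      2 * Real.pi * (∫ ξ, ‖h ξ‖ ^ 2) * Real.exp (-(2 * ε * y)) := by
  have h1 := hh.integral_slice hh y
  have e1 : ∫ x : ℝ, (starRingEnd ℂ) (bandIntegral h ⟨x, y⟩) * bandIntegral h ⟨x, y⟩ =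
      ((∫ x : ℝ, ‖bandIntegral h ⟨x, y⟩‖ ^ 2 : ℝ) : ℂ) := by
    rw [← integral_complex_ofReal]
    congr 1
    ext x
    rw [mul_comm, Complex.mul_conj, Complex.normSq_eq_norm_sq]
  have e2 : ∫ ξ, (starRingEnd ℂ) (h ξ) * h ξ * (Real.exp (-(2 * ξ * y)) : ℂ) =
      ((∫ ξ, ‖h ξ‖ ^ 2 * Real.exp (-(2 * ξ * y)) : ℝ) : ℂ) := by
    rw [← integral_complex_ofReal]
    congr 1
    ext ξ
    rw [mul_comm ((starRingEnd ℂ) _), Complex.mul_conj, Complex.normSq_eq_norm_sq]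
    push_cast
    ring
  rw [e1, e2, ← Complex.ofReal_mul] at h1
  have h1' := Complex.ofReal_injective h1
  rw [h1', mul_assoc, mul_assoc, ← integral_mul_const]
  have hsq : Integrable fun ξ => ‖h ξ‖ ^ 2 := (memLp_two_iff_integrable_sq_norm hh.memLp.1).1 hh.memLp
  have hle : ∀ ξ, ‖h ξ‖ ^ 2 * Real.exp (-(2 * ξ * y)) ≤ ‖h ξ‖ ^ 2 * Real.exp (-(2 * ε * y)) := by
    intro ξ
    by_cases hξ : ξ ∈ Icc ε ε⁻¹
    · have := mul_le_mul_of_nonneg_right hξ.1 hy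
      gcongr
      exact hξ.1
    · rw [hh.supp ξ hξ]; simp
  rw [← mul_assoc]
  refine mul_le_mul_of_nonneg_left (integral_mono ?_ (hsq.mul_const _) hle) (by positivity)
  refine (hsq.mul_const (Real.exp (-(2 * ε * y)))).mono' ?_ (ae_of_all _ fun ξ => ?_)
  · exact hsq.1.mul (by fun_prop : Measurable _).aestronglyMeasurable
  · rw [Real.norm_of_nonneg (by positivity)]
    exact hle ξ

end Slices

/-! ### Diagonalisation of forms with invariant symbols. -/

section Symbols

variable {p : ℕ}

/-- The space of `(z', v)`, `v = Im z_p - |z'|²`. -/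
abbrev SiegelBase (p : ℕ) : Type := (Fin (p - 1) → ℂ) × ℝ

/-- Lebesgue measure on `{v > 0}`. -/
def baseMeasure (p : ℕ) : Measure (SiegelBase p) := volume.restrict {w | 0 < w.2}

/-- `Im z_p = v + |z'|²`. -/
def baseIm (w : SiegelBase p) : ℝ := w.2 + ∑ k, ‖w.1 k‖ ^ 2

theorem siegelCoord_apply (w : SiegelBase p) (x : ℝ) :
    siegelCoord p (w, x) = (w.1, ⟨x, baseIm w⟩) := rfl

theorem measurableSet_base (p : ℕ) : MeasurableSet {w : SiegelBase p | 0 < w.2} :=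
  measurableSet_lt measurable_const measurable_snd

theorem measurable_baseIm : Measurable (baseIm : SiegelBase p → ℝ) := by
  unfold baseIm
  fun_prop

theorem baseIm_nonneg {w : SiegelBase p} (hw : 0 < w.2) : 0 ≤ baseIm w := by
  unfold baseIm
  positivity

instance : SFinite (baseMeasure p) := by
  unfold baseMeasure
  infer_instance

theorem ae_baseMeasure {P : SiegelBase p → Prop} (h : ∀ w, 0 < w.2 → P w) :
    ∀ᵐ w ∂(baseMeasure p), P w :=
  (ae_restrict_iff' (measurableSet_base p)).2 (ae_of_all _ h)

/-- Measurable functions of `(z', v)` bounded by `C (v^α + v^β)` with `α, β > -1`. -/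
structure IsTame (s : SiegelBase p → ℂ) : Prop where
  measurable : Measurable s
  bound : ∃ C α β : ℝ, -1 < α ∧ -1 < β ∧ ∀ w : SiegelBase p, 0 < w.2 → ‖s w‖ ≤ C * (w.2 ^ α + w.2 ^ β)

theorem integrable_base_gamma (N : Fin (p - 1) → ℕ) {α c : ℝ} (hα : -1 < α) (hc : 0 < c) :
    Integrable (fun w : SiegelBase p => (∏ k, ‖w.1 k‖ ^ N k) * Real.exp (-c * baseIm w) * w.2 ^ α)
      (baseMeasure p) := by
  -- In the coordinate r_k = |z_k|² the factor |z_k|^(N_k) is r_k^(N_k/2).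
  have h := integrableOn_comp_normSqMap (integrableOn_orthantGamma (p := p)
    (s := fun k => (N k : ℝ) / 2) (fun k => by
      have : (0 : ℝ) ≤ (N k : ℝ) / 2 := by positivity
      linarith) hα hc)
  refine Integrable.congr h (ae_of_all _ fun w => ?_)
  simp only [orthantGamma, normSqMap, baseIm]
  congr 3
  ext k
  rw [← Real.rpow_natCast (‖w.1 k‖) 2, ← Real.rpow_natCast (‖w.1 k‖) (N k),
    ← Real.rpow_mul (norm_nonneg _)]
  congr 1
  push_cast
  ring

theorem IsTame.integrable {s : SiegelBase p → ℂ} (hs : IsTame s) (N : Fin (p - 1) → ℕ) {c : ℝ}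
    (hc : 0 < c) : Integrable (fun w : SiegelBase p =>
      (∏ k, ‖w.1 k‖ ^ N k) * ‖s w‖ * Real.exp (-c * baseIm w)) (baseMeasure p) := by
  obtain ⟨C, α, β, hα, hβ, hb⟩ := hs.bound
  refine (((integrable_base_gamma N hα hc).add (integrable_base_gamma N hβ hc)).const_mul C).mono'
    ?_ (ae_baseMeasure fun w hw => ?_)
  · have := hs.measurable
    have := measurable_baseIm (p := p)
    fun_prop
  · rw [Real.norm_of_nonneg (by positivity)]
    calc _ ≤ (∏ k, ‖w.1 k‖ ^ N k) * (C * (w.2 ^ α + w.2 ^ β)) * Real.exp (-c * baseIm w) := by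
          gcongr
          exact hb w hw
      _ = _ := by
          simp only [Pi.add_apply]
          ring

/-- The monomial `conj (z')^n (z')^m`. -/
def monoPair (n m : Fin (p - 1) → ℕ) (w : SiegelBase p) : ℂ :=
  (starRingEnd ℂ) (∏ k, w.1 k ^ n k) * ∏ k, w.1 k ^ m k

theorem measurable_monoPair (n m : Fin (p - 1) → ℕ) : Measurable (monoPair n m) := by
  unfold monoPair
  have : Continuous fun w : SiegelBase p => (starRingEnd ℂ) (∏ k, w.1 k ^ n k) * ∏ k, w.1 k ^ m k :=
    (Complex.continuous_conj.comp (by fun_prop)).mul (by fun_prop)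
  exact this.measurable

theorem norm_monoPair (n m : Fin (p - 1) → ℕ) (w : SiegelBase p) :
    ‖monoPair n m w‖ = ∏ k, ‖w.1 k‖ ^ (n + m) k := by
  rw [monoPair, norm_mul, RCLike.norm_conj, norm_prod, norm_prod, ← Finset.prod_mul_distrib]
  simp [pow_add]

/-- The symbol does not depend on Re z_p, so for fixed (z', v) the integral over x is Plancherel's;
a second use of Fubini moves ξ to the outside. The exponential decay of the slices dominates both
exchanges. -/
theorem core_band {ε₁ ε₂ : ℝ} {h₁ h₂ : ℝ → ℂ} (hh₁ : IsBand ε₁ h₁) (hh₂ : IsBand ε₂ h₂)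
    (n m : Fin (p - 1) → ℕ) {s : SiegelBase p → ℂ} (hs : IsTame s) {σ : CSpace p → ℂ}
    (hσ : ∀ (w : SiegelBase p) (x : ℝ), 0 < w.2 → σ (siegelCoord p (w, x)) = s w) :
    IntegrableOn (fun z : CSpace p => (starRingEnd ℂ) ((∏ k, z.1 k ^ n k) * bandIntegral h₁ z.2) *
      ((∏ k, z.1 k ^ m k) * bandIntegral h₂ z.2) * σ z) (siegelDomain p) ∧
    ∫ z in siegelDomain p, (starRingEnd ℂ) ((∏ k, z.1 k ^ n k) * bandIntegral h₁ z.2) *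
      ((∏ k, z.1 k ^ m k) * bandIntegral h₂ z.2) * σ z =
    (2 * Real.pi : ℝ) * ∫ ξ, (starRingEnd ℂ) (h₁ ξ) * h₂ ξ *
      ∫ w, monoPair n m w * s w * (Real.exp (-(2 * ξ * baseIm w)) : ℂ) ∂(baseMeasure p) := by
  set G : SiegelBase p × ℝ → ℂ := fun u => (monoPair n m u.1 * s u.1) *
    ((starRingEnd ℂ) (bandIntegral h₁ ⟨u.2, baseIm u.1⟩) * bandIntegral h₂ ⟨u.2, baseIm u.1⟩) with hG
  have hGeq : (fun u : SiegelBase p × ℝ => (starRingEnd ℂ) ((∏ k, (siegelCoord p u).1 k ^ n k) *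
      bandIntegral h₁ (siegelCoord p u).2) * ((∏ k, (siegelCoord p u).1 k ^ m k) *
      bandIntegral h₂ (siegelCoord p u).2) * σ (siegelCoord p u)) =ᵐ[(baseMeasure p).prod volume] G := by
    have h1 : ∀ᵐ u ∂((baseMeasure p).prod (volume : Measure ℝ)), 0 < u.1.2 :=
      Measure.quasiMeasurePreserving_fst.ae (ae_baseMeasure fun w hw => hw)
    filter_upwards [h1] with u hu
    obtain ⟨w, x⟩ := u
    rw [hσ w x hu, siegelCoord_apply, hG]
    simp only [map_mul, monoPair]
    ring
  have hmk : Measurable fun u : SiegelBase p × ℝ => (⟨u.2, baseIm u.1⟩ : ℂ) :=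
    Complex.measurableEquivRealProd.symm.measurable.comp
      (measurable_snd.prodMk (measurable_baseIm.comp measurable_fst))
  have hB : ∀ {ε} {h : ℝ → ℂ}, IsBand ε h → Measurable fun u : SiegelBase p × ℝ =>
      bandIntegral h ⟨u.2, baseIm u.1⟩ := fun hh =>
    hh.differentiable_bandIntegral.continuous.measurable.comp hmk
  have hGm : Measurable G :=
    (((measurable_monoPair n m).comp measurable_fst).mul (hs.measurable.comp measurable_fst)).mul
      ((Complex.continuous_conj.measurable.comp (hB hh₁)).mul (hB hh₂))
  -- A decay rate valid for both functions.
  set ε := min ε₁ ε₂ with hε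
  have hε0 : 0 < ε := lt_min hh₁.pos hh₂.pos
  have hbase := hs.integrable (n + m) (c := 2 * ε) (by positivity)
  -- From |ab| ≤ (|a|² + |b|²)/2 and the constant 2π of Plancherel.
  set K : ℝ := Real.pi * ((∫ ξ, ‖h₁ ξ‖ ^ 2) + ∫ ξ, ‖h₂ ξ‖ ^ 2) with hK
  have hslice : ∀ w : SiegelBase p, Integrable fun x : ℝ =>
      (starRingEnd ℂ) (bandIntegral h₁ ⟨x, baseIm w⟩) * bandIntegral h₂ ⟨x, baseIm w⟩ := fun w =>
    (memLp_conj (hh₁.memLp_slice (baseIm w))).integrable_mul (hh₂.memLp_slice (baseIm w))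
  have hGi : Integrable G ((baseMeasure p).prod volume) := by
    rw [integrable_prod_iff hGm.aestronglyMeasurable]
    refine ⟨ae_of_all _ fun w => (hslice w).const_mul (monoPair n m w * s w), ?_⟩
    refine (hbase.const_mul K).mono' hGm.norm.stronglyMeasurable.integral_prod_right.aestronglyMeasurable
      (ae_baseMeasure fun w hw => ?_)
    rw [Real.norm_of_nonneg (integral_nonneg fun _ => norm_nonneg _)]
    have hy := baseIm_nonneg hw
    have i1 := (memLp_two_iff_integrable_sq_norm (hh₁.memLp_slice (baseIm w)).1).1
      (hh₁.memLp_slice (baseIm w))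
    have i2 := (memLp_two_iff_integrable_sq_norm (hh₂.memLp_slice (baseIm w)).1).1
      (hh₂.memLp_slice (baseIm w))
    have b1 := hh₁.integral_norm_slice_sq_le hy
    have b2 := hh₂.integral_norm_slice_sq_le hy
    have c1 : Real.exp (-(2 * ε₁ * baseIm w)) ≤ Real.exp (-(2 * ε) * baseIm w) := by
      refine Real.exp_le_exp.2 ?_
      have := mul_le_mul_of_nonneg_right (min_le_left ε₁ ε₂) hy
      linarith
    have c2 : Real.exp (-(2 * ε₂ * baseIm w)) ≤ Real.exp (-(2 * ε) * baseIm w) := by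
      refine Real.exp_le_exp.2 ?_
      have := mul_le_mul_of_nonneg_right (min_le_right ε₁ ε₂) hy
      linarith
    have hprod : ∫ x : ℝ, ‖(starRingEnd ℂ) (bandIntegral h₁ ⟨x, baseIm w⟩) *
        bandIntegral h₂ ⟨x, baseIm w⟩‖ ≤ K * Real.exp (-(2 * ε) * baseIm w) := by
      calc _ ≤ ∫ x : ℝ, (‖bandIntegral h₁ ⟨x, baseIm w⟩‖ ^ 2 / 2 +
            ‖bandIntegral h₂ ⟨x, baseIm w⟩‖ ^ 2 / 2) := by
            refine integral_mono (hslice w).norm ((i1.div_const 2).add (i2.div_const 2)) fun x => ?_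
            simp only [norm_mul, RCLike.norm_conj]
            nlinarith [sq_nonneg (‖bandIntegral h₁ ⟨x, baseIm w⟩‖ - ‖bandIntegral h₂ ⟨x, baseIm w⟩‖)]
        _ = (∫ x : ℝ, ‖bandIntegral h₁ ⟨x, baseIm w⟩‖ ^ 2) / 2 +
            (∫ x : ℝ, ‖bandIntegral h₂ ⟨x, baseIm w⟩‖ ^ 2) / 2 := by
            rw [integral_add (i1.div_const 2) (i2.div_const 2), integral_div, integral_div]
        _ ≤ 2 * Real.pi * (∫ ξ, ‖h₁ ξ‖ ^ 2) * Real.exp (-(2 * ε) * baseIm w) / 2 +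
            2 * Real.pi * (∫ ξ, ‖h₂ ξ‖ ^ 2) * Real.exp (-(2 * ε) * baseIm w) / 2 := by
            have p1 : 0 ≤ ∫ ξ, ‖h₁ ξ‖ ^ 2 := integral_nonneg fun _ => by positivity
            have p2 : 0 ≤ ∫ ξ, ‖h₂ ξ‖ ^ 2 := integral_nonneg fun _ => by positivity
            have q1 := b1.trans (mul_le_mul_of_nonneg_left c1 (by positivity))
            have q2 := b2.trans (mul_le_mul_of_nonneg_left c2 (by positivity))
            linarith
        _ = _ := by rw [hK]; ring
    calc ∫ x, ‖G (w, x)‖ = ‖monoPair n m w * s w‖ * ∫ x : ℝ,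
          ‖(starRingEnd ℂ) (bandIntegral h₁ ⟨x, baseIm w⟩) * bandIntegral h₂ ⟨x, baseIm w⟩‖ := by
          rw [← integral_const_mul]
          simp only [hG, norm_mul]
      _ ≤ ‖monoPair n m w * s w‖ * (K * Real.exp (-(2 * ε) * baseIm w)) := by gcongr
      _ = _ := by
          rw [norm_mul, norm_monoPair]
          ring
  constructor
  · rw [integrableOn_siegelDomain_iff]
    exact hGi.congr hGeq.symm
  · rw [setIntegral_siegelDomain]
    change ∫ u, _ ∂((baseMeasure p).prod volume) = _
    rw [integral_congr_ae hGeq, integral_prod _ hGi]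
    simp only [hG, integral_const_mul, hh₁.integral_slice hh₂]
    have e1 : ∀ w : SiegelBase p, (monoPair n m w * s w) * (((2 * Real.pi : ℝ) : ℂ) *
        ∫ ξ, (starRingEnd ℂ) (h₁ ξ) * h₂ ξ * (Real.exp (-(2 * ξ * baseIm w)) : ℂ)) =
        ((2 * Real.pi : ℝ) : ℂ) * ∫ ξ, (monoPair n m w * s w) *
          ((starRingEnd ℂ) (h₁ ξ) * h₂ ξ * (Real.exp (-(2 * ξ * baseIm w)) : ℂ)) := by
      intro w
      rw [integral_const_mul]
      ring
    simp only [e1, integral_const_mul (((2 * Real.pi : ℝ) : ℂ))]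
    congr 1
    have hh : Integrable fun ξ => (starRingEnd ℂ) (h₁ ξ) * h₂ ξ :=
      (memLp_conj hh₁.memLp).integrable_mul hh₂.memLp
    -- On the band of h₁ one has ξ ≥ ε, so e^{-2ξ Im z_p} ≤ e^{-2ε Im z_p} and the integrand is
    -- dominated by a function of (z', v) times a function of ξ.
    have hInt : Integrable (Function.uncurry fun (w : SiegelBase p) (ξ : ℝ) =>
        monoPair n m w * s w * ((starRingEnd ℂ) (h₁ ξ) * h₂ ξ *
          (Real.exp (-(2 * ξ * baseIm w)) : ℂ))) ((baseMeasure p).prod volume) := by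
      refine (hbase.mul_prod hh.norm).mono' ?_ ?_
      · refine (((measurable_monoPair n m).mul hs.measurable).comp
          measurable_fst).aestronglyMeasurable.mul ((hh.1.comp_snd).mul ?_)
        have := measurable_baseIm (p := p)
        exact (by fun_prop : Measurable fun u : SiegelBase p × ℝ =>
          (Real.exp (-(2 * u.2 * baseIm u.1)) : ℂ)).aestronglyMeasurable
      · have h1 : ∀ᵐ u ∂((baseMeasure p).prod (volume : Measure ℝ)), 0 < u.1.2 :=
          Measure.quasiMeasurePreserving_fst.ae (ae_baseMeasure fun w hw => hw)
        filter_upwards [h1] with u hu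
        obtain ⟨w, ξ⟩ := u
        have hy := baseIm_nonneg hu
        simp only [Function.uncurry, norm_mul (monoPair n m w * s w), norm_mul (monoPair n m w),
          norm_monoPair, norm_mul _ (Real.exp (-(2 * ξ * baseIm w)) : ℂ), Complex.norm_real,
          Real.norm_of_nonneg (Real.exp_pos _).le]
        by_cases hξ : ξ ∈ Icc ε₁ ε₁⁻¹
        · have hle : Real.exp (-(2 * ξ * baseIm w)) ≤ Real.exp (-(2 * ε) * baseIm w) := by
            refine Real.exp_le_exp.2 ?_
            have := mul_le_mul_of_nonneg_right ((min_le_left ε₁ ε₂).trans hξ.1) hy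
            linarith
          calc _ ≤ (∏ k, ‖w.1 k‖ ^ (n + m) k) * ‖s w‖ * (‖(starRingEnd ℂ) (h₁ ξ) * h₂ ξ‖ *
                Real.exp (-(2 * ε) * baseIm w)) := by gcongr
            _ = _ := by ring
        · rw [hh₁.supp ξ hξ]
          simp
    simp only [← integral_const_mul]
    rw [integral_integral_swap hInt]
    congr 1
    ext ξ
    congr 1
    ext w
    ring

/-- Invariance under rotations of the coordinates `z_k`. -/
def IsRotationInvariant (s : SiegelBase p → ℂ) : Prop :=
  ∀ (t : Fin (p - 1) → Circle) (w : SiegelBase p), 0 < w.2 → s (fun k => (t k : ℂ) * w.1 k, w.2) = s w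

theorem measurePreserving_circle_mul (t : Fin (p - 1) → Circle) :
    MeasurePreserving (fun w : SiegelBase p => ((fun k => (t k : ℂ) * w.1 k, w.2) : SiegelBase p))
      (baseMeasure p) (baseMeasure p) := by
  have h1 : ∀ c : Circle, MeasurePreserving (fun z : ℂ => (c : ℂ) * z) := fun c =>
    (rotation c).measurePreserving
  have h2 : MeasurePreserving (fun z : Fin (p - 1) → ℂ => fun k => (t k : ℂ) * z k) :=
    measurePreserving_pi (fun _ => volume) (fun _ => volume) (f := fun k z => (t k : ℂ) * z)
      fun k => h1 (t k)
  have h3 : MeasurePreserving (fun w : SiegelBase p => ((fun k => (t k : ℂ) * w.1 k, w.2) : SiegelBase p)) :=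
    h2.prod (MeasurePreserving.id volume)
  exact h3.restrict_preimage (measurableSet_base p)

theorem baseIm_circle_mul (t : Fin (p - 1) → Circle) (w : SiegelBase p) :
    baseIm ((fun k => (t k : ℂ) * w.1 k, w.2) : SiegelBase p) = baseIm w := by
  simp only [baseIm, norm_mul, Circle.norm_coe, one_mul]

/-- Rotating a coordinate with n_j ≠ m_j by a suitable angle negates the monomial and preserves
everything else, so the integral equals its negative. -/
theorem integral_monoPair_of_ne {n m : Fin (p - 1) → ℕ} (hnm : n ≠ m) {s : SiegelBase p → ℂ}
    (hs : IsTame s) (hinv : IsRotationInvariant s) (ξ : ℝ) :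
    ∫ w, monoPair n m w * s w * (Real.exp (-(2 * ξ * baseIm w)) : ℂ) ∂(baseMeasure p) = 0 := by
  obtain ⟨j, hj⟩ := Function.ne_iff.1 hnm
  have hj' : (m j : ℝ) - n j ≠ 0 := sub_ne_zero.2 fun h => hj (by exact_mod_cast h.symm)
  -- Chosen so that conj(e^{iθn_j}) e^{iθm_j} = e^{iπ} = -1.
  set θ : ℝ := Real.pi / (m j - n j)
  set t : Fin (p - 1) → Circle := Function.update (fun _ => 1) j (Circle.exp θ) with ht
  have hmono : ∀ w : SiegelBase p, monoPair n m (fun k => (t k : ℂ) * w.1 k, w.2) = -monoPair n m w := by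
    intro w
    have e : ∀ N : Fin (p - 1) → ℕ, ∏ k, ((t k : ℂ) * w.1 k) ^ N k =
        Complex.exp (θ * Complex.I * N j) * ∏ k, w.1 k ^ N k := by
      intro N
      simp only [mul_pow, Finset.prod_mul_distrib]
      rw [Finset.prod_eq_single j]
      · rw [ht, Function.update_self, Circle.coe_exp, ← Complex.exp_nat_mul]
        ring_nf
      · intro k _ hk
        simp [ht, Function.update_of_ne hk]
      · simp
    have e2 : (starRingEnd ℂ) (Complex.exp (θ * Complex.I * n j)) *
        Complex.exp (θ * Complex.I * m j) = -1 := by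
      rw [← Complex.exp_conj, ← Complex.exp_add, ← Complex.exp_pi_mul_I]
      congr 1
      have : (Real.pi : ℂ) = θ * (m j - n j) := by
        have : Real.pi = θ * (m j - n j) := (div_mul_cancel₀ _ hj').symm
        exact_mod_cast this
      rw [this]
      simp
      ring
    simp only [monoPair, e, map_mul]
    linear_combination ((starRingEnd ℂ) (∏ k, w.1 k ^ n k) * ∏ k, w.1 k ^ m k) * e2
  have hcomp : ∫ w, monoPair n m w * s w * (Real.exp (-(2 * ξ * baseIm w)) : ℂ) ∂(baseMeasure p) =
      ∫ w : SiegelBase p, -(monoPair n m w * s w * (Real.exp (-(2 * ξ * baseIm w)) : ℂ))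
        ∂(baseMeasure p) := by
    have h := measurePreserving_circle_mul (p := p) t
    conv_lhs => rw [← h.map_eq]
    rw [integral_map h.measurable.aemeasurable]
    · refine integral_congr_ae (ae_baseMeasure fun w hw => ?_)
      simp only [hmono, hinv t w hw, baseIm_circle_mul]
      ring
    · have := measurable_monoPair n m
      have := hs.measurable
      have := measurable_baseIm (p := p)
      exact (by fun_prop : Measurable _).aestronglyMeasurable
  rw [integral_neg] at hcomp
  exact self_eq_neg.1 hcomp

/-- The integral `∫_{ℝ_+^p} s(√r, v) r^n e^{-2ξ(v + r̂)} dr dv`. -/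
def orthantIntegral (s : SiegelBase p → ℂ) (n : Fin (p - 1) → ℕ) (ξ : ℝ) : ℂ :=
  ∫ x in posOrthant p, s (fun k => (Real.sqrt (x.1 k) : ℂ), x.2) *
    (((∏ k, x.1 k ^ n k) * Real.exp (-2 * ξ * (x.2 + ∑ k, x.1 k)) : ℝ) : ℂ)

theorem exists_circle_mul_eq_norm (z : ℂ) : ∃ t : Circle, (t : ℂ) * z = ‖z‖ := by
  refine ⟨Circle.exp (-z.arg), ?_⟩
  conv_lhs => rw [← Complex.norm_mul_exp_arg_mul_I z]
  rw [Circle.coe_exp, mul_left_comm, ← Complex.exp_add]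
  simp

theorem measurable_orthantIntegrand {s : SiegelBase p → ℂ} (hs : Measurable s)
    (n : Fin (p - 1) → ℕ) : Measurable fun u : ℝ × ((Fin (p - 1) → ℝ) × ℝ) =>
      s (fun k => (Real.sqrt (u.2.1 k) : ℂ), u.2.2) *
        (((∏ k, u.2.1 k ^ n k) * Real.exp (-2 * u.1 * (u.2.2 + ∑ k, u.2.1 k)) : ℝ) : ℂ) := by
  have h2 : Measurable fun u : ℝ × ((Fin (p - 1) → ℝ) × ℝ) =>
      ((fun k => (Real.sqrt (u.2.1 k) : ℂ), u.2.2) : SiegelBase p) := by fun_prop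
  exact (hs.comp h2).mul (by fun_prop)

/-- Invariance lets s be evaluated at (|z_1|, …, |z_{p-1}|), and then r_k = |z_k|² is a substitution
with constant Jacobian. -/
theorem integral_monoPair_self (n : Fin (p - 1) → ℕ) {s : SiegelBase p → ℂ}
    (hs : Measurable s) (hinv : IsRotationInvariant s) (ξ : ℝ) :
    ∫ w, monoPair n n w * s w * (Real.exp (-(2 * ξ * baseIm w)) : ℂ) ∂(baseMeasure p) =
      (Real.pi ^ (p - 1) : ℝ) * orthantIntegral s n ξ := by
  have hm := (measurable_orthantIntegrand hs n).comp (measurable_const (a := ξ) |>.prodMk measurable_id)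
  refine Eq.trans ?_ (integral_comp_normSqMap hm.aestronglyMeasurable)
  refine integral_congr_ae (ae_baseMeasure fun w hw => ?_)
  choose t ht using fun k => exists_circle_mul_eq_norm (w.1 k)
  have e1 : s (fun k => (Real.sqrt ((normSqMap p w).1 k) : ℂ), (normSqMap p w).2) = s w := by
    rw [← hinv t w hw]
    simp only [normSqMap, Real.sqrt_sq (norm_nonneg _), ht]
  have e2 : monoPair n n w = ((∏ k, (normSqMap p w).1 k ^ n k : ℝ) : ℂ) := by
    rw [monoPair, mul_comm, Complex.mul_conj, Complex.normSq_eq_norm_sq, norm_prod,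
      ← Finset.prod_pow]
    simp only [normSqMap, norm_pow]
    congr 2
    ext k
    ring
  simp only [e1, e2]
  have e3 : -2 * ξ * ((normSqMap p w).2 + ∑ k, (normSqMap p w).1 k) = -(2 * ξ * baseIm w) := by
    simp only [normSqMap, baseIm]
    ring
  rw [e3]
  push_cast
  ring

/-- The multiplier of the Toeplitz form with symbol `s` relative to the transform `T_l`. -/
def specGamma (l : ℝ) (s : SiegelBase p → ℂ) (n : Fin (p - 1) → ℕ) (ξ : ℝ) : ℂ :=
  ((2 * Real.pi * Real.pi ^ (p - 1) * bargmannFactor p l n ξ ^ 2 : ℝ) : ℂ) * orthantIntegral s n ξ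

/-- Different monomials are orthogonal. On the diagonal the constants of `specGamma` collect 2π from
Plancherel, π^(p-1) from the substitution r_k = |z_k|², and k_n(ξ)² from the two transforms. -/
theorem core_single {l : ℝ} (hl : 0 < l) {s : SiegelBase p → ℂ} (hs : IsTame s)
    (hinv : IsRotationInvariant s) {σ : CSpace p → ℂ}
    (hσ : ∀ (w : SiegelBase p) (x : ℝ), 0 < w.2 → σ (siegelCoord p (w, x)) = s w)
    (n m : Fin (p - 1) → ℕ) {a b : HalfLineL2} (ha : IsNice a) (hb : IsNice b) :
    IntegrableOn (fun z => (starRingEnd ℂ) (compAdj l (lp.single 2 n a) z) *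
      compAdj l (lp.single 2 m b) z * σ z) (siegelDomain p) ∧
    ∫ z in siegelDomain p, (starRingEnd ℂ) (compAdj l (lp.single 2 n a) z) *
      compAdj l (lp.single 2 m b) z * σ z =
      if n = m then ∫ ξ in Ioi (0 : ℝ), (starRingEnd ℂ) ((a : ℝ → ℂ) ξ) * (b : ℝ → ℂ) ξ *
        specGamma l s n ξ else 0 := by
  obtain ⟨ε₁, hε₁, ha⟩ := ha
  obtain ⟨ε₂, hε₂, hb⟩ := hb
  obtain ⟨h1, h2⟩ := core_band (isBand_bandFun (l := l) hε₁ n a) (isBand_bandFun (l := l) hε₂ m b)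
    n m hs hσ
  have e : EqOn (fun z => (starRingEnd ℂ) (compAdj l (lp.single 2 n a) z) *
      compAdj l (lp.single 2 m b) z * σ z) (fun z : CSpace p => (starRingEnd ℂ)
      ((∏ k, z.1 k ^ n k) * bandIntegral (bandFun p l ε₁ n a) z.2) *
      ((∏ k, z.1 k ^ m k) * bandIntegral (bandFun p l ε₂ m b) z.2) * σ z) (siegelDomain p) := by
    intro z hz
    simp only [compAdj_single hl hε₁ n ha hz, compAdj_single hl hε₂ m hb hz]
  refine ⟨h1.congr_fun e.symm (measurableSet_siegelDomain p), ?_⟩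
  rw [setIntegral_congr_fun (measurableSet_siegelDomain p) e, h2]
  split_ifs with hnm
  · subst hnm
    simp only [integral_monoPair_self n hs.measurable hinv]
    rw [← setIntegral_eq_integral_of_forall_compl_eq_zero (s := Ioi (0 : ℝ)), ← integral_const_mul]
    · refine integral_congr_ae ?_
      filter_upwards [ha, hb] with ξ h1 h2
      have e1 : (starRingEnd ℂ) (bandFun p l ε₁ n a ξ) * bandFun p l ε₂ n b ξ =
          (bargmannFactor p l n ξ : ℂ) ^ 2 * ((starRingEnd ℂ) ((a : ℝ → ℂ) ξ) * (b : ℝ → ℂ) ξ) := by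
        by_cases m1 : ξ ∈ Icc ε₁ ε₁⁻¹
        · by_cases m2 : ξ ∈ Icc ε₂ ε₂⁻¹
          · rw [bandFun, bandFun, indicator_of_mem m1, indicator_of_mem m2, map_mul,
              Complex.conj_ofReal]
            ring
          · rw [bandFun, bandFun, indicator_of_notMem m2, h2 m2]
            simp
        · rw [bandFun, indicator_of_notMem m1, h1 m1]
          simp
      rw [e1, specGamma]
      push_cast
      ring
    · intro ξ hξ
      rw [bandFun, indicator_of_notMem (fun h => hξ (Icc_inv_subset_Ioi hε₁ h))]
      simp
  · simp only [integral_monoPair_of_ne hnm hs hinv]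
    simp

end Symbols

/-! ### The weighted measure and its multiplier. -/

section Isometry

variable {p : ℕ} {l : ℝ}

/-- The normalizing constant of the weighted measure with parameter `l`. -/
def weightConst (p : ℕ) (l : ℝ) : ℝ :=
  Real.Gamma l / (4 * Real.pi ^ p * Real.Gamma (l - p))

/-- The density of the weighted measure with parameter `l`. -/
def weight (p : ℕ) (l : ℝ) (z : CSpace p) : ℝ := weightConst p l * siegelHeight z ^ (l - p - 1)

theorem weightConst_pos (hl : (p : ℝ) < l) : 0 < weightConst p l := by
  have h1 : 0 < l := (Nat.cast_nonneg p).trans_lt hl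
  have := Real.Gamma_pos_of_pos h1
  have := Real.Gamma_pos_of_pos (sub_pos.2 hl)
  unfold weightConst
  positivity

theorem weight_pos (hl : (p : ℝ) < l) {z : CSpace p} (hz : z ∈ siegelDomain p) :
    0 < weight p l z :=
  mul_pos (weightConst_pos hl) (Real.rpow_pos_of_pos hz _)

theorem measurable_weight : Measurable (weight p l) :=
  (measurable_siegelHeight.pow_const _).const_mul _

/-- The weighted measure on the Siegel domain with parameter `l`. -/
def compMeasure (p : ℕ) (l : ℝ) : Measure (CSpace p) :=
  (volume.restrict (siegelDomain p)).withDensity fun z => (weight p l z).toNNReal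

theorem integrable_compMeasure_iff (hl : (p : ℝ) < l) {f : CSpace p → ℂ} :
    Integrable f (compMeasure p l) ↔ IntegrableOn (fun z => f z * (weight p l z : ℂ)) (siegelDomain p) := by
  rw [compMeasure, integrable_withDensity_iff_integrable_smul measurable_weight.real_toNNReal]
  refine integrableOn_congr_fun (fun z hz => ?_) (measurableSet_siegelDomain p)
  change ((weight p l z).toNNReal : ℝ) • f z = _
  rw [Real.coe_toNNReal _ (weight_pos hl hz).le, Complex.real_smul, mul_comm]

theorem integral_compMeasure (hl : (p : ℝ) < l) (f : CSpace p → ℂ) :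
    ∫ z, f z ∂(compMeasure p l) = ∫ z in siegelDomain p, f z * (weight p l z : ℂ) := by
  rw [compMeasure, integral_withDensity_eq_integral_smul measurable_weight.real_toNNReal]
  refine setIntegral_congr_fun (measurableSet_siegelDomain p) (fun z hz => ?_)
  change ((weight p l z).toNNReal : ℝ) • f z = _
  rw [Real.coe_toNNReal _ (weight_pos hl hz).le, Complex.real_smul, mul_comm]

/-- The weight as a function of `(z', v)`. -/
def weightSymbol (p : ℕ) (l : ℝ) (w : SiegelBase p) : ℂ :=
  ((weightConst p l * w.2 ^ (l - p - 1) : ℝ) : ℂ)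

theorem isTame_weightSymbol (hl : (p : ℝ) < l) : IsTame (weightSymbol p l) := by
  refine ⟨by unfold weightSymbol; fun_prop, weightConst p l, l - p - 1, l - p - 1, by linarith,
    by linarith, fun w hw => ?_⟩
  have := weightConst_pos hl
  rw [weightSymbol, Complex.norm_real, Real.norm_of_nonneg (by positivity)]
  have : 0 < w.2 ^ (l - p - 1) := Real.rpow_pos_of_pos hw _
  nlinarith

theorem weight_siegelCoord (w : SiegelBase p) (x : ℝ) :
    (weight p l (siegelCoord p (w, x)) : ℂ) = weightSymbol p l w := by
  rw [weight, siegelHeight_siegelCoord, weightSymbol]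

/-- The r_k-integrals give n_k!/(2ξ)^(n_k+1) and the v-integral gives Γ(l-p)/(2ξ)^(l-p). Against
k_n(ξ)² all powers of 2ξ cancel, and 2·2π·π^(p-1) = 4π^p is the constant in the weight. This is the
reason for the normalisation of k_n. -/
theorem specGamma_weightSymbol (hp : 1 ≤ p) (hl : (p : ℝ) < l) (n : Fin (p - 1) → ℕ) {ξ : ℝ}
    (hξ : 0 < ξ) : specGamma l (weightSymbol p l) n ξ = 1 := by
  have hl0 : 0 < l := (Nat.cast_nonneg p).trans_lt hl
  have h1 : orthantIntegral (weightSymbol p l) n ξ = ((weightConst p l *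
      ∫ x in posOrthant p, orthantGamma p (fun k => (n k : ℝ)) (l - p - 1) (2 * ξ) x : ℝ) : ℂ) := by
    rw [orthantIntegral, ← integral_const_mul, ← integral_complex_ofReal]
    congr 1
    ext x
    simp only [weightSymbol, orthantGamma, Real.rpow_natCast]
    push_cast
    ring_nf
  rw [specGamma, h1, integral_orthantGamma (fun k => by
    have : (0 : ℝ) ≤ n k := Nat.cast_nonneg _
    linarith) (by linarith) (by positivity), ← Complex.ofReal_mul, ← Complex.ofReal_one,
    bargmannFactor_sq hl0 n hξ, weightConst]
  congr 1
  have hG := (Real.Gamma_pos_of_pos hl0).ne'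
  have hG' := (Real.Gamma_pos_of_pos (sub_pos.2 hl)).ne'
  have e1 : (∏ k, ((2 * ξ) ^ n k / ((n k).factorial : ℝ))) *
      ∏ k, ((1 / (2 * ξ)) ^ ((n k : ℝ) + 1) * Real.Gamma ((n k : ℝ) + 1)) = (1 / (2 * ξ)) ^ (p - 1) := by
    rw [← Finset.prod_mul_distrib, Finset.prod_eq_pow_card (b := 1 / (2 * ξ)), Finset.card_univ,
      Fintype.card_fin]
    intro k _
    have : ((n k).factorial : ℝ) ≠ 0 := Nat.cast_ne_zero.2 (Nat.factorial_ne_zero _)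
    have h2 : (1 / (2 * ξ)) ^ ((n k : ℝ) + 1) = (1 / (2 * ξ)) ^ (n k) * (1 / (2 * ξ)) := by
      rw [Real.rpow_add_one (by positivity), Real.rpow_natCast]
    rw [Real.Gamma_nat_eq_factorial, h2, one_div, inv_pow]
    field_simp
  have e2 : (2 * ξ) ^ (l - 1) * ((1 / (2 * ξ)) ^ (p - 1) * (1 / (2 * ξ)) ^ (l - p - 1 + 1)) = 1 := by
    rw [← Real.rpow_natCast, ← Real.rpow_add (by positivity), one_div, Real.inv_rpow (by positivity),
      Nat.cast_sub hp]
    have : ((p : ℝ) - (1 : ℕ)) + (l - p - 1 + 1) = l - 1 := by push_cast; ring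
    rw [this]
    exact mul_inv_cancel₀ (by positivity)
  have e3 : Real.pi * Real.pi ^ (p - 1) = Real.pi ^ p := by
    rw [← pow_succ', Nat.sub_add_cancel hp]
  have e4 : l - p - 1 + 1 = l - p := by ring
  rw [e4] at e2 ⊢
  calc _ = (Real.pi * Real.pi ^ (p - 1)) / Real.pi ^ p * (Real.Gamma l / Real.Gamma l) *
        (Real.Gamma (l - p) / Real.Gamma (l - p)) * ((2 * ξ) ^ (l - 1) *
        (((∏ k, ((2 * ξ) ^ n k / ((n k).factorial : ℝ))) *
        ∏ k, ((1 / (2 * ξ)) ^ ((n k : ℝ) + 1) * Real.Gamma ((n k : ℝ) + 1))) *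
        (1 / (2 * ξ)) ^ (l - p))) := by
        field_simp
        ring
    _ = 1 := by
        rw [e1, e2, e3, div_self hG, div_self hG', div_self (by positivity)]
        ring

end Isometry

/-! ### Isometry of a component of R^*. -/

section Isometry

variable {p : ℕ} {l : ℝ}

/-- The form `∫ conj(T a) T b dμ` converges absolutely and equals `⟨a, b⟩`. -/
def IsPaired (l : ℝ) (a b : CompSpace p) : Prop :=
  IntegrableOn (fun z => (starRingEnd ℂ) (compAdj l a z) * compAdj l b z * (weight p l z : ℂ))
    (siegelDomain p) ∧
  ∫ z in siegelDomain p, (starRingEnd ℂ) (compAdj l a z) * compAdj l b z * (weight p l z : ℂ) =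
    inner ℂ a b

theorem IsPaired.add_right (hl : 0 < l) {a b c : CompSpace p} (h1 : IsPaired l a b)
    (h2 : IsPaired l a c) : IsPaired l a (b + c) := by
  have e : (fun z => (starRingEnd ℂ) (compAdj l a z) * compAdj l (b + c) z * (weight p l z : ℂ)) =
      fun z => (starRingEnd ℂ) (compAdj l a z) * compAdj l b z * (weight p l z : ℂ) +
        (starRingEnd ℂ) (compAdj l a z) * compAdj l c z * (weight p l z : ℂ) := by
    ext z
    rw [compAdj_add hl, Pi.add_apply]
    ring
  rw [IsPaired, e]
  exact ⟨h1.1.add h2.1, by rw [integral_add h1.1 h2.1, h1.2, h2.2, inner_add_right]⟩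

theorem IsPaired.add_left (hl : 0 < l) {a b c : CompSpace p} (h1 : IsPaired l a c)
    (h2 : IsPaired l b c) : IsPaired l (a + b) c := by
  have e : (fun z => (starRingEnd ℂ) (compAdj l (a + b) z) * compAdj l c z * (weight p l z : ℂ)) =
      fun z => (starRingEnd ℂ) (compAdj l a z) * compAdj l c z * (weight p l z : ℂ) +
        (starRingEnd ℂ) (compAdj l b z) * compAdj l c z * (weight p l z : ℂ) := by
    ext z
    rw [compAdj_add hl, Pi.add_apply, map_add]
    ring
  rw [IsPaired, e]
  exact ⟨h1.1.add h2.1, by rw [integral_add h1.1 h2.1, h1.2, h2.2, inner_add_left]⟩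

theorem pos_of_natCast_lt (hl : (p : ℝ) < l) : 0 < l := (Nat.cast_nonneg p).trans_lt hl

theorem inner_single_single (n m : Fin (p - 1) → ℕ) (a b : HalfLineL2) :
    inner ℂ (lp.single 2 n a : CompSpace p) (lp.single 2 m b) =
      if n = m then ∫ ξ in Ioi (0 : ℝ), (starRingEnd ℂ) ((a : ℝ → ℂ) ξ) * (b : ℝ → ℂ) ξ else 0 := by
  rw [lp.inner_single_left]
  split_ifs with h
  · subst h
    rw [lp.single_apply_self, L2.inner_def]
    simp only [RCLike.inner_apply, mul_comm]
  · rw [lp.single_apply_ne _ _ _ h, inner_zero_right]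

theorem isPaired_single (hp : 1 ≤ p) (hl : (p : ℝ) < l) (n m : Fin (p - 1) → ℕ) {a b : HalfLineL2}
    (ha : IsNice a) (hb : IsNice b) : IsPaired l (lp.single 2 n a : CompSpace p) (lp.single 2 m b) := by
  have h := core_single (pos_of_natCast_lt hl) (isTame_weightSymbol hl) (fun _ _ _ => rfl)
    (σ := fun z => (weight p l z : ℂ)) (fun w x _ => weight_siegelCoord w x) n m ha hb
  refine ⟨h.1, ?_⟩
  rw [h.2, inner_single_single]
  split_ifs with hnm
  · refine setIntegral_congr_fun measurableSet_Ioi fun ξ hξ => ?_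
    simp only [specGamma_weightSymbol hp hl n hξ, mul_one]
  · rfl

/-- Finite sums of nice vectors. -/
def niceSums (p : ℕ) : AddSubmonoid (CompSpace p) :=
  AddSubmonoid.closure {b | ∃ (n : Fin (p - 1) → ℕ) (f : HalfLineL2), IsNice f ∧ b = lp.single 2 n f}

theorem dense_niceSums (p : ℕ) : Dense (niceSums p : Set (CompSpace p)) := by
  intro b
  change b ∈ (niceSums p).topologicalClosure
  refine compSpace_induction (C := (niceSums p).topologicalClosure)
    (niceSums p).isClosed_topologicalClosure (fun a ha b hb => add_mem ha hb) (fun n f hf => ?_) b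
  exact subset_closure (AddSubmonoid.subset_closure ⟨n, f, hf, rfl⟩)

theorem isNice_zero : IsNice 0 :=
  ⟨1, one_pos, by filter_upwards [Lp.coeFn_zero ℂ 2 (volume.restrict (Ioi (0 : ℝ)))] with ξ h _; rw [h]; rfl⟩

theorem isPaired_niceSums (hp : 1 ≤ p) (hl : (p : ℝ) < l) {a b : CompSpace p}
    (ha : a ∈ niceSums p) (hb : b ∈ niceSums p) : IsPaired l a b := by
  have hl0 := pos_of_natCast_lt hl
  -- Zero is itself a vector with one band-limited coordinate, so the zero case of each induction is
  -- an instance of the single case.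
  have h0 : (0 : CompSpace p) = lp.single 2 (0 : Fin (p - 1) → ℕ) (0 : HalfLineL2) :=
    (lp.single_zero _ _).symm
  have step : ∀ n (f : HalfLineL2), IsNice f → ∀ b ∈ niceSums p, IsPaired l (lp.single 2 n f) b := by
    intro n f hf b hb
    induction hb using AddSubmonoid.closure_induction with
    | mem x hx =>
      obtain ⟨m, g, hg, rfl⟩ := hx
      exact isPaired_single hp hl n m hf hg
    | zero => rw [h0]; exact isPaired_single hp hl _ _ hf isNice_zero
    | add x y _ _ hx hy => exact hx.add_right hl0 hy
  induction ha using AddSubmonoid.closure_induction with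
  | mem x hx =>
    obtain ⟨n, f, hf, rfl⟩ := hx
    exact step n f hf b hb
  | zero => rw [h0]; exact step _ _ isNice_zero b hb
  | add x y _ _ hx hy => exact hx.add_left hl0 hy

open Classical in
theorem measurable_compAdj (hl : 0 < l) (b : CompSpace p) : Measurable (compAdj l b) := by
  have h := (differentiableOn_compAdj hl b).continuousOn
  have h2 : compAdj l b = (siegelDomain p).indicator (compAdj l b) := by
    ext z
    by_cases hz : z ∈ siegelDomain p
    · rw [indicator_of_mem hz]
    · rw [indicator_of_notMem hz, compAdj_of_notMem _ hz]
  rw [h2]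
  have := h.measurable_piecewise (g := 0) continuousOn_const (measurableSet_siegelDomain p)
  rwa [piecewise_eq_indicator] at this

theorem lintegral_enorm_sq_of_isPaired (hl : (p : ℝ) < l) {b : CompSpace p} (h : IsPaired l b b) :
    ∫⁻ z, ‖compAdj l b z‖ₑ ^ 2 ∂(compMeasure p l) = ENNReal.ofReal (‖b‖ ^ 2) := by
  have e1 : ∀ z, (starRingEnd ℂ) (compAdj l b z) * compAdj l b z =
      ((‖compAdj l b z‖ ^ 2 : ℝ) : ℂ) := by
    intro z
    rw [mul_comm, Complex.mul_conj, Complex.normSq_eq_norm_sq]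
  obtain ⟨h1, h2⟩ := h
  rw [← integrable_compMeasure_iff hl] at h1
  rw [← integral_compMeasure hl, inner_self_eq_norm_sq_to_K] at h2
  simp only [e1] at h1 h2
  rw [integral_complex_ofReal] at h2
  have h3 : Integrable (fun z => ‖compAdj l b z‖ ^ 2) (compMeasure p l) := by
    simpa only [RCLike.re_to_complex, Complex.ofReal_re] using h1.re
  have h2' : ∫ z, ‖compAdj l b z‖ ^ 2 ∂(compMeasure p l) = ‖b‖ ^ 2 :=
    Complex.ofReal_injective (by simpa using h2)
  rw [← h2', ofReal_integral_eq_lintegral_ofReal h3 (ae_of_all _ fun z => by positivity)]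
  refine lintegral_congr fun z => ?_
  rw [ENNReal.ofReal_pow (norm_nonneg _), ofReal_norm]

theorem tendsto_compAdj (hl : 0 < l) {u : ℕ → CompSpace p} {b : CompSpace p}
    (hu : Tendsto u atTop (𝓝 b)) (z : CSpace p) :
    Tendsto (fun j => compAdj l (u j) z) atTop (𝓝 (compAdj l b z)) := by
  by_cases hz : z ∈ siegelDomain p
  · simp only [compAdj_eq_inner hl hz]
    exact (Continuous.tendsto (by fun_prop) b).comp hu
  · simp only [compAdj_of_notMem _ hz]
    exact tendsto_const_nhds

/-- Fatou's lemma along nice sums converging to b: their transforms converge pointwise, and their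
norms are already known. -/
theorem lintegral_enorm_sq_compAdj_le (hp : 1 ≤ p) (hl : (p : ℝ) < l) (b : CompSpace p) :
    ∫⁻ z, ‖compAdj l b z‖ₑ ^ 2 ∂(compMeasure p l) ≤ ENNReal.ofReal (‖b‖ ^ 2) := by
  have hl0 := pos_of_natCast_lt hl
  obtain ⟨u, hu, hub⟩ := mem_closure_iff_seq_limit.1 (dense_niceSums p b)
  have h1 : ∀ z, ‖compAdj l b z‖ₑ ^ 2 = liminf (fun j => ‖compAdj l (u j) z‖ₑ ^ 2) atTop := by
    intro z
    refine (Tendsto.liminf_eq ?_).symm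
    exact ((ENNReal.continuous_pow 2).tendsto _).comp
      ((continuous_enorm.tendsto _).comp (tendsto_compAdj hl0 hub z))
  simp only [h1]
  refine (lintegral_liminf_le fun j => ((measurable_compAdj hl0 (u j)).enorm.pow_const 2)).trans ?_
  simp only [fun j => lintegral_enorm_sq_of_isPaired hl (isPaired_niceSums hp hl (hu j) (hu j))]
  refine le_of_eq (Tendsto.liminf_eq ?_)
  exact (ENNReal.continuous_ofReal.tendsto _).comp (((continuous_norm.tendsto _).comp hub).pow 2)

theorem eLpNorm_two_sq {α : Type*} [MeasurableSpace α] {μ : Measure α} (f : α → ℂ) :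
    eLpNorm f 2 μ ^ 2 = ∫⁻ x, ‖f x‖ₑ ^ 2 ∂μ := by
  have := eLpNorm_nnreal_pow_eq_lintegral (μ := μ) (f := f) (p := 2) two_ne_zero
  simpa using this

theorem memLp_compAdj (hp : 1 ≤ p) (hl : (p : ℝ) < l) (b : CompSpace p) :
    MemLp (compAdj l b) 2 (compMeasure p l) := by
  refine ⟨(measurable_compAdj (pos_of_natCast_lt hl) b).aestronglyMeasurable, ?_⟩
  have h := (lintegral_enorm_sq_compAdj_le hp hl b).trans_lt ENNReal.ofReal_lt_top
  rw [← eLpNorm_two_sq] at h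
  exact (ENNReal.pow_lt_top_iff.1 h).resolve_right two_ne_zero

theorem norm_toLp_sq_eq {α : Type*} [MeasurableSpace α] {μ : Measure α} {f : α → ℂ}
    (hf : MemLp f 2 μ) : ENNReal.ofReal (‖hf.toLp f‖ ^ 2) = ∫⁻ x, ‖f x‖ₑ ^ 2 ∂μ := by
  rw [Lp.norm_toLp, ← eLpNorm_two_sq, ENNReal.ofReal_pow ENNReal.toReal_nonneg,
    ENNReal.ofReal_toReal hf.2.ne]

/-- The component of the adjoint super Bargmann transform as a map to `L_2`. -/
def compLin (hp : 1 ≤ p) (hl : (p : ℝ) < l) : CompSpace p →L[ℂ] Lp ℂ 2 (compMeasure p l) :=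
  LinearMap.mkContinuous
    { toFun := fun b => (memLp_compAdj hp hl b).toLp _
      map_add' := fun a b => by
        rw [← MemLp.toLp_add]
        exact MemLp.toLp_congr _ _ (ae_of_all _ fun z => by
          rw [compAdj_add (pos_of_natCast_lt hl)])
      map_smul' := fun c b => by
        rw [RingHom.id_apply, ← MemLp.toLp_const_smul]
        exact MemLp.toLp_congr _ _ (ae_of_all _ fun z => by
          rw [compAdj_smul (pos_of_natCast_lt hl)]) } 1 fun b => by
    rw [one_mul]
    have h := norm_toLp_sq_eq (memLp_compAdj hp hl b)
    have h2 := (lintegral_enorm_sq_compAdj_le hp hl b)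
    rw [← h, ENNReal.ofReal_le_ofReal_iff (by positivity)] at h2
    exact le_of_sq_le_sq h2 (norm_nonneg _)

/-- Fatou gave a contraction, hence a continuous map; equality of norms is a closed condition that
holds on the dense set of nice sums. -/
theorem norm_compLin (hp : 1 ≤ p) (hl : (p : ℝ) < l) (b : CompSpace p) :
    ‖compLin hp hl b‖ = ‖b‖ := by
  have hc : IsClosed {b : CompSpace p | ‖compLin hp hl b‖ = ‖b‖} :=
    isClosed_eq (by fun_prop) continuous_norm
  refine hc.closure_subset_iff.2 (fun b hb => ?_) (dense_niceSums p b)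
  have h := norm_toLp_sq_eq (memLp_compAdj hp hl b)
  rw [lintegral_enorm_sq_of_isPaired hl (isPaired_niceSums hp hl hb hb)] at h
  have h2 := (ENNReal.ofReal_eq_ofReal_iff (by positivity) (by positivity)).1 h
  exact (sq_eq_sq₀ (norm_nonneg _) (norm_nonneg _)).1 h2

/-- The component of the adjoint super Bargmann transform as an isometry to `L_2`. -/
def compIso (hp : 1 ≤ p) (hl : (p : ℝ) < l) : CompSpace p →ₗᵢ[ℂ] Lp ℂ 2 (compMeasure p l) :=
  ⟨(compLin hp hl).toLinearMap, norm_compLin hp hl⟩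

theorem compIso_apply (hp : 1 ≤ p) (hl : (p : ℝ) < l) (b : CompSpace p) :
    compIso hp hl b = (memLp_compAdj hp hl b).toLp _ := rfl

theorem inner_toLp_toLp {α : Type*} [MeasurableSpace α] {μ : Measure α} {f g : α → ℂ}
    (hf : MemLp f 2 μ) (hg : MemLp g 2 μ) :
    inner ℂ (hf.toLp f) (hg.toLp g) = ∫ x, (starRingEnd ℂ) (f x) * g x ∂μ := by
  rw [L2.inner_def]
  refine integral_congr_ae ?_
  filter_upwards [hf.coeFn_toLp, hg.coeFn_toLp] with x h1 h2
  rw [h1, h2, RCLike.inner_apply, mul_comm]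

/-- Polarisation: a linear isometry preserves inner products. -/
theorem isPaired (hp : 1 ≤ p) (hl : (p : ℝ) < l) (a b : CompSpace p) : IsPaired l a b := by
  have ha := memLp_compAdj hp hl a
  have hb := memLp_compAdj hp hl b
  refine ⟨(integrable_compMeasure_iff hl).1 ((memLp_conj ha).integrable_mul hb), ?_⟩
  rw [← integral_compMeasure hl, ← inner_toLp_toLp ha hb]
  exact (compIso hp hl).inner_map_map a b

end Isometry

/-! ### Mean value property against a circle-invariant weight. -/

section MeanValue

/-- Averaging over v ↦ e^{iθ}v leaves the integral unchanged, while for each v the average of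
G(e^{iθ}v) is G(0). If G(0) ≠ 0, the averaged integrand is a nonzero multiple of r, so integrability
of r comes for free. Holomorphy is required only where the weight does not vanish. -/
theorem integral_mul_eq_of_circle_invariant {V : Type*} [NormedAddCommGroup V] [NormedSpace ℂ V]
    [MeasurableSpace V] [BorelSpace V] [SecondCountableTopology V] (μ : Measure V) [SFinite μ]
    (hμ : ∀ θ : ℝ, MeasurePreserving (fun v : V => Complex.exp (θ * Complex.I) • v) μ μ)
    {r : V → ℝ} (hrinv : ∀ (θ : ℝ) v, r (Complex.exp (θ * Complex.I) • v) = r v)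
    {G : V → ℂ} (hG : ∀ v, r v ≠ 0 → DiffContOnCl ℂ (fun t : ℂ => G (t • v)) (Metric.ball 0 1))
    (hi : Integrable (fun v => G v * (r v : ℂ)) μ) :
    ∫ v, G v * (r v : ℂ) ∂μ = G 0 * ∫ v, (r v : ℂ) ∂μ ∧
      (G 0 ≠ 0 → Integrable (fun v => (r v : ℂ)) μ) := by
  set ν : Measure ℝ := volume.restrict (Ioc 0 (2 * Real.pi)) with hν
  -- Rotation by the variable angle preserves the product measure, so joint integrability is
  -- inherited from that of G r.
  have hskew : MeasurePreserving (fun x : ℝ × V => (x.1, Complex.exp (x.1 * Complex.I) • x.2))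
      (ν.prod μ) (ν.prod μ) := by
    refine MeasurePreserving.skew_product (f := id) (g := fun (θ : ℝ) v => Complex.exp (θ * Complex.I) • v)
      (MeasurePreserving.id ν) ?_ (ae_of_all _ fun θ => (hμ θ).map_eq)
    exact Continuous.measurable (by fun_prop)
  set f : ℝ × V → ℂ := fun x => G (Complex.exp (x.1 * Complex.I) • x.2) * (r x.2 : ℂ) with hf
  have hfi : Integrable f (ν.prod μ) := by
    have h1 : Integrable (fun x : ℝ × V => G x.2 * (r x.2 : ℂ)) (ν.prod μ) := hi.comp_snd ν
    refine (hskew.integrable_comp_of_integrable h1).congr (ae_of_all _ fun x => ?_)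
    simp only [Function.comp, hf, hrinv]
  have hmean : ∀ v, ∫ θ, f (θ, v) ∂ν = (2 * Real.pi : ℝ) * (G 0 * (r v : ℂ)) := by
    intro v
    by_cases hv : r v = 0
    · simp [hf, hv]
    have h := (show DiffContOnCl ℂ (fun t : ℂ => G (t • v)) (Metric.ball 0 |1|) by
      rw [abs_one]; exact hG v hv).circleAverage
    rw [Real.circleAverage_def, intervalIntegral.integral_of_le (by positivity), zero_smul] at h
    simp only [circleMap, Complex.ofReal_one, one_mul, zero_add] at h
    rw [← h]
    simp only [hf]
    rw [integral_mul_const, Complex.real_smul, hν, ← mul_assoc, ← mul_assoc,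
      ← Complex.ofReal_mul, mul_inv_cancel₀ (by positivity), Complex.ofReal_one, one_mul]
  have hsw := integral_integral_swap (f := fun v θ => f (θ, v)) (μ := μ) (ν := ν) hfi.swap
  have hrot : ∀ θ, ∫ v, f (θ, v) ∂μ = ∫ v, G v * (r v : ℂ) ∂μ := by
    intro θ
    have h := (hμ θ)
    conv_rhs => rw [← h.map_eq]
    rw [integral_map h.measurable.aemeasurable]
    · simp only [hf, hrinv]
    · rw [h.map_eq]; exact hi.1
  simp only [hmean, hrot] at hsw
  have h2π : ((2 * Real.pi : ℝ) : ℂ) ≠ 0 := by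
    rw [Ne, Complex.ofReal_eq_zero]; positivity
  constructor
  · rw [integral_const_mul, integral_const_mul, integral_const, hν] at hsw
    rw [measureReal_restrict_apply_univ, Real.volume_real_Ioc_of_le (by positivity), sub_zero,
      Complex.real_smul] at hsw
    exact (mul_left_cancel₀ h2π hsw).symm
  · intro h0
    have h3 : Integrable (fun v => ∫ θ, f (θ, v) ∂ν) μ := hfi.swap.integral_prod_left
    simp only [hmean] at h3
    refine (h3.const_mul ((((2 * Real.pi : ℝ) : ℂ) * G 0)⁻¹)).congr (ae_of_all _ fun v => ?_)
    simp only
    field_simp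

end MeanValue

/-! ### The Bergman kernel Tκ_w and Heisenberg translations. -/

section KernelTransform

variable {p : ℕ} {l : ℝ}

/-- The Laplace type integral `∫ 2 (2ξ)^(l-1) / Γ(l) e^{iξζ} dξ`. -/
def lapKernel (l : ℝ) (ζ : ℂ) : ℂ :=
  ∫ ξ in Ioi (0 : ℝ), ((2 * (2 * ξ) ^ (l - 1) / Real.Gamma l : ℝ) : ℂ) *
    Complex.exp (Complex.I * ξ * ζ)

/-- Summing the exponential series under the integral over ξ leaves a Laplace integral in the single
variable z_p - conj w_p - 2i z'·conj w'. -/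
theorem compAdj_kernelVec (hl : 0 < l) {z w : CSpace p} (hz : z ∈ siegelDomain p)
    (hw : w ∈ siegelDomain p) : compAdj l (kernelVec hl hw) z =
      lapKernel l (z.2 - (starRingEnd ℂ) w.2 -
        2 * Complex.I * ∑ k, z.1 k * (starRingEnd ℂ) (w.1 k)) := by
  have hint : ∀ n, Integrable (fun ξ => bargmannKernel p l n z ξ *
      (starRingEnd ℂ) (bargmannKernel p l n w ξ)) (volume.restrict (Ioi 0)) := fun n =>
    (memLp_bargmannKernel hl n hz).integrable_mul (memLp_conj (memLp_bargmannKernel hl n hw))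
  have e1 : ∀ n, inner ℂ (kernelVec hl hz n) (kernelVec hl hw n) =
      ∫ ξ in Ioi (0 : ℝ), bargmannKernel p l n z ξ *
        (starRingEnd ℂ) (bargmannKernel p l n w ξ) := by
    intro n
    rw [kernelVec_apply, kernelVec_apply, inner_toLp_toLp]
    simp only [Complex.conj_conj]
  have hsum : Summable fun n => ∫ ξ in Ioi (0 : ℝ), ‖bargmannKernel p l n z ξ *
      (starRingEnd ℂ) (bargmannKernel p l n w ξ)‖ := by
    have hs : ∀ {z : CSpace p}, z ∈ siegelDomain p →
        Summable fun n => ∫ ξ in Ioi (0 : ℝ), ‖bargmannKernel p l n z ξ‖ ^ 2 := fun {z} hz =>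
      summable_of_sum_le (fun n => integral_nonneg fun _ => by positivity)
        (sum_integral_norm_bargmannKernel_sq_le hl hz)
    -- The exchange of sum and integral is dominated by |ab| ≤ |a|² + |b|² and the norm bounds for
    -- κ_z and κ_w.
    refine Summable.of_nonneg_of_le (fun n => integral_nonneg fun _ => norm_nonneg _) (fun n => ?_)
      ((hs hz).add (hs hw))
    have i1 := integrableOn_norm_bargmannKernel_sq hl n hz
    have i2 := integrableOn_norm_bargmannKernel_sq hl n hw
    rw [← integral_add i1 i2]
    refine integral_mono (hint n).norm (i1.add i2) fun ξ => ?_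
    simp only [norm_mul, RCLike.norm_conj]
    nlinarith [sq_nonneg (‖bargmannKernel p l n z ξ‖ - ‖bargmannKernel p l n w ξ‖),
      sq_nonneg (‖bargmannKernel p l n z ξ‖), sq_nonneg ‖bargmannKernel p l n w ξ‖]
  rw [compAdj_eq_inner hl hz, lp.inner_eq_tsum]
  simp only [e1]
  rw [integral_tsum_of_summable_integral_norm hint hsum, lapKernel]
  refine setIntegral_congr_fun measurableSet_Ioi fun ξ hξ => ?_
  rw [(hasSum_bargmannKernel_mul_conj hl z w hξ).tsum_eq, mul_assoc, ← Complex.exp_add]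
  congr 2
  rw [← Finset.mul_sum]
  linear_combination (2 * ξ * ∑ k, z.1 k * (starRingEnd ℂ) (w.1 k)) * Complex.I_sq

theorem origin_mem_siegelDomain {ζ : ℂ} (hζ : 0 < ζ.im) :
    ((0, ζ) : CSpace p) ∈ siegelDomain p := by
  simpa [siegelDomain, siegelHeight] using hζ

theorem lapKernel_ofReal_mul_I (hl : 0 < l) {c : ℝ} (hc : 0 < c) :
    lapKernel l (2 * c * Complex.I) = ((c ^ (-l) : ℝ) : ℂ) := by
  rw [lapKernel, ← integral_kernel_bound hl hc, ← integral_complex_ofReal]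
  refine integral_congr_ae (ae_of_all _ fun ξ => ?_)
  simp only
  rw [Complex.ofReal_mul _ (Real.exp _), Complex.ofReal_exp]
  congr 2
  push_cast
  linear_combination (2 * ξ * c : ℂ) * Complex.I_mul_I

/-- The identity theorem: both sides are holomorphic in the upper half-plane and agree on the
imaginary axis, where the left side is Euler's integral. -/
theorem lapKernel_eq_cpow (hl : 0 < l) {η : ℝ} (hη : 0 < η) {ζ : ℂ} (hζ : 0 < ζ.im) :
    lapKernel l (ζ + η * Complex.I) = ((-Complex.I * ζ + η) / 2) ^ (-l : ℂ) := by
  have hopen : IsOpen {ζ : ℂ | 0 < ζ.im} := isOpen_lt continuous_const Complex.continuous_im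
  -- Holomorphy of the Laplace integral is borrowed from the case p = 1, where it is the transform
  -- of a kernel vector.
  have hw : ((0, η * Complex.I) : CSpace 1) ∈ siegelDomain 1 :=
    origin_mem_siegelDomain (by simpa using hη)
  have e1 : EqOn (fun ζ : ℂ => compAdj l (kernelVec hl hw) ((0, ζ) : CSpace 1))
      (fun ζ => lapKernel l (ζ + η * Complex.I)) {ζ : ℂ | 0 < ζ.im} := by
    intro ζ hζ
    simp only
    rw [compAdj_kernelVec hl (origin_mem_siegelDomain hζ) hw]
    simp
  have d1 : DifferentiableOn ℂ (fun ζ => lapKernel l (ζ + η * Complex.I)) {ζ : ℂ | 0 < ζ.im} := by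
    refine DifferentiableOn.congr ?_ e1.symm
    refine (differentiableOn_compAdj hl _).comp (Differentiable.differentiableOn (by fun_prop))
      fun ζ hζ => origin_mem_siegelDomain hζ
  have hre : ∀ ζ : ℂ, ((-Complex.I * ζ + η) / 2).re = (ζ.im + η) / 2 := by
    intro ζ
    have : ((-Complex.I * ζ + η) / 2) = ((1 / 2 : ℝ) : ℂ) * (-Complex.I * ζ + η) := by
      push_cast; ring
    rw [this, Complex.re_ofReal_mul]
    simp
    ring
  have d2 : DifferentiableOn ℂ (fun ζ : ℂ => ((-Complex.I * ζ + η) / 2) ^ (-l : ℂ))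
      {ζ : ℂ | 0 < ζ.im} := by
    refine DifferentiableOn.cpow_const (Differentiable.differentiableOn (by fun_prop)) fun ζ hζ => ?_
    refine Or.inl ?_
    rw [hre]
    have : 0 < ζ.im := hζ
    linarith
  have hfreq : ∃ᶠ ζ in 𝓝[≠] Complex.I, lapKernel l (ζ + η * Complex.I) =
      ((-Complex.I * ζ + η) / 2) ^ (-l : ℂ) := by
    -- The points iy with y ↓ 1 accumulate at i without meeting it, as the identity theorem
    -- requires.
    have ht : Tendsto (fun y : ℝ => (y : ℂ) * Complex.I) (𝓝[>] 1) (𝓝[≠] Complex.I) := by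
      refine tendsto_nhdsWithin_iff.2 ⟨?_, ?_⟩
      · have : Tendsto (fun y : ℝ => (y : ℂ) * Complex.I) (𝓝 1) (𝓝 ((1 : ℝ) * Complex.I)) :=
          Continuous.tendsto (by fun_prop) 1
        rw [Complex.ofReal_one, one_mul] at this
        exact this.mono_left nhdsWithin_le_nhds
      · filter_upwards [self_mem_nhdsWithin] with y hy
        intro h
        have := congrArg Complex.im h
        simp at this
        exact (ne_of_gt hy) this
    refine ht.frequently (Eventually.frequently ?_)
    filter_upwards [self_mem_nhdsWithin] with y hy
    have hy' : (0 : ℝ) < y := one_pos.trans hy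
    have hc : 0 < (y + η) / 2 := by positivity
    have a1 : (y : ℂ) * Complex.I + η * Complex.I = 2 * (((y + η) / 2 : ℝ) : ℂ) * Complex.I := by
      push_cast; ring
    have a2 : (-Complex.I * (y * Complex.I) + η) / 2 = (((y + η) / 2 : ℝ) : ℂ) := by
      push_cast
      linear_combination (-(y : ℂ) / 2) * Complex.I_mul_I
    rw [a1, a2, lapKernel_ofReal_mul_I hl hc, ← Complex.ofReal_neg, Complex.ofReal_cpow hc.le]
  exact (d1.analyticOnNhd hopen).eqOn_of_preconnected_of_frequently_eq (d2.analyticOnNhd hopen)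
    (convex_halfSpace_im_gt 0).isPreconnected (by simp : (0 : ℝ) < Complex.I.im) hfreq hζ

/-- The Heisenberg translation moving `(0, iρ(w))` to `w`. -/
def heisenberg (w ζ : CSpace p) : CSpace p :=
  (ζ.1 + w.1, ζ.2 + ((w.2.re : ℂ) + Complex.I * ((∑ k, ‖w.1 k‖ ^ 2 : ℝ) : ℂ) +
    2 * Complex.I * ∑ k, ζ.1 k * (starRingEnd ℂ) (w.1 k)))

theorem sum_mul_conj_self (v : Fin (p - 1) → ℂ) :
    ∑ k, v k * (starRingEnd ℂ) (v k) = ((∑ k, ‖v k‖ ^ 2 : ℝ) : ℂ) := by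
  push_cast
  exact Finset.sum_congr rfl fun k _ => Complex.mul_conj' _

/-- The cross term 2 Re(ζ'·conj w') of |ζ' + w'|² is compensated by the imaginary part of 2i ζ'·conj
w'. -/
theorem siegelHeight_heisenberg (w ζ : CSpace p) :
    siegelHeight (heisenberg w ζ) = siegelHeight ζ := by
  have e : ∀ k, ‖ζ.1 k + w.1 k‖ ^ 2 = ‖ζ.1 k‖ ^ 2 + ‖w.1 k‖ ^ 2 +
      2 * (ζ.1 k * (starRingEnd ℂ) (w.1 k)).re := by
    intro k
    rw [← Complex.normSq_eq_norm_sq, ← Complex.normSq_eq_norm_sq, ← Complex.normSq_eq_norm_sq,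
      Complex.normSq_add]
  simp only [siegelHeight, heisenberg, Pi.add_apply, e, Finset.sum_add_distrib, ← Finset.mul_sum]
  have h : (2 * Complex.I * ∑ k, ζ.1 k * (starRingEnd ℂ) (w.1 k)).im =
      2 * ∑ k, (ζ.1 k * (starRingEnd ℂ) (w.1 k)).re := by
    rw [← Complex.re_sum]
    simp [Complex.mul_im, Complex.mul_re]
  rw [Complex.add_im, Complex.add_im, Complex.add_im, h, Complex.ofReal_im, Complex.I_mul_im,
    Complex.ofReal_re]
  ring

theorem heisenberg_mem_siegelDomain {w ζ : CSpace p} :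
    heisenberg w ζ ∈ siegelDomain p ↔ ζ ∈ siegelDomain p := by
  simp only [siegelDomain, mem_ofPred_eq, siegelHeight_heisenberg]

theorem differentiable_heisenberg (w : CSpace p) : Differentiable ℂ (heisenberg w) := by
  unfold heisenberg
  fun_prop

theorem measurePreserving_heisenberg (w : CSpace p) :
    MeasurePreserving (heisenberg w) volume volume := by
  refine MeasurePreserving.skew_product (f := fun v : Fin (p - 1) → ℂ => v + w.1)
    (g := fun v (ζ : ℂ) => ζ + ((w.2.re : ℂ) + Complex.I * ((∑ k, ‖w.1 k‖ ^ 2 : ℝ) : ℂ) +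
      2 * Complex.I * ∑ k, v k * (starRingEnd ℂ) (w.1 k)))
    (measurePreserving_add_right volume w.1) ?_
    (ae_of_all _ fun v => (measurePreserving_add_right volume _).map_eq)
  exact Continuous.measurable (by fun_prop)

theorem heisenberg_zero (w : CSpace p) :
    heisenberg w (0, siegelHeight w * Complex.I) = w := by
  refine Prod.ext (by simp [heisenberg]) (Complex.ext ?_ ?_)
  · have : ∀ k, ((‖w.1 k‖ : ℂ) ^ 2).im = 0 := fun k => by
      rw [← Complex.ofReal_pow, Complex.ofReal_im]
    simp [heisenberg, this]
  · simp [heisenberg, siegelHeight]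

/-- After translation the kernel depends on ζ_p alone, so the integration over ζ' no longer sees it.
-/
theorem compAdj_kernelVec_heisenberg (hl : 0 < l) {w ζ : CSpace p} (hw : w ∈ siegelDomain p)
    (hζ : ζ ∈ siegelDomain p) : compAdj l (kernelVec hl hw) (heisenberg w ζ) =
      ((-Complex.I * ζ.2 + siegelHeight w) / 2) ^ (-l : ℂ) := by
  have hζ2 : 0 < ζ.2.im := by
    have h1 : 0 < ζ.2.im - ∑ k, ‖ζ.1 k‖ ^ 2 := hζ
    have h2 : 0 ≤ ∑ k, ‖ζ.1 k‖ ^ 2 := by positivity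
    linarith
  rw [compAdj_kernelVec hl (heisenberg_mem_siegelDomain.2 hζ) hw, ← lapKernel_eq_cpow hl hw hζ2]
  congr 1
  simp only [heisenberg, Pi.add_apply, add_mul, Finset.sum_add_distrib, sum_mul_conj_self]
  have h1 : (starRingEnd ℂ) w.2 = w.2.re - w.2.im * Complex.I := by
    apply Complex.ext <;> simp
  rw [h1, siegelHeight]
  push_cast
  ring

end KernelTransform

/-! ### Integrating out z': from the Siegel domain to the half-plane. -/

section Slice

theorem ne_zero_of_integral_pos_weight {V : Type*} [TopologicalSpace V] [MeasurableSpace V]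
    [OpensMeasurableSpace V] {μ : Measure V} [μ.IsOpenPosMeasure] {r : V → ℝ} (h0 : ∀ v, 0 ≤ r v)
    {s : Set V} (hs : IsOpen s) (hne : s.Nonempty) (hpos : ∀ v ∈ s, 0 < r v)
    (hi : Integrable (fun v => (r v : ℂ)) μ) : ∫ v, (r v : ℂ) ∂μ ≠ 0 := by
  have hi' : Integrable r μ := by simpa using hi.re
  rw [integral_complex_ofReal, Ne, Complex.ofReal_eq_zero]
  refine ((integral_pos_iff_support_of_nonneg h0 hi').2 ?_).ne'
  exact (hs.measure_pos μ hne).trans_le (measure_mono fun v hv => (hpos v hv).ne')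

open Classical in
/-- The function `(y - |v|²)_+^s`. -/
def ballWeight {d : ℕ} (s y : ℝ) (v : Fin d → ℂ) : ℝ :=
  if ∑ k, ‖v k‖ ^ 2 < y then (y - ∑ k, ‖v k‖ ^ 2) ^ s else 0

variable {d : ℕ} {s : ℝ}

theorem ballWeight_nonneg (y : ℝ) (v : Fin d → ℂ) : 0 ≤ ballWeight s y v := by
  unfold ballWeight
  split_ifs with h
  · exact Real.rpow_nonneg (by linarith) _
  · exact le_rfl

theorem ballWeight_rotate (y θ : ℝ) (v : Fin d → ℂ) :
    ballWeight s y (Complex.exp (θ * Complex.I) • v) = ballWeight s y v := by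
  simp [ballWeight, Complex.norm_exp_ofReal_mul_I]

theorem ballWeight_sqrt_smul {y : ℝ} (hy : 0 < y) (v : Fin d → ℂ) :
    ballWeight s y (Real.sqrt y • v) = y ^ s * ballWeight s 1 v := by
  have e : ∑ k, ‖(Real.sqrt y • v) k‖ ^ 2 = y * ∑ k, ‖v k‖ ^ 2 := by
    rw [Finset.mul_sum]
    refine Finset.sum_congr rfl fun k _ => ?_
    rw [Pi.smul_apply, norm_smul, mul_pow, Real.norm_of_nonneg (Real.sqrt_nonneg y),
      Real.sq_sqrt hy.le]
  unfold ballWeight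
  rw [e]
  by_cases h : ∑ k, ‖v k‖ ^ 2 < 1
  · rw [if_pos h, if_pos ((mul_lt_iff_lt_one_right hy).2 h),
      ← Real.mul_rpow hy.le (by linarith), mul_sub, mul_one]
  · rw [if_neg h, if_neg (mt (mul_lt_iff_lt_one_right hy).1 h), mul_zero]

/-- Scaling by √y in real dimension 2d contributes y^d, and the weight contributes y^s. -/
theorem integral_ballWeight {y : ℝ} (hy : 0 < y) :
    ∫ v : Fin d → ℂ, (ballWeight s y v : ℂ) =
      ((y ^ (s + d) : ℝ) : ℂ) * ∫ v : Fin d → ℂ, (ballWeight s 1 v : ℂ) := by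
  have h := Measure.integral_comp_smul volume (fun v : Fin d → ℂ => (ballWeight s y v : ℂ)) (Real.sqrt y)
  have hf : Module.finrank ℝ (Fin d → ℂ) = 2 * d := by
    rw [Module.finrank_pi_fintype]
    simp [mul_comm]
  simp only [ballWeight_sqrt_smul hy, Complex.ofReal_mul] at h
  rw [integral_const_mul, hf, pow_mul, Real.sq_sqrt hy.le, abs_of_nonneg (by positivity),
    Complex.real_smul] at h
  have hy' : ((y ^ d : ℝ) : ℂ) ≠ 0 := by
    rw [Ne, Complex.ofReal_eq_zero]; positivity
  rw [Real.rpow_add hy, Real.rpow_natCast, Complex.ofReal_mul, mul_comm ((y ^ s : ℝ) : ℂ), mul_assoc,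
    h, Complex.ofReal_inv, ← mul_assoc, mul_inv_cancel₀ hy', one_mul]

theorem measurePreserving_exp_smul (θ : ℝ) :
    MeasurePreserving (fun v : Fin d → ℂ => Complex.exp (θ * Complex.I) • v) volume volume := by
  have h1 : MeasurePreserving (fun z : ℂ => Complex.exp (θ * Complex.I) * z) := by
    have : MeasurePreserving (fun z : ℂ => (Circle.exp θ : ℂ) * z) :=
      (rotation (Circle.exp θ)).measurePreserving
    simpa only [Circle.coe_exp] using this
  exact measurePreserving_pi (fun _ => volume) (fun _ => volume)
    (f := fun _ z => Complex.exp (θ * Complex.I) * z) fun _ => h1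

theorem measurePreserving_exp_mul (θ : ℝ) :
    MeasurePreserving (fun v : ℂ => Complex.exp (θ * Complex.I) • v) := by
  have : MeasurePreserving (fun z : ℂ => (Circle.exp θ : ℂ) * z) :=
    (rotation (Circle.exp θ)).measurePreserving
  simpa only [Circle.coe_exp, smul_eq_mul] using this

variable {p : ℕ} {l : ℝ}

/-- For |t| ≤ 1 the point (tv, ζ) stays in the domain, so the mean value property applies to the
slice over ζ with the rotation invariant weight (Im ζ - |v|²)_+^s. -/
theorem slice_mean {G : CSpace p → ℂ} (hG : DifferentiableOn ℂ G (siegelDomain p)) (s : ℝ) {ζ : ℂ}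
    (hi : Integrable (fun v : Fin (p - 1) → ℂ => G (v, ζ) * (ballWeight s ζ.im v : ℂ))) :
    ∫ v : Fin (p - 1) → ℂ, G (v, ζ) * (ballWeight s ζ.im v : ℂ) =
        G (0, ζ) * ∫ v : Fin (p - 1) → ℂ, (ballWeight s ζ.im v : ℂ) ∧
      (G (0, ζ) ≠ 0 → Integrable fun v : Fin (p - 1) → ℂ => (ballWeight s ζ.im v : ℂ)) := by
  refine integral_mul_eq_of_circle_invariant volume measurePreserving_exp_smul
    (G := fun v => G (v, ζ)) (fun θ v => ballWeight_rotate _ θ v) (fun v hv => ?_) hi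
  have hv' : ∑ k, ‖v k‖ ^ 2 < ζ.im := by
    by_contra h
    exact hv (if_neg h)
  refine DifferentiableOn.diffContOnCl ?_
  refine hG.comp (f := fun t : ℂ => ((t • v, ζ) : CSpace p))
    (Differentiable.differentiableOn (by fun_prop)) fun t ht => ?_
  have ht1 : ‖t‖ ≤ 1 := by
    have := Metric.closure_ball_subset_closedBall ht
    simpa using this
  change 0 < ζ.im - ∑ k, ‖t * v k‖ ^ 2
  have : ∑ k, ‖t * v k‖ ^ 2 ≤ ∑ k, ‖v k‖ ^ 2 := by
    refine Finset.sum_le_sum fun k _ => ?_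
    rw [norm_mul]
    exact pow_le_pow_left₀ (by positivity) (mul_le_of_le_one_left (norm_nonneg _) ht1) 2
  linarith

theorem isOpen_ball_pi (y : ℝ) : IsOpen {v : Fin d → ℂ | ∑ k, ‖v k‖ ^ 2 < y} :=
  isOpen_lt (by fun_prop) continuous_const

/-- Since k depends only on z_p, the inner integral over z' is k(ζ) G(0, ζ) times a power of Im ζ,
up to a constant that must be shown to be nonzero. -/
theorem half_plane_of_siegel (hp : 1 ≤ p) (hl : (p : ℝ) < l) {k : ℂ → ℂ}
    (hk : ∀ ζ : ℂ, 0 < ζ.im → k ζ ≠ 0) {G : CSpace p → ℂ}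
    (hG : DifferentiableOn ℂ G (siegelDomain p)) (hG0 : ∀ z ∉ siegelDomain p, G z = 0)
    (hi : Integrable fun z : CSpace p => k z.2 * G z * (weight p l z : ℂ))
    (hint : ∫ z : CSpace p, k z.2 * G z * (weight p l z : ℂ) = 0) {ζ₀ : ℂ} (hζ₀ : 0 < ζ₀.im)
    (hne : G (0, ζ₀) ≠ 0) :
    IntegrableOn (fun ζ => k ζ * G (0, ζ) * ((ζ.im ^ (l - 2) : ℝ) : ℂ)) {ζ | 0 < ζ.im} ∧
      ∫ ζ in {ζ : ℂ | 0 < ζ.im}, k ζ * G (0, ζ) * ((ζ.im ^ (l - 2) : ℝ) : ℂ) = 0 := by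
  set s := l - p - 1 with hs
  have hc : ((weightConst p l : ℝ) : ℂ) ≠ 0 := by
    rw [Ne, Complex.ofReal_eq_zero]; exact (weightConst_pos hl).ne'
  set f : CSpace p → ℂ := fun z => k z.2 * (G z * (ballWeight s z.2.im z.1 : ℂ)) with hf
  have e : ∀ z : CSpace p, f z = (weightConst p l : ℂ)⁻¹ * (k z.2 * G z * (weight p l z : ℂ)) := by
    intro z
    by_cases hz : z ∈ siegelDomain p
    · have hz' : ∑ k, ‖z.1 k‖ ^ 2 < z.2.im := by
        have : 0 < z.2.im - ∑ k, ‖z.1 k‖ ^ 2 := hz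
        linarith
      simp only [hf, ballWeight, if_pos hz', weight, siegelHeight, Complex.ofReal_mul]
      rw [← hs]
      field_simp
    · simp [hf, hG0 z hz]
  have hfi : Integrable f (volume.prod volume) := by
    have := hi.const_mul ((weightConst p l : ℂ)⁻¹)
    exact this.congr (ae_of_all _ fun z => (e z).symm)
  have hf0 : ∫ z, f z ∂(volume.prod volume) = 0 := by
    have : ∫ z, f z = 0 := by
      simp only [e]
      rw [integral_const_mul, hint, mul_zero]
    exact this
  have hae : ∀ᵐ ζ : ℂ, 0 < ζ.im →
      Integrable fun v : Fin (p - 1) → ℂ => G (v, ζ) * (ballWeight s ζ.im v : ℂ) := by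
    filter_upwards [hfi.prod_left_ae] with ζ hζ h0
    refine (hζ.const_mul (k ζ)⁻¹).congr (ae_of_all _ fun v => ?_)
    simp only [hf]
    rw [inv_mul_cancel_left₀ (hk ζ h0)]
  set C₁ := ∫ v : Fin (p - 1) → ℂ, (ballWeight s 1 v : ℂ) with hC₁
  -- The p - 1 variables raise the exponent l - p - 1 to l - 2, the weight of the half-plane with
  -- the same parameter l.
  have hsl : s + (p - 1 : ℕ) = l - 2 := by
    rw [hs]; push_cast [hp]; ring
  -- A divergent integral would count as 0. A slice with G(0, ζ) ≠ 0 shows that the weight is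
  -- integrable, after which positivity applies; such a slice exists because G(0, ·) is nonzero on
  -- an open set.
  have hC : C₁ ≠ 0 := by
    have hopenH : IsOpen {ζ : ℂ | 0 < ζ.im} := isOpen_lt continuous_const Complex.continuous_im
    have hcont : ContinuousOn (fun ζ : ℂ => G (0, ζ)) {ζ : ℂ | 0 < ζ.im} :=
      hG.continuousOn.comp (by fun_prop) fun ζ hζ => origin_mem_siegelDomain hζ
    have hopen : IsOpen ({ζ : ℂ | 0 < ζ.im} ∩ (fun ζ : ℂ => G (0, ζ)) ⁻¹' {0}ᶜ) :=
      hcont.isOpen_inter_preimage hopenH isOpen_compl_singleton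
    have hfr := frequently_ae_mem_iff.2 (hopen.measure_pos volume ⟨ζ₀, hζ₀, hne⟩).ne'
    obtain ⟨ζ, hζ, hζi⟩ := (hfr.and_eventually hae).exists
    have hζ0 : 0 < ζ.im := hζ.1
    have h1 := (slice_mean hG s (hζi hζ0)).2 hζ.2
    have h2 : ∫ v : Fin (p - 1) → ℂ, (ballWeight s ζ.im v : ℂ) ≠ 0 :=
      ne_zero_of_integral_pos_weight (ballWeight_nonneg ζ.im) (isOpen_ball_pi ζ.im)
        ⟨0, by simpa using hζ0⟩
        (fun v hv => by
          have hv' : ∑ k, ‖v k‖ ^ 2 < ζ.im := hv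
          rw [ballWeight, if_pos hv']
          exact Real.rpow_pos_of_pos (by linarith) _) h1
    rw [integral_ballWeight hζ0] at h2
    exact right_ne_zero_of_mul h2
  have hJ : (fun ζ : ℂ => ∫ v : Fin (p - 1) → ℂ, f (v, ζ)) =ᵐ[volume] fun ζ => C₁ *
      ({ζ : ℂ | 0 < ζ.im}.indicator
        (fun ζ => k ζ * G (0, ζ) * ((ζ.im ^ (l - 2) : ℝ) : ℂ)) ζ) := by
    filter_upwards [hae] with ζ hζ
    by_cases h0 : 0 < ζ.im
    · rw [indicator_of_mem (by exact h0)]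
      simp only [hf]
      rw [integral_const_mul, (slice_mean hG s (hζ h0)).1, integral_ballWeight h0, hsl]
      ring
    · rw [indicator_of_notMem (by exact h0), mul_zero]
      refine integral_eq_zero_of_ae (ae_of_all _ fun v => ?_)
      have : ¬ ∑ k, ‖v k‖ ^ 2 < ζ.im := by
        have : 0 ≤ ∑ k, ‖v k‖ ^ 2 := by positivity
        linarith
      simp [hf, ballWeight, this]
  have hmeasH : MeasurableSet {ζ : ℂ | 0 < ζ.im} :=
    measurableSet_lt measurable_const Complex.measurable_im
  constructor
  · rw [← integrable_indicator_iff hmeasH]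
    refine ((hfi.integral_prod_right.congr hJ).const_mul C₁⁻¹).congr (ae_of_all _ fun ζ => ?_)
    simp only
    rw [inv_mul_cancel_left₀ hC]
  · rw [← integral_indicator hmeasH]
    rw [integral_prod_symm f hfi, integral_congr_ae hJ, integral_const_mul] at hf0
    exact (mul_eq_zero.1 hf0).resolve_left hC

end Slice

/-! ### The Cayley transform and the mean value property on the disc. -/

section Cayley

variable {l : ℝ}

/-- The Cayley transform from the unit disc to the upper half-plane with `0 ↦ iη`. -/
def cayley (η : ℝ) (u : ℂ) : ℂ := Complex.I * η * (1 + u) / (1 - u)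

theorem one_sub_ne_zero_of_norm_lt {u : ℂ} (hu : ‖u‖ < 1) : 1 - u ≠ 0 := by
  intro h
  rw [← sub_eq_zero.1 h, norm_one] at hu
  exact lt_irrefl _ hu

theorem cayley_im {η : ℝ} {u : ℂ} (hu : ‖u‖ < 1) :
    (cayley η u).im = η * (1 - ‖u‖ ^ 2) / ‖1 - u‖ ^ 2 := by
  have h1 := one_sub_ne_zero_of_norm_lt hu
  have h2 : Complex.normSq (1 - u) ≠ 0 := by simpa [Complex.normSq_eq_zero] using h1
  rw [cayley, ← Complex.normSq_eq_norm_sq, ← Complex.normSq_eq_norm_sq, Complex.div_im]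
  field_simp
  simp [Complex.normSq_apply]
  ring

theorem cayley_image {η : ℝ} (hη : 0 < η) :
    cayley η '' Metric.ball 0 1 = {ζ : ℂ | 0 < ζ.im} := by
  ext ζ
  simp only [mem_image, mem_ball_zero_iff, mem_ofPred_eq]
  constructor
  · rintro ⟨u, hu, rfl⟩
    rw [cayley_im hu]
    have h1 := norm_pos_iff.2 (one_sub_ne_zero_of_norm_lt hu)
    have : 0 < 1 - ‖u‖ ^ 2 := by nlinarith [norm_nonneg u]
    positivity
  · intro hζ
    have hd : ζ + Complex.I * η ≠ 0 := by
      intro h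
      have := congrArg Complex.im h
      simp at this
      linarith
    refine ⟨(ζ - Complex.I * η) / (ζ + Complex.I * η), ?_, ?_⟩
    · rw [norm_div, div_lt_one (norm_pos_iff.2 hd)]
      rw [← sq_lt_sq₀ (norm_nonneg _) (norm_nonneg _), ← Complex.normSq_eq_norm_sq,
        ← Complex.normSq_eq_norm_sq, Complex.normSq_apply, Complex.normSq_apply]
      simp
      nlinarith [mul_pos hζ hη]
    · have hη' : (η : ℂ) ≠ 0 := by exact_mod_cast hη.ne'
      have h2 : 1 - (ζ - Complex.I * η) / (ζ + Complex.I * η) ≠ 0 := by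
        rw [Ne, sub_eq_zero, eq_div_iff hd]
        intro h
        have : 2 * Complex.I * η = 0 := by linear_combination h
        simp [Complex.I_ne_zero, hη'] at this
      rw [cayley, div_eq_iff h2]
      field_simp
      ring

theorem cayley_injOn {η : ℝ} (hη : 0 < η) : InjOn (cayley η) (Metric.ball 0 1) := by
  intro u hu v hv h
  have h1 := one_sub_ne_zero_of_norm_lt (mem_ball_zero_iff.1 hu)
  have h2 := one_sub_ne_zero_of_norm_lt (mem_ball_zero_iff.1 hv)
  have hη' : (η : ℂ) ≠ 0 := by exact_mod_cast hη.ne'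
  rw [cayley, cayley, div_eq_div_iff h1 h2] at h
  have : (Complex.I * η) * (2 * (u - v)) = 0 := by linear_combination h
  have h3 := (mul_eq_zero.1 this).resolve_left (mul_ne_zero Complex.I_ne_zero hη')
  exact sub_eq_zero.1 ((mul_eq_zero.1 h3).resolve_left two_ne_zero)

theorem hasDerivAt_cayley {η : ℝ} {u : ℂ} (hu : ‖u‖ < 1) :
    HasDerivAt (cayley η) (2 * Complex.I * η / (1 - u) ^ 2) u := by
  have h1 := one_sub_ne_zero_of_norm_lt hu
  have h := (((hasDerivAt_id u).const_add 1).const_mul (Complex.I * η)).div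
    ((hasDerivAt_id u).const_sub 1) h1
  refine h.congr_deriv ?_
  simp only [id]
  field_simp
  ring

theorem det_restrictScalars_toSpanSingleton (c : ℂ) :
    ((ContinuousLinearMap.toSpanSingleton ℂ c).restrictScalars ℝ).det = ‖c‖ ^ 2 := by
  simp [ContinuousLinearMap.det, LinearMap.det_restrictScalars,
      Algebra.norm_complex_eq, Complex.normSq_eq_norm_sq]

open Classical in
/-- The function `(1 - |u|²)_+^s` on the plane. -/
def discWeight (s : ℝ) (u : ℂ) : ℝ := if ‖u‖ < 1 then (1 - ‖u‖ ^ 2) ^ s else 0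

/-- In the disc coordinate the conjugated kernel is a positive function times a holomorphic one. The
positive part, the weight and the Jacobian combine to a radial weight, so the integral is G(iη)
times a nonzero number. -/
theorem eq_zero_of_half_plane {η : ℝ} (hη : 0 < η) {G : ℂ → ℂ}
    (hG : DifferentiableOn ℂ G {ζ | 0 < ζ.im})
    (hi : IntegrableOn (fun ζ => (starRingEnd ℂ) (((-Complex.I * ζ + η) / 2) ^ (-l : ℂ)) * G ζ *
      ((ζ.im ^ (l - 2) : ℝ) : ℂ)) {ζ | 0 < ζ.im})
    (hint : ∫ ζ in {ζ : ℂ | 0 < ζ.im}, (starRingEnd ℂ) (((-Complex.I * ζ + η) / 2) ^ (-l : ℂ)) *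
      G ζ * ((ζ.im ^ (l - 2) : ℝ) : ℂ) = 0) : G (Complex.I * η) = 0 := by
  set B : Set ℂ := Metric.ball 0 1 with hB
  have hmem : ∀ {u : ℂ}, u ∈ B → ‖u‖ < 1 := fun h => mem_ball_zero_iff.1 h
  set f' : ℂ → ℂ →L[ℝ] ℂ := fun u =>
    (ContinuousLinearMap.toSpanSingleton ℂ (2 * Complex.I * η / (1 - u) ^ 2)).restrictScalars ℝ
    with hf'
  have hd : ∀ u ∈ B, HasFDerivWithinAt (cayley η) (f' u) B u := fun u hu =>
    ((hasDerivAt_cayley (hmem hu)).hasFDerivAt.restrictScalars ℝ).hasFDerivWithinAt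
  rw [← cayley_image hη] at hi hint
  rw [integrableOn_image_iff_integrableOn_abs_det_fderiv_smul volume measurableSet_ball hd
    (cayley_injOn hη)] at hi
  rw [integral_image_eq_integral_abs_det_fderiv_smul volume measurableSet_ball hd
    (cayley_injOn hη)] at hint
  set H : ℂ → ℂ := fun u => ((η : ℂ) / (1 - u)) ^ (l : ℂ) * G (cayley η u) with hH
  have hre : ∀ {u : ℂ}, ‖u‖ < 1 → 0 < ((η : ℂ) / (1 - u)).re := by
    intro u hu
    have h1 := norm_pos_iff.2 (one_sub_ne_zero_of_norm_lt hu)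
    have h2 : Complex.normSq (1 - u) = ‖1 - u‖ ^ 2 := Complex.normSq_eq_norm_sq _
    rw [Complex.div_re, h2]
    have h3 : u.re < 1 := (Complex.re_le_norm u).trans_lt hu
    simp
    have : 0 < 1 - u.re := by linarith
    positivity
  have e : ∀ u ∈ B, |(f' u).det| • ((starRingEnd ℂ) (((-Complex.I * cayley η u + η) / 2) ^ (-l : ℂ)) *
      G (cayley η u) * (((cayley η u).im ^ (l - 2) : ℝ) : ℂ)) =
      ((4 * η ^ (-l) : ℝ) : ℂ) * (H u * (discWeight (l - 2) u : ℂ)) := by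
    intro u hu
    have hu' := hmem hu
    have h1 := one_sub_ne_zero_of_norm_lt hu'
    have hn := norm_pos_iff.2 h1
    have h1u : 0 < 1 - ‖u‖ ^ 2 := by nlinarith [norm_nonneg u]
    set a : ℂ := (η : ℂ) / (1 - u) with ha
    have ha1 : (-Complex.I * cayley η u + η) / 2 = a := by
      rw [cayley, ha]
      field_simp
      linear_combination (-(η : ℂ) * (1 + u)) * Complex.I_sq
    have ha0 : a ≠ 0 := div_ne_zero (by exact_mod_cast hη.ne') h1
    have hna : ‖a‖ = η / ‖1 - u‖ := by
      rw [ha, norm_div, Complex.norm_real, Real.norm_of_nonneg hη.le]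
    -- From conj(b)·b = |b|² with b = a^l: the conjugate of 1/b is b/|b|².
    have hconj : (starRingEnd ℂ) (a ^ (-l : ℂ)) = ((‖a‖ ^ (-(2 * l)) : ℝ) : ℂ) * a ^ (l : ℂ) := by
      have hb : a ^ (l : ℂ) ≠ 0 := by simp [Complex.cpow_eq_zero_iff, ha0]
      have hnb : ((‖a‖ ^ (-(2 * l)) : ℝ) : ℂ) = ((‖a ^ (l : ℂ)‖ : ℂ) ^ 2)⁻¹ := by
        rw [Complex.norm_cpow_real, Real.rpow_neg (norm_nonneg _), mul_comm,
          Real.rpow_mul (norm_nonneg _)]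
        push_cast
        norm_num
      rw [hnb, ← Complex.conj_mul', Complex.cpow_neg, map_inv₀, mul_inv, mul_assoc,
        inv_mul_cancel₀ hb, mul_one]
    rw [ha1, hf', det_restrictScalars_toSpanSingleton, hconj, hna, cayley_im hu', Complex.real_smul,
      discWeight, if_pos hu', abs_of_nonneg (by positivity)]
    have hnorm : ‖2 * Complex.I * (η : ℂ) / (1 - u) ^ 2‖ = 2 * η / ‖1 - u‖ ^ 2 := by
      simp [abs_of_pos hη]
    rw [hnorm, hH]
    -- The exponents of |1 - u| are -4, 2l and -2(l - 2), with sum 0, so only the radial factor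
    -- remains.
    have key : (2 * η / ‖1 - u‖ ^ 2) ^ 2 * (η / ‖1 - u‖) ^ (-(2 * l)) *
        (η * (1 - ‖u‖ ^ 2) / ‖1 - u‖ ^ 2) ^ (l - 2) = 4 * η ^ (-l) * (1 - ‖u‖ ^ 2) ^ (l - 2) := by
      have e1 : (‖1 - u‖ ^ 2) ^ (l - 2) = ‖1 - u‖ ^ (2 * l) / ‖1 - u‖ ^ 4 := by
        rw [← Real.rpow_natCast ‖1 - u‖ 2, ← Real.rpow_mul hn.le, ← Real.rpow_natCast ‖1 - u‖ 4,
          ← Real.rpow_sub hn]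
        congr 1
        push_cast
        ring
      have e2 : η ^ (l - 2) = η ^ l / η ^ 2 := by
        rw [← Real.rpow_natCast η 2, ← Real.rpow_sub hη]
        norm_num
      have e3 : η ^ (2 * l) = η ^ l * η ^ l := by
        rw [← Real.rpow_add hη]; ring_nf
      rw [Real.div_rpow hη.le hn.le, Real.rpow_neg hη.le, Real.rpow_neg hn.le,
        Real.div_rpow (by positivity) (by positivity), Real.mul_rpow hη.le h1u.le, e1, e2, e3,
        Real.rpow_neg hη.le]
      have p1 := Real.rpow_pos_of_pos hη l
      have p2 := Real.rpow_pos_of_pos hn (2 * l)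
      field_simp
      ring
    have key' := congrArg (fun x : ℝ => (x : ℂ)) key
    simp only [Complex.ofReal_mul] at key' ⊢
    simp only [← ha]
    linear_combination (a ^ (l : ℂ) * G (cayley η u)) * key'
  have hc : ((4 * η ^ (-l) : ℝ) : ℂ) ≠ 0 := by
    rw [Ne, Complex.ofReal_eq_zero]
    have := Real.rpow_pos_of_pos hη (-l)
    positivity
  have hsupp : ∀ u, u ∉ B → H u * (discWeight (l - 2) u : ℂ) = 0 := by
    intro u hu
    have : ¬ ‖u‖ < 1 := fun h => hu (mem_ball_zero_iff.2 h)
    simp [discWeight, this]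
  have hi2 : Integrable (fun u => H u * (discWeight (l - 2) u : ℂ)) := by
    have h1 : IntegrableOn (fun u => ((4 * η ^ (-l) : ℝ) : ℂ) * (H u * (discWeight (l - 2) u : ℂ))) B :=
      (integrableOn_congr_fun e measurableSet_ball).1 hi
    have h2 : IntegrableOn (fun u => H u * (discWeight (l - 2) u : ℂ)) B := by
      refine (Integrable.const_mul h1 ((4 * η ^ (-l) : ℝ) : ℂ)⁻¹).congr (ae_of_all _ fun u => ?_)
      simp only
      rw [inv_mul_cancel_left₀ hc]
    rwa [integrableOn_iff_integrable_of_support_subset] at h2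
    intro u hu
    by_contra h
    exact hu (hsupp u h)
  have hint2 : ∫ u, H u * (discWeight (l - 2) u : ℂ) = 0 := by
    rw [setIntegral_congr_fun measurableSet_ball e, integral_const_mul,
      setIntegral_eq_integral_of_forall_compl_eq_zero hsupp] at hint
    exact (mul_eq_zero.1 hint).resolve_left hc
  have hmv := integral_mul_eq_of_circle_invariant volume measurePreserving_exp_mul
    (G := H) (r := discWeight (l - 2))
    (fun θ u => by simp [discWeight, Complex.norm_exp_ofReal_mul_I])
    (fun u hu => by
      have hu' : ‖u‖ < 1 := by
        by_contra h
        exact hu (if_neg h)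
      refine DifferentiableOn.diffContOnCl ?_
      have hball : ∀ t ∈ closure (Metric.ball (0 : ℂ) 1), ‖t • u‖ < 1 := by
        intro t ht
        have ht1 : ‖t‖ ≤ 1 := by
          have := Metric.closure_ball_subset_closedBall ht
          simpa using this
        rw [norm_smul]
        exact (mul_le_of_le_one_left (norm_nonneg _) ht1).trans_lt hu'
      have hHd : DifferentiableOn ℂ H B := by
        refine DifferentiableOn.mul ?_ ?_
        · refine DifferentiableOn.cpow_const ?_ fun u hu => Or.inl (hre (hmem hu))
          refine DifferentiableOn.div (by fun_prop) (by fun_prop) fun u hu =>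
            one_sub_ne_zero_of_norm_lt (hmem hu)
        · refine hG.comp (fun u hu =>
            (hasDerivAt_cayley (hmem hu)).differentiableAt.differentiableWithinAt) ?_
          rw [← cayley_image hη]
          exact mapsTo_image _ _
      exact hHd.comp (Differentiable.differentiableOn (by fun_prop)) fun t ht =>
        mem_ball_zero_iff.2 (hball t ht)) hi2
  by_contra hne
  have hcay : cayley η 0 = Complex.I * η := by simp [cayley]
  have hH0 : H 0 ≠ 0 := by
    simp only [hH, hcay]
    refine mul_ne_zero ?_ hne
    rw [sub_zero, div_one, ← Complex.ofReal_cpow hη.le, Ne, Complex.ofReal_eq_zero]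
    exact (Real.rpow_pos_of_pos hη l).ne'
  have hpos : ∀ v : ℂ, ‖v‖ < 1 → 0 < 1 - ‖v‖ ^ 2 := fun v hv => by nlinarith [norm_nonneg v]
  have h2 : ∫ v : ℂ, (discWeight (l - 2) v : ℂ) ≠ 0 :=
    ne_zero_of_integral_pos_weight (fun v => by
        unfold discWeight
        split_ifs with h
        · exact (Real.rpow_pos_of_pos (hpos v h) _).le
        · exact le_rfl) Metric.isOpen_ball
      ⟨0, Metric.mem_ball_self one_pos⟩
      (fun v hv => by
        rw [discWeight, if_pos (mem_ball_zero_iff.1 hv)]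
        exact Real.rpow_pos_of_pos (hpos v (mem_ball_zero_iff.1 hv)) _) (hmv.2 hH0)
  rw [hmv.1] at hint2
  exact (mul_ne_zero hH0 h2) hint2

end Cayley

/-! ### Surjectivity onto the weighted Bergman space. -/

section Onto

variable {p : ℕ} {l : ℝ}

theorem siegelHeight_le_im (z : CSpace p) : siegelHeight z ≤ z.2.im := by
  have h2 : 0 ≤ ∑ k, ‖z.1 k‖ ^ 2 := by positivity
  rw [siegelHeight]
  linarith

/-- To get g(w) = 0 only the test vector κ_w is needed. The translation moves the base point w to
(0, iρ(w)), where the two mean value arguments apply in turn. -/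
theorem eq_zero_of_orthogonal (hp : 1 ≤ p) (hl : (p : ℝ) < l) {g : CSpace p → ℂ}
    (hg : DifferentiableOn ℂ g (siegelDomain p)) (hg0 : ∀ z ∉ siegelDomain p, g z = 0)
    (hg2 : MemLp g 2 (compMeasure p l))
    (horth : ∀ a : CompSpace p, ∫ z, (starRingEnd ℂ) (compAdj l a z) * g z ∂(compMeasure p l) = 0) :
    g = 0 := by
  funext w
  by_cases hw : w ∈ siegelDomain p
  swap
  · exact hg0 w hw
  have hl0 := pos_of_natCast_lt hl
  set κ := compAdj l (kernelVec hl0 hw) with hκ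
  set Φ : CSpace p → ℂ := fun z => (starRingEnd ℂ) (κ z) * g z * (weight p l z : ℂ) with hΦ
  have hsupp : Function.support Φ ⊆ siegelDomain p := by
    intro z hz
    by_contra h
    exact hz (by simp [hΦ, hg0 z h])
  have hΦi : Integrable Φ := by
    have h1 : Integrable (fun z => (starRingEnd ℂ) (κ z) * g z) (compMeasure p l) :=
      (memLp_conj (memLp_compAdj hp hl _)).integrable_mul hg2
    rw [integrable_compMeasure_iff hl] at h1
    exact (integrableOn_iff_integrable_of_support_subset hsupp).1 h1
  have hΦ0 : ∫ z, Φ z = 0 := by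
    rw [← setIntegral_eq_integral_of_forall_compl_eq_zero
      (fun z hz => Function.notMem_support.1 fun h => hz (hsupp h)), ← integral_compMeasure hl]
    exact horth _
  have hmp := measurePreserving_heisenberg w
  set k : ℂ → ℂ := fun ζ =>
    (starRingEnd ℂ) (((-Complex.I * ζ + siegelHeight w) / 2) ^ (-l : ℂ)) with hk
  set G : CSpace p → ℂ := fun z => g (heisenberg w z) with hG
  have e : ∀ z, Φ (heisenberg w z) = k z.2 * G z * (weight p l z : ℂ) := by
    intro z
    by_cases hz : z ∈ siegelDomain p
    · simp only [hΦ, hκ, hk, hG, compAdj_kernelVec_heisenberg hl0 hw hz, weight,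
        siegelHeight_heisenberg]
    · simp [hΦ, hG, hg0 _ (mt heisenberg_mem_siegelDomain.1 hz)]
  have hi2 : Integrable fun z => k z.2 * G z * (weight p l z : ℂ) :=
    (hmp.integrable_comp_of_integrable hΦi).congr (ae_of_all _ e)
  have h02 : ∫ z, k z.2 * G z * (weight p l z : ℂ) = 0 := by
    simp only [← e]
    rw [← hΦ0]
    conv_rhs => rw [← hmp.map_eq]
    rw [integral_map hmp.measurable.aemeasurable]
    rw [hmp.map_eq]
    exact hΦi.1
  have hη : 0 < siegelHeight w := hw
  by_contra hne
  have hne' : G (0, Complex.I * siegelHeight w) ≠ 0 := by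
    simp only [hG]
    rw [mul_comm, heisenberg_zero]
    exact hne
  have hGd : DifferentiableOn ℂ G (siegelDomain p) :=
    hg.comp (differentiable_heisenberg w).differentiableOn fun z hz =>
      heisenberg_mem_siegelDomain.2 hz
  have hG0 : ∀ z ∉ siegelDomain p, G z = 0 := fun z hz =>
    hg0 _ (mt heisenberg_mem_siegelDomain.1 hz)
  have hk0 : ∀ ζ : ℂ, 0 < ζ.im → k ζ ≠ 0 := by
    intro ζ hζ
    rw [hk, Ne, map_eq_zero, Complex.cpow_eq_zero_iff, not_and_or]
    left
    intro h
    have := congrArg Complex.re ((div_eq_zero_iff.1 h).resolve_right two_ne_zero)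
    simp at this
    linarith
  obtain ⟨h1, h2⟩ := half_plane_of_siegel hp hl hk0 hGd hG0 hi2 h02
    (ζ₀ := Complex.I * siegelHeight w) (by simpa using hη) hne'
  exact hne' (eq_zero_of_half_plane hη (G := fun ζ => G (0, ζ))
    (hGd.comp (Differentiable.differentiableOn (by fun_prop)) fun ζ hζ =>
      origin_mem_siegelDomain hζ) h1 h2)

/-- The candidate is T^* f: the difference f - TT^* f is holomorphic and orthogonal to the range of
T. -/
theorem exists_compAdj_eq (hp : 1 ≤ p) (hl : (p : ℝ) < l) {f : CSpace p → ℂ}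
    (hf : DifferentiableOn ℂ f (siegelDomain p)) (hf0 : ∀ z ∉ siegelDomain p, f z = 0)
    (hf2 : MemLp f 2 (compMeasure p l)) : ∃ b, compAdj l b = f := by
  have hl0 := pos_of_natCast_lt hl
  set T := (compIso hp hl).toContinuousLinearMap with hT
  set b := ContinuousLinearMap.adjoint T (hf2.toLp f) with hb
  refine ⟨b, ?_⟩
  have hTb := memLp_compAdj hp hl b
  have h := eq_zero_of_orthogonal hp hl (hf.sub (differentiableOn_compAdj hl0 b))
    (fun z hz => by simp [hf0 z hz, compAdj_of_notMem b hz]) (hf2.sub hTb) (fun a => by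
      have ha := memLp_compAdj hp hl a
      rw [← inner_toLp_toLp ha (hf2.sub hTb), MemLp.toLp_sub hf2 hTb, inner_sub_right, sub_eq_zero,
        ← compIso_apply hp hl a, ← compIso_apply hp hl b, LinearIsometry.inner_map_map, hb,
        ContinuousLinearMap.adjoint_inner_right]
      rfl)
  exact (sub_eq_zero.1 h).symm

end Onto

/-! ### Testing functions on bands. -/

section Testing

/-- Vanishing set integrals give vanishing almost everywhere on each band, and countably many bands
cover the half-line. -/
theorem ae_eq_zero_of_forall_band {f : ℝ → ℂ}
    (hf : ∀ ε > 0, ∀ S, MeasurableSet S → S ⊆ Icc ε ε⁻¹ → IntegrableOn f S ∧ ∫ ξ in S, f ξ = 0) :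
    f =ᵐ[volume.restrict (Ioi (0 : ℝ))] 0 := by
  have h1 : ∀ j : ℕ, f =ᵐ[volume.restrict (Icc ((j : ℝ) + 1)⁻¹ ((j : ℝ) + 1)⁻¹⁻¹)] 0 := by
    intro j
    have hpos : (0 : ℝ) < ((j : ℝ) + 1)⁻¹ := by positivity
    refine Integrable.ae_eq_zero_of_forall_setIntegral_eq_zero
      (hf _ hpos _ measurableSet_Icc subset_rfl).1 fun S hS _ => ?_
    rw [Measure.restrict_restrict hS]
    exact (hf _ hpos _ (hS.inter measurableSet_Icc) inter_subset_right).2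
  have h2 : ∀ᵐ ξ : ℝ, ∀ j : ℕ, ξ ∈ Icc ((j : ℝ) + 1)⁻¹ ((j : ℝ) + 1)⁻¹⁻¹ → f ξ = 0 :=
    ae_all_iff.2 fun j => (ae_restrict_iff' measurableSet_Icc).1 (h1 j)
  refine (ae_restrict_iff' measurableSet_Ioi).2 ?_
  filter_upwards [h2] with ξ hξ h0
  obtain ⟨N, hN⟩ := exists_nat_ge (max ξ ξ⁻¹)
  have hN' : max ξ ξ⁻¹ ≤ (N : ℝ) + 1 := hN.trans (by linarith)
  refine hξ N ⟨inv_le_of_inv_le₀ h0 ((le_max_right _ _).trans hN'), ?_⟩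
  rw [inv_inv]
  exact (le_max_left _ _).trans hN'

theorem memLp_indicator_one {ε : ℝ} {S : Set ℝ} (hS : MeasurableSet S) (hSε : S ⊆ Icc ε ε⁻¹) :
    MemLp (S.indicator fun _ => (1 : ℂ)) 2 (volume.restrict (Ioi (0 : ℝ))) := by
  refine memLp_indicator_const 2 hS 1 (Or.inr ?_)
  refine ((Measure.restrict_apply_le _ _).trans_lt
    ((measure_mono hSε).trans_lt measure_Icc_lt_top)).ne

theorem isNice_indicator_one {ε : ℝ} (hε : 0 < ε) {S : Set ℝ} (hS : MeasurableSet S)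
    (hSε : S ⊆ Icc ε ε⁻¹) : IsNice ((memLp_indicator_one hS hSε).toLp _) := by
  refine ⟨ε, hε, ?_⟩
  filter_upwards [(memLp_indicator_one hS hSε).coeFn_toLp] with ξ h1 h2
  rw [h1, indicator_of_notMem fun h => h2 (hSε h)]

/-- A function is determined by its pairings with the elements of `L_2` supported in bands. -/
theorem ae_eq_of_forall_isNice {f g : ℝ → ℂ}
    (h : ∀ a : HalfLineL2, IsNice a →
      IntegrableOn (fun ξ => (starRingEnd ℂ) ((a : ℝ → ℂ) ξ) * f ξ) (Ioi 0) ∧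
      IntegrableOn (fun ξ => (starRingEnd ℂ) ((a : ℝ → ℂ) ξ) * g ξ) (Ioi 0) ∧
      ∫ ξ in Ioi (0 : ℝ), (starRingEnd ℂ) ((a : ℝ → ℂ) ξ) * f ξ =
        ∫ ξ in Ioi (0 : ℝ), (starRingEnd ℂ) ((a : ℝ → ℂ) ξ) * g ξ) :
    f =ᵐ[volume.restrict (Ioi (0 : ℝ))] g := by
  have hsub : (fun ξ => f ξ - g ξ) =ᵐ[volume.restrict (Ioi (0 : ℝ))] 0 := by
    refine ae_eq_zero_of_forall_band fun ε hε S hS hSε => ?_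
    obtain ⟨h1, h2, h3⟩ := h _ (isNice_indicator_one hε hS hSε)
    have hS0 : S ⊆ Ioi 0 := hSε.trans (Icc_inv_subset_Ioi hε)
    have e : ∀ f : ℝ → ℂ, (fun ξ => (starRingEnd ℂ)
        (((memLp_indicator_one hS hSε).toLp _ : HalfLineL2) ξ) * f ξ)
        =ᵐ[volume.restrict (Ioi (0 : ℝ))] S.indicator f := by
      intro f
      filter_upwards [(memLp_indicator_one hS hSε).coeFn_toLp] with ξ h1
      rw [h1]
      by_cases hξ : ξ ∈ S <;> simp [hξ]
    have i1 : IntegrableOn f S := by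
      have := h1.congr (e f)
      rwa [integrable_indicator_iff hS, IntegrableOn, Measure.restrict_restrict hS,
        inter_eq_left.2 hS0] at this
    have i2 : IntegrableOn g S := by
      have := h2.congr (e g)
      rwa [integrable_indicator_iff hS, IntegrableOn, Measure.restrict_restrict hS,
        inter_eq_left.2 hS0] at this
    refine ⟨i1.sub i2, ?_⟩
    rw [integral_sub i1 i2, sub_eq_zero]
    rw [integral_congr_ae (e f), integral_congr_ae (e g), integral_indicator hS,
      integral_indicator hS, Measure.restrict_restrict hS, inter_eq_left.2 hS0] at h3
    exact h3
  filter_upwards [hsub] with ξ hξ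
  exact sub_eq_zero.1 hξ

end Testing

/-! ### The integral formula for the inverse transform R. -/

section Transform

variable {p : ℕ} {l : ℝ}

instance : SFinite (compMeasure p l) := by
  unfold compMeasure
  infer_instance

/-- The function `|z'^n| e^{-c Im z_p}` on the strip `|Re z_p| ≤ N`. -/
def stripBound (N : ℝ) (n : Fin (p - 1) → ℕ) (c : ℝ) (z : CSpace p) : ℝ :=
  {z : CSpace p | |z.2.re| ≤ N}.indicator (fun z => (∏ k, ‖z.1 k‖ ^ n k) * Real.exp (-c * z.2.im)) z

theorem measurableSet_strip (N : ℝ) : MeasurableSet {z : CSpace p | |z.2.re| ≤ N} :=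
  measurableSet_le (by fun_prop) measurable_const

/-- The modulus of the kernel does not depend on Re z_p, so it is square integrable only after
restriction to a strip. This is why R is defined as a limit. -/
theorem memLp_stripBound (hl : (p : ℝ) < l) (N : ℝ) (n : Fin (p - 1) → ℕ) {c : ℝ} (hc : 0 < c) :
    MemLp (fun z => (stripBound N n c z : ℂ)) 2 (compMeasure p l) := by
  have hmeas : Measurable (stripBound (p := p) N n c) :=
    Measurable.indicator (by fun_prop) (measurableSet_strip N)
  have hmeas' : Measurable fun z : CSpace p => (stripBound N n c z : ℂ) :=
    Complex.measurable_ofReal.comp hmeas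
  rw [memLp_two_iff_integrable_sq_norm hmeas'.aestronglyMeasurable]
  have key : Integrable (fun z => ((stripBound N n c z ^ 2 : ℝ) : ℂ)) (compMeasure p l) := by
    rw [integrable_compMeasure_iff hl, integrableOn_siegelDomain_iff]
    have h1 := (isTame_weightSymbol hl).integrable (fun k => 2 * n k) (c := 2 * c) (by positivity)
    have h2 : Integrable (fun x : ℝ => (Icc (-N) N).indicator (fun _ => (1 : ℝ)) x) :=
      (integrable_indicator_iff measurableSet_Icc).2
        (integrableOn_const (by simp))
    refine (h1.mul_prod h2).mono' ?_ ?_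
    · have := measurable_weight (p := p) (l := l)
      have hm : Measurable fun z : CSpace p => ((stripBound N n c z ^ 2 : ℝ) : ℂ) * (weight p l z : ℂ) := by
        fun_prop
      exact (hm.comp (siegelCoord p).measurable).aestronglyMeasurable
    · refine ae_of_all _ fun w => ?_
      rw [weight_siegelCoord, norm_mul, Complex.norm_real, Real.norm_of_nonneg (by positivity)]
      by_cases hx : |w.2| ≤ N
      · have hx' : w.2 ∈ Icc (-N) N := abs_le.1 hx
        rw [stripBound, indicator_of_mem (by exact hx), indicator_of_mem hx', mul_one, mul_pow,
          ← Finset.prod_pow, ← Real.exp_nat_mul]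
        refine le_of_eq ?_
        have e : ((2 : ℕ) : ℝ) * (-c * (siegelCoord p w).2.im) = -(2 * c) * baseIm w.1 := by
          change ((2 : ℕ) : ℝ) * (-c * baseIm w.1) = _
          push_cast
          ring
        rw [e]
        simp only [← pow_mul, mul_comm (n _) 2]
        rw [mul_right_comm]
        rfl
      · rw [stripBound, indicator_of_notMem (by exact hx)]
        simp only [ne_eq, OfNat.ofNat_ne_zero, not_false_eq_true, zero_pow, zero_mul]
        have : 0 ≤ (Icc (-N) N).indicator (fun _ => (1 : ℝ)) w.2 :=
          indicator_nonneg (fun _ _ => zero_le_one) _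
        positivity
  have := key.norm
  refine this.congr (ae_of_all _ fun z => ?_)
  simp only [Complex.norm_real, norm_pow]

theorem norm_bargmannKernel_le {ε C : ℝ} (n : Fin (p - 1) → ℕ)
    (hC : ∀ ξ ∈ Icc ε ε⁻¹, bargmannFactor p l n ξ ≤ C) {z : CSpace p} (hz : z ∈ siegelDomain p)
    {ξ : ℝ} (hξ : ξ ∈ Icc ε ε⁻¹) :
    ‖bargmannKernel p l n z ξ‖ ≤ C * ((∏ k, ‖z.1 k‖ ^ n k) * Real.exp (-ε * z.2.im)) := by
  have him : 0 < z.2.im := lt_of_lt_of_le hz (siegelHeight_le_im z)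
  rw [bargmannKernel, norm_mul, norm_mul, Complex.norm_real,
    Real.norm_of_nonneg (bargmannFactor_nonneg n ξ), norm_prod, Complex.norm_exp, mul_assoc]
  have e : (Complex.I * ξ * z.2).re = -ξ * z.2.im := by
    simp [Complex.mul_re, Complex.mul_im]
  rw [e]
  simp only [norm_pow]
  have h0 := (bargmannFactor_nonneg (l := l) n ξ).trans (hC ξ hξ)
  refine mul_le_mul (hC ξ hξ) ?_ (by positivity) h0
  refine mul_le_mul_of_nonneg_left (Real.exp_le_exp.2 ?_) (by positivity)
  nlinarith [hξ.1]

/-- The restriction of a function to the strip `|Re z_p| ≤ N`. -/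
def stripTrunc (f : CSpace p → ℂ) (N : ℝ) : CSpace p → ℂ := {z : CSpace p | |z.2.re| ≤ N}.indicator f

theorem integrable_kernel_stripTrunc (hl : (p : ℝ) < l) {f : CSpace p → ℂ}
    (hf : MemLp f 2 (compMeasure p l)) (N : ℝ) (n : Fin (p - 1) → ℕ) {ξ : ℝ} (hξ : 0 < ξ) :
    Integrable (fun z => (starRingEnd ℂ) (bargmannKernel p l n z ξ) * stripTrunc f N z)
      (compMeasure p l) := by
  have h := (memLp_stripBound hl N n hξ).norm.integrable_mul hf.norm
  refine ((h.const_mul (bargmannFactor p l n ξ))).mono' ?_ (ae_of_all _ fun z => ?_)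
  · refine AEStronglyMeasurable.mul ?_ (hf.1.indicator (measurableSet_strip N))
    have := (measurable_bargmannKernel (p := p) (l := l) n).comp
      (measurable_id.prodMk (measurable_const (a := ξ)))
    exact (Complex.continuous_conj.measurable.comp this).aestronglyMeasurable
  · by_cases hz : z ∈ {z : CSpace p | |z.2.re| ≤ N}
    · rw [stripTrunc, indicator_of_mem hz, Pi.mul_apply, stripBound, indicator_of_mem hz, norm_mul,
        RCLike.norm_conj, bargmannKernel, norm_mul, norm_mul, Complex.norm_real,
        Real.norm_of_nonneg (bargmannFactor_nonneg n ξ), norm_prod, Complex.norm_exp,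
        Complex.norm_real, Real.norm_of_nonneg (by positivity)]
      have e : (Complex.I * ξ * z.2).re = -ξ * z.2.im := by
        simp [Complex.mul_re, Complex.mul_im]
      rw [e]
      simp only [norm_pow]
      exact le_of_eq (by ring)
    · rw [stripTrunc, indicator_of_notMem hz, mul_zero, norm_zero]
      have := bargmannFactor_nonneg (p := p) (l := l) n ξ
      simp only [Pi.mul_apply]
      positivity

/-- For ξ in the band of a, one function of z dominates the kernel on the strip, so the integrand is
bounded by a product of functions of z and of ξ. -/
theorem integrable_prod_kernel (hl : (p : ℝ) < l) {f : CSpace p → ℂ}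
    (hf : MemLp f 2 (compMeasure p l)) (N : ℝ) (n : Fin (p - 1) → ℕ) {a : HalfLineL2}
    (ha : IsNice a) :
    Integrable (fun x : CSpace p × ℝ => (starRingEnd ℂ) ((a : ℝ → ℂ) x.2) *
      ((starRingEnd ℂ) (bargmannKernel p l n x.1 x.2) * stripTrunc f N x.1))
      ((compMeasure p l).prod (volume.restrict (Ioi 0))) := by
  obtain ⟨ε, hε, ha⟩ := ha
  obtain ⟨C, hC⟩ := exists_bargmannFactor_le (p := p) (l := l) hε n
  have h1 : Integrable (fun ξ => ‖(a : ℝ → ℂ) ξ‖) (volume.restrict (Ioi 0)) := by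
    have h2 : IntegrableOn (a : ℝ → ℂ) (Icc ε ε⁻¹) := by
      have := (Lp.memLp a).mono_measure (Measure.restrict_mono_set volume (Icc_inv_subset_Ioi hε))
      exact this.integrable (by norm_num)
    have h3 : Integrable ((Icc ε ε⁻¹).indicator (a : ℝ → ℂ)) (volume.restrict (Ioi 0)) :=
      ((integrable_indicator_iff measurableSet_Icc).2 h2).restrict
    refine (h3.congr ?_).norm
    filter_upwards [ha] with ξ hξ
    by_cases h : ξ ∈ Icc ε ε⁻¹
    · rw [indicator_of_mem h]
    · rw [indicator_of_notMem h, hξ h]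
  have h4 := (memLp_stripBound hl N n hε).norm.integrable_mul hf.norm
  refine ((h4.mul_prod h1).const_mul C).mono' ?_ ?_
  · refine AEStronglyMeasurable.mul ?_ (AEStronglyMeasurable.mul ?_ ?_)
    · exact (Complex.continuous_conj.comp_aestronglyMeasurable (Lp.memLp a).1).comp_snd
    · exact (Complex.continuous_conj.measurable.comp
        (measurable_bargmannKernel n)).aestronglyMeasurable
    · exact (hf.1.indicator (measurableSet_strip N)).comp_fst
  · have h5 : ∀ᵐ x ∂((compMeasure p l).prod (volume.restrict (Ioi (0 : ℝ)))),
        x.2 ∉ Icc ε ε⁻¹ → (a : ℝ → ℂ) x.2 = 0 := Measure.quasiMeasurePreserving_snd.ae ha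
    have h6 : ∀ᵐ x ∂((compMeasure p l).prod (volume.restrict (Ioi (0 : ℝ)))),
        x.1 ∈ siegelDomain p := by
      refine Measure.quasiMeasurePreserving_fst.ae (p := fun z => z ∈ siegelDomain p) ?_
      exact (withDensity_absolutelyContinuous _ _).ae_le
        (ae_restrict_mem (measurableSet_siegelDomain p))
    filter_upwards [h5, h6] with x hx hxU
    by_cases hξ : x.2 ∈ Icc ε ε⁻¹
    · by_cases hz : x.1 ∈ {z : CSpace p | |z.2.re| ≤ N}
      · rw [stripTrunc, indicator_of_mem hz, Pi.mul_apply, stripBound, indicator_of_mem hz, norm_mul,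
          norm_mul, RCLike.norm_conj, RCLike.norm_conj, Complex.norm_real,
          Real.norm_of_nonneg (by positivity)]
        have := norm_bargmannKernel_le n hC hxU hξ
        calc _ ≤ ‖(a : ℝ → ℂ) x.2‖ * (C * ((∏ k, ‖x.1.1 k‖ ^ n k) * Real.exp (-ε * x.1.2.im)) *
              ‖f x.1‖) := by gcongr
          _ = _ := by ring
      · rw [stripTrunc, indicator_of_notMem hz, Pi.mul_apply, stripBound, indicator_of_notMem hz]
        simp
    · rw [hx hξ]
      simp only [map_zero, zero_mul, norm_zero, Pi.mul_apply]
      simp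

/-- The truncated inverse transform. -/
def compTrunc (l : ℝ) (f : CSpace p → ℂ) (N : ℝ) (n : Fin (p - 1) → ℕ) (ξ : ℝ) : ℂ :=
  ∫ z, (starRingEnd ℂ) (bargmannKernel p l n z ξ) * stripTrunc f N z ∂(compMeasure p l)

/-- Against a band-limited test function Fubini is justified, and it identifies the coordinates of
T^* with the truncated integrals. -/
theorem adjoint_stripTrunc_ae (hp : 1 ≤ p) (hl : (p : ℝ) < l) {f : CSpace p → ℂ}
    (hf : MemLp f 2 (compMeasure p l)) (N : ℝ) (hfN : MemLp (stripTrunc f N) 2 (compMeasure p l))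
    (n : Fin (p - 1) → ℕ) :
    (ContinuousLinearMap.adjoint (compIso hp hl).toContinuousLinearMap (hfN.toLp _) n : ℝ → ℂ)
      =ᵐ[volume.restrict (Ioi (0 : ℝ))] compTrunc l f N n := by
  have hl0 := pos_of_natCast_lt hl
  set c := ContinuousLinearMap.adjoint (compIso hp hl).toContinuousLinearMap (hfN.toLp _) with hc
  refine ae_eq_of_forall_isNice fun a ha => ?_
  have hprod := integrable_prod_kernel hl hf N n ha
  refine ⟨(memLp_conj (Lp.memLp a)).integrable_mul (Lp.memLp (c n)), ?_, ?_⟩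
  · refine hprod.integral_prod_right.congr (ae_of_all _ fun ξ => ?_)
    simp only
    rw [integral_const_mul]
    rfl
  · have e1 : ∫ ξ in Ioi (0 : ℝ), (starRingEnd ℂ) ((a : ℝ → ℂ) ξ) * (c n : ℝ → ℂ) ξ =
        inner ℂ (lp.single 2 n a : CompSpace p) c := by
      rw [lp.inner_single_left, L2.inner_def]
      refine integral_congr_ae (ae_of_all _ fun ξ => ?_)
      simp only [RCLike.inner_apply, mul_comm]
    rw [e1, hc, ContinuousLinearMap.adjoint_inner_right]
    change inner ℂ (compIso hp hl (lp.single 2 n a)) _ = _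
    rw [compIso_apply, inner_toLp_toLp]
    have e2 : ∀ z ∈ siegelDomain p, compAdj l (lp.single 2 n a) z =
        ∫ ξ in Ioi (0 : ℝ), (a : ℝ → ℂ) ξ * bargmannKernel p l n z ξ := by
      intro z hz
      rw [compAdj_eq_inner hl0 hz, lp.inner_single_right, inner_kernelVec_apply]
      refine integral_congr_ae (ae_of_all _ fun ξ => ?_)
      simp only [bargmannKernel]
      ring
    have e3 : ∫ z, (starRingEnd ℂ) (compAdj l (lp.single 2 n a) z) * stripTrunc f N z
        ∂(compMeasure p l) = ∫ z, (∫ ξ in Ioi (0 : ℝ), (starRingEnd ℂ) ((a : ℝ → ℂ) ξ) *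
          ((starRingEnd ℂ) (bargmannKernel p l n z ξ) * stripTrunc f N z)) ∂(compMeasure p l) := by
      refine integral_congr_ae ?_
      have h6 : ∀ᵐ z ∂(compMeasure p l), z ∈ siegelDomain p :=
        (withDensity_absolutelyContinuous _ _).ae_le
          (ae_restrict_mem (measurableSet_siegelDomain p))
      filter_upwards [h6] with z hz
      rw [e2 z hz, ← integral_conj, ← integral_mul_const]
      refine integral_congr_ae (ae_of_all _ fun ξ => ?_)
      simp only [map_mul]
      ring
    rw [e3, integral_integral_swap hprod]
    refine integral_congr_ae (ae_of_all _ fun ξ => ?_)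
    simp only
    rw [integral_const_mul]
    rfl

theorem memLp_stripTrunc {f : CSpace p → ℂ} (hf : MemLp f 2 (compMeasure p l)) (N : ℝ) :
    MemLp (stripTrunc f N) 2 (compMeasure p l) := hf.indicator (measurableSet_strip N)

theorem tendsto_stripTrunc {f : CSpace p → ℂ} (hf : MemLp f 2 (compMeasure p l)) :
    Tendsto (fun N : ℝ => ‖(memLp_stripTrunc hf N).toLp _ - hf.toLp f‖) atTop (𝓝 0) := by
  have e : ∀ N : ℝ, ‖(memLp_stripTrunc hf N).toLp _ - hf.toLp f‖ ^ 2 =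
      ∫ z, ‖stripTrunc f N z - f z‖ ^ 2 ∂(compMeasure p l) := by
    intro N
    rw [← MemLp.toLp_sub, norm_toLp_sq]
    rfl
  have h2 : Tendsto (fun N : ℝ => ‖(memLp_stripTrunc hf N).toLp _ - hf.toLp f‖ ^ 2) atTop (𝓝 0) := by
    simp only [e]
    have hi : Integrable (fun z => ‖f z‖ ^ 2) (compMeasure p l) :=
      (memLp_two_iff_integrable_sq_norm hf.1).1 hf
    have := tendsto_integral_filter_of_dominated_convergence (μ := compMeasure p l) (l := atTop)
      (F := fun (N : ℝ) z => ‖stripTrunc f N z - f z‖ ^ 2)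
      (f := fun _ => (0 : ℝ)) (fun z => ‖f z‖ ^ 2)
      (Eventually.of_forall fun N => ?_) (Eventually.of_forall fun N => ?_) hi ?_
    · simpa using this
    · exact ((memLp_stripTrunc hf N).sub hf).1.norm.pow 2
    · refine ae_of_all _ fun z => ?_
      rw [Real.norm_of_nonneg (by positivity)]
      by_cases hz : z ∈ {z : CSpace p | |z.2.re| ≤ N}
      · rw [stripTrunc, indicator_of_mem hz]; simp
      · rw [stripTrunc, indicator_of_notMem hz]; simp
    · refine ae_of_all _ fun z => tendsto_const_nhds.congr' ?_
      filter_upwards [eventually_ge_atTop |z.2.re|] with N hN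
      rw [stripTrunc, indicator_of_mem (by exact hN)]
      simp
  have h3 := (Real.continuous_sqrt.tendsto 0).comp h2
  simpa [Function.comp_def, Real.sqrt_sq] using h3

/-- Here T^*T = 1 and ‖T^*‖ ≤ 1, while the strip truncations of Tb converge to Tb in L². -/
theorem tendsto_compTrunc (hp : 1 ≤ p) (hl : (p : ℝ) < l) (b : CompSpace p) (n : Fin (p - 1) → ℕ) :
    Tendsto (fun N : ℝ => eLpNorm (fun ξ => compTrunc l (compAdj l b) N n ξ - (b n : ℝ → ℂ) ξ) 2
      (volume.restrict (Ioi (0 : ℝ)))) atTop (𝓝 0) := by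
  have hf := memLp_compAdj hp hl b
  set T := (compIso hp hl).toContinuousLinearMap with hT
  have hTb : ContinuousLinearMap.adjoint T (hf.toLp _) = b := by
    refine ext_inner_left ℂ fun a => ?_
    rw [ContinuousLinearMap.adjoint_inner_right]
    exact (compIso hp hl).inner_map_map a b
  have hbound : ∀ N : ℝ,
      eLpNorm (fun ξ => compTrunc l (compAdj l b) N n ξ - (b n : ℝ → ℂ) ξ) 2
      (volume.restrict (Ioi (0 : ℝ))) ≤
      ENNReal.ofReal ‖(memLp_stripTrunc hf N).toLp _ - hf.toLp _‖ := by
    intro N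
    set c := ContinuousLinearMap.adjoint T ((memLp_stripTrunc hf N).toLp _) with hc
    have h1 : (fun ξ => compTrunc l (compAdj l b) N n ξ - (b n : ℝ → ℂ) ξ)
        =ᵐ[volume.restrict (Ioi (0 : ℝ))] ((c n - b n : HalfLineL2) : ℝ → ℂ) := by
      filter_upwards [adjoint_stripTrunc_ae hp hl hf N (memLp_stripTrunc hf N) n,
        Lp.coeFn_sub (c n) (b n)] with ξ e1 e2
      rw [e2, Pi.sub_apply, ← e1]
    rw [eLpNorm_congr_ae h1, ← Lp.enorm_def, ← ofReal_norm]
    refine ENNReal.ofReal_le_ofReal ?_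
    calc ‖c n - b n‖ = ‖(c - b) n‖ := rfl
      _ ≤ ‖c - b‖ := lp.norm_apply_le_norm (by norm_num) _ n
      _ = ‖ContinuousLinearMap.adjoint T ((memLp_stripTrunc hf N).toLp _ - hf.toLp _)‖ := by
        rw [map_sub, hTb]
      _ ≤ ‖ContinuousLinearMap.adjoint T‖ * ‖(memLp_stripTrunc hf N).toLp _ - hf.toLp _‖ :=
        ContinuousLinearMap.le_opNorm _ _
      _ ≤ 1 * ‖(memLp_stripTrunc hf N).toLp _ - hf.toLp _‖ := by
        gcongr
        rw [LinearIsometryEquiv.norm_map]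
        exact (compIso hp hl).norm_toContinuousLinearMap_le
      _ = _ := one_mul _
  refine tendsto_of_tendsto_of_tendsto_of_le_of_le tendsto_const_nhds ?_ (fun _ => zero_le) hbound
  have := ENNReal.tendsto_ofReal (tendsto_stripTrunc hf)
  simpa using this

theorem isBargmannTransform_bargmannAdj {q : ℕ} (hp : 1 ≤ p) {ν : ℝ} (hν : (p : ℝ) < ν)
    (b : SeqSpace p q) : IsBargmannTransform ν (bargmannAdj ν b) b := by
  intro M n
  have hl : (p : ℝ) < ν + M.card := by
    have : (0 : ℝ) ≤ M.card := by positivity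
    linarith
  have hf := memLp_compAdj hp hl (b M)
  have hk : ∀ ξ z, (bargmannFactor p (ν + M.card) n ξ : ℂ) *
      bargmannIntegrand ν (bargmannAdj ν b) M n ξ z =
      (starRingEnd ℂ) (bargmannKernel p (ν + M.card) n z ξ) * compAdj (ν + M.card) (b M) z *
        (weight p (ν + M.card) z : ℂ) := by
    intro ξ z
    rw [bargmannIntegrand, bargmannKernel, bargmannAdj_eq_compAdj, weight, weightConst]
    simp only [map_mul, map_prod, map_pow, Complex.conj_ofReal, ← Complex.exp_conj, Complex.conj_I]
    rw [show -Complex.I * (ξ : ℂ) * (starRingEnd ℂ) z.2 = -(Complex.I * ξ * (starRingEnd ℂ) z.2) by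
      ring]
    ring
  have hind : ∀ N ξ, (fun z => (starRingEnd ℂ) (bargmannKernel p (ν + M.card) n z ξ) *
      stripTrunc (compAdj (ν + M.card) (b M)) N z * (weight p (ν + M.card) z : ℂ)) =
      {z : CSpace p | |z.2.re| ≤ N}.indicator fun z => (bargmannFactor p (ν + M.card) n ξ : ℂ) *
        bargmannIntegrand ν (bargmannAdj ν b) M n ξ z := by
    intro N ξ
    ext z
    by_cases hz : z ∈ {z : CSpace p | |z.2.re| ≤ N}
    · rw [stripTrunc, indicator_of_mem hz, indicator_of_mem hz, hk]
    · rw [stripTrunc, indicator_of_notMem hz, indicator_of_notMem hz]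
      simp
  have hl0 : 0 < ν + M.card := pos_of_natCast_lt hl
  refine ⟨fun N ξ hξ => ?_, ?_⟩
  · have h := integrable_kernel_stripTrunc hl hf N n hξ
    rw [integrable_compMeasure_iff hl, hind, IntegrableOn,
      integrable_indicator_iff (measurableSet_strip N), IntegrableOn,
      Measure.restrict_restrict (measurableSet_strip N), inter_comm] at h
    -- The factor k_n(ξ) is positive for ξ > 0, so integrability passes from the kernel to the
    -- integrand without it.
    have hne : (bargmannFactor p (ν + M.card) n ξ : ℂ) ≠ 0 := by
      intro h0
      have h1 := bargmannFactor_sq (p := p) hl0 n hξ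
      rw [Complex.ofReal_eq_zero.1 h0] at h1
      have := Real.Gamma_pos_of_pos hl0
      have : 0 < (0 : ℝ) ^ 2 := by
        rw [h1]
        positivity
      simp at this
    refine (h.const_mul (bargmannFactor p (ν + M.card) n ξ : ℂ)⁻¹).congr (ae_of_all _ fun z => ?_)
    simp only
    rw [inv_mul_cancel_left₀ hne]
  · refine (tendsto_compTrunc hp hl (b M) n).congr fun N => ?_
    congr 1
    ext ξ
    congr 1
    rw [compTrunc, integral_compMeasure hl, hind, integral_indicator (measurableSet_strip N),
      Measure.restrict_restrict (measurableSet_strip N), inter_comm, integral_const_mul]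
    rfl

end Transform

/-! ### Toeplitz forms on one component and their multipliers. -/

section ComponentToeplitz

variable {p : ℕ} {l : ℝ}

/-- Rotation invariant measurable functions of `(z', v)` bounded by `C (v^(l-p-1) + v^β)` with
`β ≥ l-p-1`. -/
structure IsBergmanSymbol (l : ℝ) (s : SiegelBase p → ℂ) : Prop where
  measurable : Measurable s
  rotation : IsRotationInvariant s
  bound : ∃ C β : ℝ, 0 ≤ C ∧ l - p - 1 ≤ β ∧
    ∀ w : SiegelBase p, 0 < w.2 → ‖s w‖ ≤ C * (w.2 ^ (l - p - 1) + w.2 ^ β)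

/-- The function on the Siegel domain given by `s(z', ρ(z))`. -/
def liftSymbol (s : SiegelBase p → ℂ) (z : CSpace p) : ℂ := s (z.1, siegelHeight z)

theorem liftSymbol_siegelCoord (s : SiegelBase p → ℂ) (w : SiegelBase p) (x : ℝ) :
    liftSymbol s (siegelCoord p (w, x)) = s w := by
  rw [liftSymbol, siegelHeight_siegelCoord]
  rfl

theorem measurable_liftSymbol {s : SiegelBase p → ℂ} (hs : Measurable s) :
    Measurable (liftSymbol s) :=
  hs.comp (measurable_fst.prodMk measurable_siegelHeight)

theorem IsBergmanSymbol.isTame (hl : (p : ℝ) < l) {s : SiegelBase p → ℂ}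
    (hs : IsBergmanSymbol l s) : IsTame s := by
  obtain ⟨C, β, _, hβ, hb⟩ := hs.bound
  exact ⟨hs.measurable, C, l - p - 1, β, by linarith, by linarith, hb⟩

theorem IsBergmanSymbol.conj {s : SiegelBase p → ℂ} (hs : IsBergmanSymbol l s) :
    IsBergmanSymbol l (fun w => (starRingEnd ℂ) (s w)) := by
  obtain ⟨C, β, hC, hβ, hb⟩ := hs.bound
  refine ⟨Complex.continuous_conj.measurable.comp hs.measurable, fun t w hw => ?_, C, β, hC, hβ,
    fun w hw => ?_⟩
  · simp only [hs.rotation t w hw]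
  · rw [RCLike.norm_conj]
    exact hb w hw

/-- The symbol `|s|² / w_l`. -/
def ratioSymbol (l : ℝ) (s : SiegelBase p → ℂ) (w : SiegelBase p) : ℂ :=
  ((‖s w‖ ^ 2 : ℝ) : ℂ) / weightSymbol p l w

/-- With α = l - p - 1 ≤ β, the square of v^α + v^β divided by v^α is of order v^α + v^(2β-α), and
both exponents exceed -1. -/
theorem IsBergmanSymbol.isTame_ratioSymbol (hl : (p : ℝ) < l) {s : SiegelBase p → ℂ}
    (hs : IsBergmanSymbol l s) : IsTame (ratioSymbol l s) := by
  obtain ⟨C, β, hC, hβ, hb⟩ := hs.bound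
  have hc := weightConst_pos hl
  refine ⟨?_, 2 * C ^ 2 / weightConst p l, l - p - 1, 2 * β - (l - p - 1), by linarith, by linarith,
    fun w hw => ?_⟩
  · have := hs.measurable
    have := (isTame_weightSymbol hl).measurable
    unfold ratioSymbol
    fun_prop
  · have h1 := Real.rpow_pos_of_pos hw (l - p - 1)
    have h2 := Real.rpow_pos_of_pos hw β
    have e : w.2 ^ (2 * β - (l - p - 1)) = (w.2 ^ β) ^ 2 / w.2 ^ (l - p - 1) := by
      rw [Real.rpow_sub hw, mul_comm 2 β, Real.rpow_mul hw.le]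
      norm_num
    rw [ratioSymbol, norm_div, Complex.norm_real, Real.norm_of_nonneg (by positivity), weightSymbol,
      Complex.norm_real, Real.norm_of_nonneg (by positivity), e]
    set α := l - p - 1
    have h3 : ‖s w‖ ^ 2 ≤ 2 * C ^ 2 * ((w.2 ^ α) ^ 2 + (w.2 ^ β) ^ 2) := by
      calc ‖s w‖ ^ 2 ≤ (C * (w.2 ^ α + w.2 ^ β)) ^ 2 := by
            gcongr
            exact hb w hw
        _ ≤ _ := by
            rw [mul_pow]
            nlinarith [mul_nonneg (sq_nonneg C) (sq_nonneg (w.2 ^ α - w.2 ^ β))]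
    calc _ ≤ 2 * C ^ 2 * ((w.2 ^ α) ^ 2 + (w.2 ^ β) ^ 2) / (weightConst p l * w.2 ^ α) := by gcongr
      _ = _ := by field_simp

theorem IsBergmanSymbol.isRotationInvariant_ratioSymbol {s : SiegelBase p → ℂ}
    (hs : IsBergmanSymbol l s) : IsRotationInvariant (ratioSymbol l s) := by
  intro t w hw
  simp only [ratioSymbol, hs.rotation t w hw, weightSymbol]

/-- The exponential decreases in ξ, so the integral at ξ = ε dominates all later ones. -/
theorem norm_orthantIntegral_le {s : SiegelBase p → ℂ} (hs : IsTame s) (n : Fin (p - 1) → ℕ) {ε : ℝ}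
    (hε : 0 < ε) : ∃ C, ∀ ξ, ε ≤ ξ → ‖orthantIntegral s n ξ‖ ≤ C := by
  obtain ⟨C, α, β, hα, hβ, hb⟩ := hs.bound
  have hn : ∀ k, (-1 : ℝ) < n k := fun k => by
    have : (0 : ℝ) ≤ n k := Nat.cast_nonneg _
    linarith
  have hi := ((integrableOn_orthantGamma (p := p) (c := 2 * ε) hn hα (by positivity)).add
    (integrableOn_orthantGamma (p := p) (c := 2 * ε) hn hβ (by positivity))).const_mul C
  refine ⟨_, fun ξ hξ => norm_integral_le_of_norm_le hi ?_⟩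
  refine (ae_restrict_iff' ?_).2 (ae_of_all _ fun x hx => ?_)
  · exact measurableSet_posOrthant p
  · obtain ⟨hx1, hx2⟩ := hx
    have hp1 : 0 ≤ ∏ k, x.1 k ^ n k := Finset.prod_nonneg fun k _ => pow_nonneg (hx1 k).le _
    have hsum : 0 ≤ x.2 + ∑ k, x.1 k := add_nonneg hx2.le (Finset.sum_nonneg fun k _ => (hx1 k).le)
    have hbx := hb (fun k => (Real.sqrt (x.1 k) : ℂ), x.2) hx2
    rw [norm_mul, Complex.norm_real, Real.norm_of_nonneg (by positivity)]
    have h0 := (norm_nonneg _).trans hbx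
    calc _ ≤ C * (x.2 ^ α + x.2 ^ β) *
          ((∏ k, x.1 k ^ n k) * Real.exp (-2 * ε * (x.2 + ∑ k, x.1 k))) := by
          refine mul_le_mul hbx ?_ (by positivity) h0
          refine mul_le_mul_of_nonneg_left (Real.exp_le_exp.2 ?_) hp1
          nlinarith
      _ = _ := by
          simp only [Pi.add_apply, orthantGamma, Real.rpow_natCast]
          ring_nf

theorem exists_norm_specGamma_le {s : SiegelBase p → ℂ} (hs : IsTame s) {ε : ℝ} (hε : 0 < ε)
    (n : Fin (p - 1) → ℕ) : ∃ C, ∀ ξ ∈ Icc ε ε⁻¹, ‖specGamma l s n ξ‖ ≤ C := by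
  obtain ⟨C₁, h1⟩ := norm_orthantIntegral_le hs n hε
  obtain ⟨C₂, h2⟩ := exists_bargmannFactor_le (p := p) (l := l) hε n
  refine ⟨2 * Real.pi * Real.pi ^ (p - 1) * C₂ ^ 2 * C₁, fun ξ hξ => ?_⟩
  rw [specGamma, norm_mul, Complex.norm_real, Real.norm_of_nonneg (by positivity)]
  have := bargmannFactor_nonneg (p := p) (l := l) n ξ
  gcongr
  · exact h2 ξ hξ
  · exact h1 ξ hξ.1

theorem measurable_specGamma {s : SiegelBase p → ℂ} (hs : Measurable s) (n : Fin (p - 1) → ℕ) :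
    Measurable (specGamma l s n) := by
  refine Measurable.mul ?_ ?_
  · have := measurable_bargmannFactor (p := p) (l := l) n
    fun_prop
  · exact (measurable_orthantIntegrand hs n).stronglyMeasurable.integral_prod_right.measurable

theorem specGamma_conj (s : SiegelBase p → ℂ) (n : Fin (p - 1) → ℕ) (ξ : ℝ) :
    specGamma l (fun w => (starRingEnd ℂ) (s w)) n ξ = (starRingEnd ℂ) (specGamma l s n ξ) := by
  rw [specGamma, specGamma, map_mul, Complex.conj_ofReal, orthantIntegral, orthantIntegral,
    ← integral_conj]
  simp only [map_mul, Complex.conj_ofReal]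

theorem memLp_specGamma_mul {s : SiegelBase p → ℂ} (hs : IsTame s) (n : Fin (p - 1) → ℕ)
    {f : HalfLineL2} (hf : IsNice f) :
    MemLp (fun ξ => specGamma l s n ξ * (f : ℝ → ℂ) ξ) 2 (volume.restrict (Ioi (0 : ℝ))) := by
  obtain ⟨ε, hε, hf⟩ := hf
  obtain ⟨C, hC⟩ := exists_norm_specGamma_le (l := l) hs hε n
  refine MemLp.of_le_mul (c := C) (Lp.memLp f)
    ((measurable_specGamma hs.measurable n).aestronglyMeasurable.mul (Lp.memLp f).1) ?_
  filter_upwards [hf] with ξ h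
  by_cases hξ : ξ ∈ Icc ε ε⁻¹
  · rw [norm_mul]
    exact mul_le_mul_of_nonneg_right (hC ξ hξ) (norm_nonneg _)
  · simp [h hξ]

/-- The function `σ T_l b / w_l`. -/
def symbolQuot (l : ℝ) (s : SiegelBase p → ℂ) (b : CompSpace p) (z : CSpace p) : ℂ :=
  liftSymbol s z * compAdj l b z / (weight p l z : ℂ)

/-- `c` represents the form `a ↦ ∫ conj (T_l a) T_l b σ` with `σ` given by `s`. -/
def IsCompToeplitz (l : ℝ) (s : SiegelBase p → ℂ) (b c : CompSpace p) : Prop :=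
  ∀ a : CompSpace p, IntegrableOn (fun z => (starRingEnd ℂ) (compAdj l a z) * compAdj l b z *
      liftSymbol s z) (siegelDomain p) ∧
    ∫ z in siegelDomain p, (starRingEnd ℂ) (compAdj l a z) * compAdj l b z * liftSymbol s z =
      inner ℂ a c

/-- When σTb/w is in L², the form is the L² pairing of Ta with it, and the adjoint T^* plays the
role of the Bergman projection. -/
theorem isCompToeplitz_adjoint (hp : 1 ≤ p) (hl : (p : ℝ) < l) {s : SiegelBase p → ℂ}
    {b : CompSpace p} (hG : MemLp (symbolQuot l s b) 2 (compMeasure p l)) :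
    IsCompToeplitz l s b
      (ContinuousLinearMap.adjoint (compIso hp hl).toContinuousLinearMap (hG.toLp _)) := by
  intro a
  have ha := memLp_compAdj hp hl a
  have e : EqOn (fun z => (starRingEnd ℂ) (compAdj l a z) * symbolQuot l s b z * (weight p l z : ℂ))
      (fun z => (starRingEnd ℂ) (compAdj l a z) * compAdj l b z * liftSymbol s z)
      (siegelDomain p) := by
    intro z hz
    have : (weight p l z : ℂ) ≠ 0 := Complex.ofReal_ne_zero.2 (weight_pos hl hz).ne'
    simp only [symbolQuot]
    field_simp
  constructor
  · rw [← integrableOn_congr_fun e (measurableSet_siegelDomain p), ← integrable_compMeasure_iff hl]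
    exact (memLp_conj ha).integrable_mul hG
  · rw [← setIntegral_congr_fun (measurableSet_siegelDomain p) e, ← integral_compMeasure hl,
      ContinuousLinearMap.adjoint_inner_right]
    exact (inner_toLp_toLp ha hG).symm

theorem IsCompToeplitz.add (hl : 0 < l) {s : SiegelBase p → ℂ} {b c b' c' : CompSpace p}
    (h : IsCompToeplitz l s b c) (h' : IsCompToeplitz l s b' c') :
    IsCompToeplitz l s (b + b') (c + c') := by
  intro a
  have e : (fun z => (starRingEnd ℂ) (compAdj l a z) * compAdj l (b + b') z * liftSymbol s z) =
      fun z => (starRingEnd ℂ) (compAdj l a z) * compAdj l b z * liftSymbol s z +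
        (starRingEnd ℂ) (compAdj l a z) * compAdj l b' z * liftSymbol s z := by
    ext z
    rw [compAdj_add hl, Pi.add_apply]
    ring
  rw [e]
  refine ⟨(h a).1.add (h' a).1, ?_⟩
  rw [integral_add (h a).1 (h' a).1, (h a).2, (h' a).2, inner_add_right]

theorem isCompToeplitz_zero (hl : 0 < l) (s : SiegelBase p → ℂ) : IsCompToeplitz l s 0 0 := by
  intro a
  have h0 : compAdj l (0 : CompSpace p) = 0 := by
    simpa using compAdj_smul hl (0 : ℂ) (0 : CompSpace p)
  simp [h0]

/-- The squared norm of σTf/w is the diagonal form of Tf with symbol |s|²/w, which converges by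
`core_single`. -/
theorem memLp_symbolQuot_single (hp : 1 ≤ p) (hl : (p : ℝ) < l) {s : SiegelBase p → ℂ}
    (hs : IsBergmanSymbol l s) (n : Fin (p - 1) → ℕ) {f : HalfLineL2} (hf : IsNice f) :
    MemLp (symbolQuot l s (lp.single 2 n f)) 2 (compMeasure p l) := by
  have hl0 := pos_of_natCast_lt hl
  have hT := memLp_compAdj hp hl (lp.single 2 n f : CompSpace p)
  have hmeas : AEStronglyMeasurable (symbolQuot l s (lp.single 2 n f)) (compMeasure p l) := by
    have h1 := measurable_compAdj hl0 (lp.single 2 n f : CompSpace p)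
    have h2 := measurable_liftSymbol hs.measurable
    have h3 := measurable_weight (p := p) (l := l)
    unfold symbolQuot
    exact ((h2.mul h1).div (Complex.measurable_ofReal.comp h3)).aestronglyMeasurable
  rw [memLp_two_iff_integrable_sq_norm hmeas]
  have h := (core_single hl0 (hs.isTame_ratioSymbol hl) hs.isRotationInvariant_ratioSymbol
    (fun w x _ => liftSymbol_siegelCoord _ w x) n n hf hf).1
  have key : Integrable (fun z => ((‖symbolQuot l s (lp.single 2 n f) z‖ ^ 2 : ℝ) : ℂ))
      (compMeasure p l) := by
    rw [integrable_compMeasure_iff hl]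
    refine h.congr_fun (fun z hz => ?_) (measurableSet_siegelDomain p)
    have hw := weight_pos hl hz
    have hw' : (weight p l z : ℂ) ≠ 0 := Complex.ofReal_ne_zero.2 hw.ne'
    simp only
    rw [Complex.conj_mul', liftSymbol, ratioSymbol]
    change _ * (_ / (weight p l z : ℂ)) = _
    rw [symbolQuot, norm_div, norm_mul, Complex.norm_real, Real.norm_of_nonneg hw.le, liftSymbol]
    push_cast
    field_simp
  refine key.norm.congr (ae_of_all _ fun z => ?_)
  simp only [Complex.norm_real, norm_pow, norm_norm]

/-- Domain membership comes from the projection; `core_single` then identifies its coordinates by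
testing. -/
theorem exists_isCompToeplitz_single (hp : 1 ≤ p) (hl : (p : ℝ) < l) {s : SiegelBase p → ℂ}
    (hs : IsBergmanSymbol l s) (n : Fin (p - 1) → ℕ) {f : HalfLineL2} (hf : IsNice f) :
    IsCompToeplitz l s (lp.single 2 n f)
      (lp.single 2 n ((memLp_specGamma_mul (l := l) (hs.isTame hl) n hf).toLp _)) := by
  have hl0 := pos_of_natCast_lt hl
  have hG := isCompToeplitz_adjoint hp hl (memLp_symbolQuot_single hp hl hs n hf)
  set c := ContinuousLinearMap.adjoint (compIso hp hl).toContinuousLinearMap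
    ((memLp_symbolQuot_single hp hl hs n hf).toLp _) with hc
  set g : HalfLineL2 := (memLp_specGamma_mul (l := l) (hs.isTame hl) n hf).toLp _ with hg
  have hcore := fun m (a : HalfLineL2) (ha : IsNice a) =>
    (core_single hl0 (hs.isTame hl) hs.rotation
      (fun w x _ => liftSymbol_siegelCoord _ w x) m n ha hf).2
  suffices c = lp.single 2 n g by rwa [← this]
  suffices hm : ∀ m, (c m : HalfLineL2) = (lp.single 2 n g : CompSpace p) m from
    lp.ext (funext hm)
  intro m
  refine Lp.ext (ae_eq_of_forall_isNice fun a ha => ?_)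
  refine ⟨(memLp_conj (Lp.memLp a)).integrable_mul (Lp.memLp (c m)),
    (memLp_conj (Lp.memLp a)).integrable_mul (Lp.memLp _), ?_⟩
  have e1 : ∀ d : HalfLineL2, ∫ ξ in Ioi (0 : ℝ), (starRingEnd ℂ) ((a : ℝ → ℂ) ξ) * (d : ℝ → ℂ) ξ =
      inner ℂ a d := by
    intro d
    rw [L2.inner_def]
    refine integral_congr_ae (ae_of_all _ fun ξ => ?_)
    simp only [RCLike.inner_apply, mul_comm]
  refine (e1 (c m)).trans (Eq.trans ?_ (e1 ((lp.single 2 n g : CompSpace p) m)).symm)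
  rw [← lp.inner_single_left (𝕜 := ℂ) m a c, ← (hG _).2, hcore m a ha]
  split_ifs with h
  · subst h
    rw [lp.single_apply_self, ← e1]
    refine integral_congr_ae ?_
    filter_upwards [(memLp_specGamma_mul (l := l) (hs.isTame hl) m hf).coeFn_toLp] with ξ h1
    rw [hg, h1]
    ring
  · rw [lp.single_apply_ne _ _ _ h, inner_zero_right]

/-- The symbol is moved to the test vector: the form of b against a is the conjugate of the form of
a against b with symbol conj s. Since a is band-limited, the action of conj s on it is known, and b
may be arbitrary. -/
theorem IsCompToeplitz.ae_eq (hp : 1 ≤ p) (hl : (p : ℝ) < l) {s : SiegelBase p → ℂ}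
    (hs : IsBergmanSymbol l s) {b c : CompSpace p} (h : IsCompToeplitz l s b c)
    (n : Fin (p - 1) → ℕ) : (c n : ℝ → ℂ) =ᵐ[volume.restrict (Ioi (0 : ℝ))]
      fun ξ => specGamma l s n ξ * (b n : ℝ → ℂ) ξ := by
  refine ae_eq_of_forall_isNice fun a ha => ?_
  have hconj := memLp_specGamma_mul (l := l) (hs.conj.isTame hl) n ha
  have e0 : ∀ ξ, (starRingEnd ℂ) (specGamma l (fun w => (starRingEnd ℂ) (s w)) n ξ *
      (a : ℝ → ℂ) ξ) * (b n : ℝ → ℂ) ξ =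
      (starRingEnd ℂ) ((a : ℝ → ℂ) ξ) * (specGamma l s n ξ * (b n : ℝ → ℂ) ξ) := by
    intro ξ
    rw [specGamma_conj, map_mul, Complex.conj_conj]
    ring
  refine ⟨(memLp_conj (Lp.memLp a)).integrable_mul (Lp.memLp (c n)), ?_, ?_⟩
  · exact ((memLp_conj hconj).integrable_mul (Lp.memLp (b n))).congr (ae_of_all _ e0)
  · have hT := exists_isCompToeplitz_single hp hl hs.conj n ha
    have e1 : ∫ ξ in Ioi (0 : ℝ), (starRingEnd ℂ) ((a : ℝ → ℂ) ξ) * (c n : ℝ → ℂ) ξ =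
        inner ℂ (lp.single 2 n a : CompSpace p) c := by
      rw [lp.inner_single_left, L2.inner_def]
      refine integral_congr_ae (ae_of_all _ fun ξ => ?_)
      simp only [RCLike.inner_apply, mul_comm]
    rw [e1, ← (h _).2]
    have e2 : ∫ z in siegelDomain p, (starRingEnd ℂ) (compAdj l (lp.single 2 n a) z) * compAdj l b z *
        liftSymbol s z = (starRingEnd ℂ) (∫ z in siegelDomain p, (starRingEnd ℂ) (compAdj l b z) *
          compAdj l (lp.single 2 n a) z * liftSymbol (fun w => (starRingEnd ℂ) (s w)) z) := by
      rw [← integral_conj]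
      refine integral_congr_ae (ae_of_all _ fun z => ?_)
      simp only [map_mul, Complex.conj_conj, liftSymbol]
      ring
    rw [e2, (hT b).2, inner_conj_symm, lp.inner_single_left, L2.inner_def]
    refine integral_congr_ae ?_
    filter_upwards [hconj.coeFn_toLp] with ξ h1
    rw [h1, RCLike.inner_apply, mul_comm, ← e0]

/-- The graph of the component Toeplitz operator. -/
def compToeplitzGraph (hl : 0 < l) (s : SiegelBase p → ℂ) : AddSubmonoid (CompSpace p × CompSpace p) where
  carrier := {x | IsCompToeplitz l s x.1 x.2}
  add_mem' h h' := h.add hl h'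
  zero_mem' := isCompToeplitz_zero hl s

/-- Truncating b and c to a band and to finitely many coordinates keeps c = γb and puts the pair in
the graph, because γ is bounded on bands; the truncations converge. -/
theorem mem_closure_compToeplitzGraph (hp : 1 ≤ p) (hl : (p : ℝ) < l) {s : SiegelBase p → ℂ}
    (hs : IsBergmanSymbol l s) {b c : CompSpace p}
    (h : ∀ n, (c n : ℝ → ℂ) =ᵐ[volume.restrict (Ioi (0 : ℝ))]
      fun ξ => specGamma l s n ξ * (b n : ℝ → ℂ) ξ) :
    (b, c) ∈ (compToeplitzGraph (pos_of_natCast_lt hl) s).topologicalClosure := by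
  set D := (compToeplitzGraph (pos_of_natCast_lt hl) s).topologicalClosure with hD
  have hDc : IsClosed (D : Set (CompSpace p × CompSpace p)) :=
    AddSubmonoid.isClosed_topologicalClosure _
  have hsingle : ∀ n, ((lp.single 2 n (b n), lp.single 2 n (c n)) : CompSpace p × CompSpace p) ∈ D := by
    intro n
    have hcont : Continuous fun f : HalfLineL2 => (lp.single 2 n f : CompSpace p) :=
      (lp.isometry_single (E := fun _ : Fin (p - 1) → ℕ => HalfLineL2) (p := 2) n).continuous
    refine hDc.mem_of_tendsto (((hcont.tendsto _).comp (tendsto_bandTrunc (b n))).prodMk_nhds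
      ((hcont.tendsto _).comp (tendsto_bandTrunc (c n)))) (Eventually.of_forall fun j => ?_)
    have hpos : (0 : ℝ) < ((j : ℝ) + 1)⁻¹ := by positivity
    have hT := exists_isCompToeplitz_single hp hl hs n (isNice_bandTrunc hpos (b n))
    refine AddSubmonoid.le_topologicalClosure _ ?_
    -- Cutting off to a band commutes with multiplication by the multiplier.
    have e : (memLp_specGamma_mul (l := l) (hs.isTame hl) n
        (isNice_bandTrunc hpos (b n))).toLp _ = bandTrunc ((j : ℝ) + 1)⁻¹ (c n) := by
      refine Lp.ext ?_
      filter_upwards [(memLp_specGamma_mul (l := l) (hs.isTame hl) n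
        (isNice_bandTrunc hpos (b n))).coeFn_toLp, bandTrunc_ae ((j : ℝ) + 1)⁻¹ (b n),
        bandTrunc_ae ((j : ℝ) + 1)⁻¹ (c n), h n] with ξ h1 h2 h3 h4
      rw [h1, h2, h3]
      by_cases hξ : ξ ∈ Icc ((j : ℝ) + 1)⁻¹ ((j : ℝ) + 1)⁻¹⁻¹
      · rw [indicator_of_mem hξ, indicator_of_mem hξ, h4]
      · rw [indicator_of_notMem hξ, indicator_of_notMem hξ, mul_zero]
    rw [e] at hT
    exact hT
  have hsum := (lp.hasSum_single (p := 2) (by norm_num) b).prodMk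
    (lp.hasSum_single (p := 2) (by norm_num) c)
  exact hDc.mem_of_tendsto hsum (Eventually.of_forall fun S => sum_mem fun n _ => hsingle n)

theorem memLp_symbolQuot_of_le (hp : 1 ≤ p) (hl : (p : ℝ) < l) {s : SiegelBase p → ℂ}
    (hs : Measurable s) {C : ℝ} (hC : ∀ w : SiegelBase p, 0 < w.2 → ‖s w‖ ≤ C * ‖weightSymbol p l w‖)
    (b : CompSpace p) : MemLp (symbolQuot l s b) 2 (compMeasure p l) := by
  have hl0 := pos_of_natCast_lt hl
  refine MemLp.of_le_mul (c := C) (memLp_compAdj hp hl b) ?_ ?_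
  · have h1 := measurable_compAdj hl0 b
    have h2 := measurable_liftSymbol hs
    have h3 := measurable_weight (p := p) (l := l)
    unfold symbolQuot
    exact ((h2.mul h1).div (Complex.measurable_ofReal.comp h3)).aestronglyMeasurable
  · have h6 : ∀ᵐ z ∂(compMeasure p l), z ∈ siegelDomain p :=
      (withDensity_absolutelyContinuous _ _).ae_le
        (ae_restrict_mem (measurableSet_siegelDomain p))
    filter_upwards [h6] with z hz
    have hw := weight_pos hl hz
    have hb := hC (z.1, siegelHeight z) hz
    change _ ≤ C * ‖(weight p l z : ℂ)‖ at hb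
    rw [Complex.norm_real, Real.norm_of_nonneg hw.le] at hb
    rw [symbolQuot, norm_div, norm_mul, Complex.norm_real, Real.norm_of_nonneg hw.le,
      div_le_iff₀ hw, liftSymbol]
    nlinarith [norm_nonneg (compAdj l b z)]

/-- The multiplier is monotone in |s|, and that of the weight is 1. -/
theorem norm_specGamma_le (hp : 1 ≤ p) (hl : (p : ℝ) < l) {s : SiegelBase p → ℂ}
    {C : ℝ} (hC : ∀ w : SiegelBase p, 0 < w.2 → ‖s w‖ ≤ C * ‖weightSymbol p l w‖)
    (n : Fin (p - 1) → ℕ) {ξ : ℝ} (hξ : 0 < ξ) : ‖specGamma l s n ξ‖ ≤ C := by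
  set A : ℝ := 2 * Real.pi * Real.pi ^ (p - 1) * bargmannFactor p l n ξ ^ 2 with hA
  have hA0 : 0 ≤ A := by positivity
  set E : (Fin (p - 1) → ℝ) × ℝ → ℝ := fun x => weightConst p l * x.2 ^ (l - p - 1) *
    ((∏ k, x.1 k ^ n k) * Real.exp (-2 * ξ * (x.2 + ∑ k, x.1 k))) with hE
  have h1 : A * ∫ x in posOrthant p, E x = 1 := by
    have h := specGamma_weightSymbol hp hl n hξ
    have e : orthantIntegral (weightSymbol p l) n ξ = ((∫ x in posOrthant p, E x : ℝ) : ℂ) := by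
      rw [orthantIntegral, ← integral_complex_ofReal]
      simp only [hE, weightSymbol, Complex.ofReal_mul]
    rw [specGamma, e, ← Complex.ofReal_mul] at h
    exact_mod_cast h
  -- A divergent integral would count as 0 and contradict `h1`.
  have hEi : IntegrableOn E (posOrthant p) := by
    by_contra hni
    rw [integral_undef hni, mul_zero] at h1
    exact zero_ne_one h1
  have h2 : ‖orthantIntegral s n ξ‖ ≤ C * ∫ x in posOrthant p, E x := by
    rw [← integral_const_mul]
    refine norm_integral_le_of_norm_le (hEi.const_mul C)
      ((ae_restrict_iff' (measurableSet_posOrthant p)).2 (ae_of_all _ fun x hx => ?_))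
    obtain ⟨hx1, hx2⟩ := hx
    have hp1 : 0 ≤ ∏ k, x.1 k ^ n k := Finset.prod_nonneg fun k _ => pow_nonneg (hx1 k).le _
    have hc := weightConst_pos hl
    have hb := hC (fun k => (Real.sqrt (x.1 k) : ℂ), x.2) hx2
    rw [weightSymbol, Complex.norm_real, Real.norm_of_nonneg (by positivity)] at hb
    rw [norm_mul, Complex.norm_real, Real.norm_of_nonneg (by positivity)]
    simp only [hE]
    rw [← mul_assoc C]
    exact mul_le_mul_of_nonneg_right hb (by positivity)
  rw [specGamma, norm_mul, Complex.norm_real, Real.norm_of_nonneg hA0]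
  calc A * ‖orthantIntegral s n ξ‖ ≤ A * (C * ∫ x in posOrthant p, E x) := by gcongr
    _ = C := by rw [mul_left_comm, h1, mul_one]

end ComponentToeplitz

/-! ### The scalar symbols of the super Toeplitz operator. -/

section SuperSymbol

variable {p q : ℕ} {ν : ℝ}

theorem lt_add_card (hν : (p : ℝ) < ν) (M : Finset (Fin q)) : (p : ℝ) < ν + M.card := by
  have : (0 : ℝ) ≤ M.card := Nat.cast_nonneg _
  linarith

theorem card_le_natCast (M : Finset (Fin q)) : (M.card : ℝ) ≤ q := by
  have := Finset.card_le_univ M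
  rw [Fintype.card_fin] at this
  exact_mod_cast this

theorem measurable_indicator_siegelDomain {f : CSpace p → ℂ}
    (hf : Measurable fun z : siegelDomain p => f z) : Measurable ((siegelDomain p).indicator f) := by
  refine measurable_of_restrict_of_restrict_compl (measurableSet_siegelDomain p) ?_ ?_
  · have e : (siegelDomain p).domRestrict ((siegelDomain p).indicator f) =
        fun z : siegelDomain p => f z := by
      ext z
      simp
    exact e ▸ hf
  · have e : ((siegelDomain p)ᶜ).domRestrict ((siegelDomain p).indicator f) = fun _ => 0 := by
      ext z
      have : (z : CSpace p) ∉ siegelDomain p := z.2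
      simp [this]
    exact e ▸ measurable_const

theorem rpow_le_add {v a b x : ℝ} (hv : 0 < v) (ha : a ≤ x) (hb : x ≤ b) : v ^ x ≤ v ^ a + v ^ b := by
  have h1 := Real.rpow_pos_of_pos hv a
  have h2 := Real.rpow_pos_of_pos hv b
  rcases le_total v 1 with h | h
  · linarith [Real.rpow_le_rpow_of_exponent_ge hv h ha]
  · linarith [Real.rpow_le_rpow_of_exponent_le h hb]

theorem siegelCoord_mem {w : SiegelBase p} (hw : 0 < w.2) (x : ℝ) :
    siegelCoord p (w, x) ∈ siegelDomain p := by
  rw [siegelDomain, mem_ofPred_eq, siegelHeight_siegelCoord]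
  exact hw

/-- The coefficient of `F_{K \ M}` in the symbol of the `M`-th component. -/
def toeplitzCoeff (p : ℕ) (ν : ℝ) (M K : Finset (Fin q)) (v : ℝ) : ℝ :=
  (-1) ^ (K \ M).card * (Real.Gamma (ν + M.card) / (4 * Real.pi ^ p * Real.Gamma (ν + K.card - p))) *
    v ^ (ν + K.card - p - 1)

/-- The symbol of the `M`-th component of the super Toeplitz operator. -/
def toeplitzSymbol (ν : ℝ) (F : SuperComponents p q) (M : Finset (Fin q)) (w : SiegelBase p) : ℂ :=
  ∑ K ∈ Finset.univ.filter (fun K : Finset (Fin q) => M ⊆ K), (toeplitzCoeff p ν M K w.2 : ℂ) *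
    (siegelDomain p).indicator (F (K \ M) (K \ M)) (siegelCoord p (w, 0))

theorem abs_toeplitzCoeff (hν : (p : ℝ) < ν) (M K : Finset (Fin q)) {v : ℝ} (hv : 0 < v) :
    |toeplitzCoeff p ν M K v| = Real.Gamma (ν + M.card) /
      (4 * Real.pi ^ p * Real.Gamma (ν + K.card - p)) * v ^ (ν + K.card - p - 1) := by
  have h1 := Real.Gamma_pos_of_pos (pos_of_natCast_lt (lt_add_card hν M))
  have h2 := Real.Gamma_pos_of_pos (sub_pos.2 (lt_add_card hν K))
  have h3 := Real.rpow_pos_of_pos hv (ν + K.card - p - 1)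
  rw [toeplitzCoeff, abs_mul, abs_mul, abs_pow, abs_neg, abs_one, one_pow, one_mul, abs_of_pos h3,
    abs_of_pos (by positivity)]

variable {F : SuperComponents p q}

/-- The term of K grows like v^(ν+|K|-p-1), between the exponents for K = M, the Bergman weight
itself, and for K = Q. The terms with K ≠ M exceed the weight for large v, which is why T_F may be
unbounded although F is bounded. -/
theorem isBergmanSymbol_toeplitzSymbol (hν : (p : ℝ) < ν)
    (hmeas : ∀ I J, Measurable (fun z : siegelDomain p => F I J z))
    (hbdd : ∃ C : ℝ, ∀ I J, ∀ z ∈ siegelDomain p, ‖F I J z‖ ≤ C) (hinv : IsQuasiParabolic F)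
    (M : Finset (Fin q)) : IsBergmanSymbol (ν + M.card) (toeplitzSymbol ν F M) := by
  obtain ⟨C, hC⟩ := hbdd
  have hcoef : ∀ K : Finset (Fin q), 0 ≤ Real.Gamma (ν + M.card) /
      (4 * Real.pi ^ p * Real.Gamma (ν + K.card - p)) := fun K => by
    have h1 := Real.Gamma_pos_of_pos (pos_of_natCast_lt (lt_add_card hν M))
    have h2 := Real.Gamma_pos_of_pos (sub_pos.2 (lt_add_card hν K))
    positivity
  refine ⟨?_, fun t w hw => ?_, ∑ K ∈ Finset.univ.filter (fun K : Finset (Fin q) => M ⊆ K),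
    Real.Gamma (ν + M.card) / (4 * Real.pi ^ p * Real.Gamma (ν + K.card - p)) * |C|,
    ν + q - p - 1, ?_, ?_, fun w hw => ?_⟩
  · refine Finset.measurable_sum _ fun K _ => ?_
    refine Measurable.mul ?_ ?_
    · unfold toeplitzCoeff
      fun_prop
    · exact (measurable_indicator_siegelDomain (hmeas _ _)).comp
        ((siegelCoord p).measurable.comp (by fun_prop))
  · refine Finset.sum_congr rfl fun K _ => ?_
    have h1 := siegelCoord_mem hw 0
    have e : siegelCoord p (((fun k => (t k : ℂ) * w.1 k, w.2) : SiegelBase p), 0) =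
        (fun k => (t k : ℂ) * (siegelCoord p (w, 0)).1 k, (siegelCoord p (w, 0)).2 + ((0 : ℝ) : ℂ)) := by
      rw [siegelCoord_apply, siegelCoord_apply, baseIm_circle_mul]
      simp
    rw [indicator_of_mem h1, indicator_of_mem
      (siegelCoord_mem (w := ((fun k => (t k : ℂ) * w.1 k, w.2) : SiegelBase p)) hw 0), e,
      hinv.rotate_shift h1]
  · exact Finset.sum_nonneg fun K _ => mul_nonneg (hcoef K) (abs_nonneg C)
  · linarith [card_le_natCast M]
  · rw [toeplitzSymbol, Finset.sum_mul]
    refine norm_sum_le_of_le _ fun K hK => ?_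
    rw [norm_mul, Complex.norm_real, Real.norm_eq_abs, abs_toeplitzCoeff hν M K hw,
      indicator_of_mem (siegelCoord_mem hw 0)]
    have hMK : (M.card : ℝ) ≤ K.card := by
      exact_mod_cast Finset.card_le_card (Finset.mem_filter.1 hK).2
    have h1 : w.2 ^ (ν + K.card - p - 1) ≤ w.2 ^ (ν + M.card - p - 1) + w.2 ^ (ν + q - p - 1) :=
      rpow_le_add hw (by linarith) (by linarith [card_le_natCast K])
    have h2 : ‖F (K \ M) (K \ M) (siegelCoord p (w, 0))‖ ≤ |C| :=
      (hC _ _ _ (siegelCoord_mem hw 0)).trans (le_abs_self C)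
    calc _ ≤ Real.Gamma (ν + M.card) / (4 * Real.pi ^ p * Real.Gamma (ν + K.card - p)) *
          (w.2 ^ (ν + M.card - p - 1) + w.2 ^ (ν + q - p - 1)) * |C| := by
          have h3 := hcoef K
          have h4 := Real.rpow_pos_of_pos hw (ν + M.card - p - 1)
          have h5 := Real.rpow_pos_of_pos hw (ν + q - p - 1)
          gcongr
      _ = _ := by ring

theorem siegelCoord_shift (hinv : IsQuasiParabolic F) {z : CSpace p} (hz : z ∈ siegelDomain p)
    (I : Finset (Fin q)) : F I I (siegelCoord p ((z.1, siegelHeight z), 0)) = F I I z := by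
  have h1 : siegelCoord p ((z.1, siegelHeight z), 0) ∈ siegelDomain p :=
    siegelCoord_mem (w := (z.1, siegelHeight z)) hz 0
  rw [← hinv.rotate_shift h1 I (fun _ => 1) z.2.re]
  congr 1
  refine Prod.ext ?_ (Complex.ext ?_ ?_)
  · ext k
    simp [siegelCoord_apply]
  · simp [siegelCoord_apply]
  · simp [siegelCoord_apply, baseIm, siegelHeight]

theorem liftSymbol_toeplitzSymbol (hν : (p : ℝ) < ν) (hinv : IsQuasiParabolic F)
    (M : Finset (Fin q)) {z : CSpace p} (hz : z ∈ siegelDomain p) :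
    liftSymbol (toeplitzSymbol ν F M) z =
      ((Real.Gamma (ν + M.card) / (4 * Real.pi ^ p * Real.Gamma (ν + q - p)) : ℝ) : ℂ) *
        componentSymbol ν F M z := by
  rw [liftSymbol, toeplitzSymbol, componentSymbol, Finset.mul_sum]
  refine Finset.sum_congr rfl fun K _ => ?_
  rw [indicator_of_mem (siegelCoord_mem (w := (z.1, siegelHeight z)) hz 0),
    siegelCoord_shift hinv hz, ← mul_assoc, ← Complex.ofReal_mul, superPowCoeff_compl hν]
  congr 2
  have h2 : Real.Gamma (ν + q - p) ≠ 0 := by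
    refine (Real.Gamma_pos_of_pos ?_).ne'
    have : (0 : ℝ) ≤ q := Nat.cast_nonneg _
    linarith
  rw [toeplitzCoeff]
  field_simp

theorem integrableOn_gammaIntegrand (hν : (p : ℝ) < ν)
    (hmeas : ∀ I J, Measurable (fun z : siegelDomain p => F I J z))
    (hbdd : ∃ C : ℝ, ∀ I J, ∀ z ∈ siegelDomain p, ‖F I J z‖ ≤ C) (I K : Finset (Fin q))
    (n : Fin (p - 1) → ℕ) {ξ : ℝ} (hξ : 0 < ξ) :
    IntegrableOn (gammaIntegrand F I (ν + K.card - p) n ξ) (posOrthant p) := by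
  obtain ⟨C, hC⟩ := hbdd
  have hn : ∀ k, (-1 : ℝ) < n k := fun k => by
    have : (0 : ℝ) ≤ n k := Nat.cast_nonneg _
    linarith
  have hi := (integrableOn_orthantGamma (p := p) (α := ν + K.card - p - 1) (c := 2 * ξ) hn
    (by linarith [lt_add_card hν K]) (by positivity)).const_mul |C|
  have hmem : ∀ x ∈ posOrthant p, ((fun k => (Real.sqrt (x.1 k) : ℂ),
      Complex.I * ((x.2 + ∑ k, x.1 k : ℝ) : ℂ)) : CSpace p) ∈ siegelDomain p := by
    intro x hx
    have e : ∀ k, Real.sqrt (x.1 k) ^ 2 = x.1 k := fun k => Real.sq_sqrt (hx.1 k).le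
    have := hx.2
    simpa [siegelDomain, siegelHeight, e] using this
  have hm : Measurable fun x : (Fin (p - 1) → ℝ) × ℝ =>
      (siegelDomain p).indicator (F I I) ((fun k => (Real.sqrt (x.1 k) : ℂ),
        Complex.I * ((x.2 + ∑ k, x.1 k : ℝ) : ℂ)) : CSpace p) *
      (((∏ k, x.1 k ^ n k) * Real.exp (-2 * ξ * (x.2 + ∑ k, x.1 k)) *
        x.2 ^ (ν + K.card - p - 1) : ℝ) : ℂ) :=
    ((measurable_indicator_siegelDomain (hmeas I I)).comp (by fun_prop)).mul (by fun_prop)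
  have e : EqOn (fun x : (Fin (p - 1) → ℝ) × ℝ =>
      (siegelDomain p).indicator (F I I) ((fun k => (Real.sqrt (x.1 k) : ℂ),
        Complex.I * ((x.2 + ∑ k, x.1 k : ℝ) : ℂ)) : CSpace p) *
      (((∏ k, x.1 k ^ n k) * Real.exp (-2 * ξ * (x.2 + ∑ k, x.1 k)) *
        x.2 ^ (ν + K.card - p - 1) : ℝ) : ℂ)) (gammaIntegrand F I (ν + K.card - p) n ξ)
      (posOrthant p) := fun x hx => by
    simp only [gammaIntegrand, indicator_of_mem (hmem x hx)]
  rw [← integrableOn_congr_fun e (measurableSet_posOrthant p)]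
  refine hi.mono' hm.aestronglyMeasurable
    ((ae_restrict_iff' (measurableSet_posOrthant p)).2 (ae_of_all _ fun x hx => ?_))
  have hp1 : 0 ≤ ∏ k, x.1 k ^ n k := Finset.prod_nonneg fun k _ => pow_nonneg (hx.1 k).le _
  have hp2 := Real.rpow_pos_of_pos hx.2 (ν + K.card - p - 1)
  rw [indicator_of_mem (hmem x hx), norm_mul, Complex.norm_real, Real.norm_of_nonneg (by positivity),
    orthantGamma]
  simp only [Real.rpow_natCast]
  have h2 : -2 * ξ = -(2 * ξ) := by ring
  rw [h2]
  exact mul_le_mul_of_nonneg_right ((hC _ _ _ (hmem x hx)).trans (le_abs_self C)) (by positivity)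

/-- The integral over the orthant is taken term by term in K; Γ(ν+|M|) cancels against k_n(ξ)², and
4π^p against the constants of `specGamma`. -/
theorem specGamma_toeplitzSymbol (hp : 1 ≤ p) (hν : (p : ℝ) < ν)
    (hmeas : ∀ I J, Measurable (fun z : siegelDomain p => F I J z))
    (hbdd : ∃ C : ℝ, ∀ I J, ∀ z ∈ siegelDomain p, ‖F I J z‖ ≤ C) (M : Finset (Fin q))
    (n : Fin (p - 1) → ℕ) {ξ : ℝ} (hξ : 0 < ξ) :
    specGamma (ν + M.card) (toeplitzSymbol ν F M) n ξ = gammaSymbol ν F n ξ M := by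
  have hint := fun K => integrableOn_gammaIntegrand hν hmeas hbdd (K \ M) K n hξ
  have e1 : orthantIntegral (toeplitzSymbol ν F M) n ξ =
      ∑ K ∈ Finset.univ.filter (fun K : Finset (Fin q) => M ⊆ K),
        (((-1) ^ (K \ M).card * (Real.Gamma (ν + M.card) /
          (4 * Real.pi ^ p * Real.Gamma (ν + K.card - p))) : ℝ) : ℂ) *
        ∫ x in posOrthant p, gammaIntegrand F (K \ M) (ν + K.card - p) n ξ x := by
    simp only [← integral_const_mul]
    rw [← integral_finsetSum _ fun K _ => (hint K).const_mul _, orthantIntegral]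
    refine setIntegral_congr_fun (measurableSet_posOrthant p) fun x hx => ?_
    simp only [toeplitzSymbol, Finset.sum_mul]
    refine Finset.sum_congr rfl fun K _ => ?_
    have e : siegelCoord p (((fun k => (Real.sqrt (x.1 k) : ℂ), x.2) : SiegelBase p), 0) =
        (fun k => (Real.sqrt (x.1 k) : ℂ), Complex.I * ((x.2 + ∑ k, x.1 k : ℝ) : ℂ)) := by
      have e : ∀ k, Real.sqrt (x.1 k) ^ 2 = x.1 k := fun k => Real.sq_sqrt (hx.1 k).le
      rw [siegelCoord_apply]
      refine Prod.ext rfl (Complex.ext ?_ ?_)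
      · simp
      · simp [baseIm, e]
    rw [indicator_of_mem (siegelCoord_mem (by exact hx.2) 0), e, gammaIntegrand, toeplitzCoeff]
    push_cast
    ring
  have hl0 := pos_of_natCast_lt (lt_add_card hν M)
  have hΓ := (Real.Gamma_pos_of_pos hl0).ne'
  rw [specGamma, e1, gammaSymbol, Finset.mul_sum, Finset.mul_sum]
  refine Finset.sum_congr rfl fun K _ => ?_
  rw [← mul_assoc, ← mul_assoc, ← Complex.ofReal_mul, ← Complex.ofReal_mul]
  congr 2
  have hK := (Real.Gamma_pos_of_pos (sub_pos.2 (lt_add_card hν K))).ne'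
  have e2 : Real.pi * Real.pi ^ (p - 1) = Real.pi ^ p := by
    rw [← pow_succ', Nat.sub_add_cancel hp]
  have e3 : (2 * ξ) ^ (((∑ k, n k : ℕ) : ℝ) + ν + M.card - 1) =
      (2 * ξ) ^ (ν + M.card - 1) * ∏ k, (2 * ξ) ^ n k := by
    rw [Finset.prod_pow_eq_pow_sum, ← Real.rpow_natCast, ← Real.rpow_add (by positivity)]
    congr 1
    ring
  rw [bargmannFactor_sq hl0 n hξ, e3, Finset.prod_div_distrib, ← e2]
  push_cast
  have hf : ∏ k, ((n k).factorial : ℝ) ≠ 0 :=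
    Finset.prod_ne_zero_iff.2 fun k _ => Nat.cast_ne_zero.2 (Nat.factorial_ne_zero _)
  field_simp
  ring

/-- The excess of the K-th term over the weight is v^|K \ M|, which is exactly what the hypothesis
on ρ^|I| F_I with I = K \ M absorbs. -/
theorem norm_toeplitzSymbol_le (hν : (p : ℝ) < ν) {C : ℝ}
    (hC : ∀ I, ∀ z ∈ siegelDomain p, siegelHeight z ^ I.card * ‖F I I z‖ ≤ C) :
    ∃ C', ∀ M : Finset (Fin q), ∀ w : SiegelBase p, 0 < w.2 →
      ‖toeplitzSymbol ν F M w‖ ≤ C' * ‖weightSymbol p (ν + M.card) w‖ := by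
  have hΓ : ∀ K : Finset (Fin q), 0 < Real.Gamma (ν + K.card - p) := fun K =>
    Real.Gamma_pos_of_pos (sub_pos.2 (lt_add_card hν K))
  have key : ∀ M : Finset (Fin q), ∃ C', ∀ w : SiegelBase p, 0 < w.2 →
      ‖toeplitzSymbol ν F M w‖ ≤ C' * ‖weightSymbol p (ν + M.card) w‖ := by
    intro M
    refine ⟨∑ K ∈ Finset.univ.filter (fun K : Finset (Fin q) => M ⊆ K),
      Real.Gamma (ν + M.card - p) / Real.Gamma (ν + K.card - p) * C, fun w hw => ?_⟩
    rw [toeplitzSymbol, Finset.sum_mul]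
    refine norm_sum_le_of_le _ fun K hK => ?_
    have hMK := (Finset.mem_filter.1 hK).2
    have hcard : (K.card : ℝ) = M.card + (K \ M).card := by
      have := Finset.card_sdiff_add_card_eq_card hMK
      rw [← this]
      push_cast
      ring
    have hc := weightConst_pos (lt_add_card hν M)
    have hm := siegelCoord_mem hw 0
    have hF := hC (K \ M) _ hm
    rw [siegelHeight_siegelCoord] at hF
    rw [norm_mul, Complex.norm_real, Real.norm_eq_abs, abs_toeplitzCoeff hν M K hw,
      indicator_of_mem hm, weightSymbol, Complex.norm_real, Real.norm_of_nonneg (by positivity)]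
    have e : w.2 ^ (ν + K.card - p - 1) = w.2 ^ (ν + M.card - p - 1) * w.2 ^ (K \ M).card := by
      rw [← Real.rpow_natCast, ← Real.rpow_add hw, hcard]
      congr 1
      ring
    have h1 := hΓ M
    have h2 := hΓ K
    have h3 := Real.Gamma_pos_of_pos (pos_of_natCast_lt (lt_add_card hν M))
    have h4 := Real.rpow_pos_of_pos hw (ν + M.card - p - 1)
    rw [e, weightConst]
    calc _ = Real.Gamma (ν + M.card) / (4 * Real.pi ^ p * Real.Gamma (ν + K.card - p)) *
          w.2 ^ (ν + M.card - p - 1) *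
          (w.2 ^ (K \ M).card * ‖F (K \ M) (K \ M) (siegelCoord p (w, 0))‖) := by ring
      _ ≤ Real.Gamma (ν + M.card) / (4 * Real.pi ^ p * Real.Gamma (ν + K.card - p)) *
          w.2 ^ (ν + M.card - p - 1) * C := by gcongr
      _ = _ := by
          field_simp
  choose C' hC' using key
  refine ⟨∑ M, |C' M|, fun M w hw => (hC' M w hw).trans ?_⟩
  refine mul_le_mul_of_nonneg_right ?_ (norm_nonneg _)
  exact (le_abs_self _).trans (Finset.single_le_sum (f := fun M => |C' M|)
    (fun _ _ => abs_nonneg _) (Finset.mem_univ M))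

end SuperSymbol

/-! ### Reassembling the components. -/

section SuperSpace

variable {p q : ℕ} {ν : ℝ}

/-- The ratio of the `M`-th weight in the super inner product to the weight with parameter
`ν + |M|`. -/
def superRatio (p q : ℕ) (ν : ℝ) (M : Finset (Fin q)) : ℝ :=
  4 * Real.pi ^ p * Real.Gamma (ν + q - p) / Real.Gamma (ν + M.card)

theorem gamma_top_pos (hν : (p : ℝ) < ν) : 0 < Real.Gamma (ν + q - p) := by
  refine Real.Gamma_pos_of_pos ?_
  have : (0 : ℝ) ≤ q := Nat.cast_nonneg _
  linarith

theorem superRatio_pos (hν : (p : ℝ) < ν) (M : Finset (Fin q)) : 0 < superRatio p q ν M := by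
  have h1 := Real.Gamma_pos_of_pos (pos_of_natCast_lt (lt_add_card hν M))
  have h2 := gamma_top_pos (q := q) hν
  unfold superRatio
  positivity

theorem superPowCoeff_compl_eq_weight (hν : (p : ℝ) < ν) (M : Finset (Fin q)) (z : CSpace p) :
    superPowCoeff (ν + q - p - 1) (siegelHeight z) (Mᶜ).card =
      superRatio p q ν M * weight p (ν + M.card) z := by
  have h1 := (Real.Gamma_pos_of_pos (pos_of_natCast_lt (lt_add_card hν M))).ne'
  have h2 := (Real.Gamma_pos_of_pos (sub_pos.2 (lt_add_card hν M))).ne'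
  rw [superPowCoeff_compl hν, superRatio, weight, weightConst]
  field_simp

/-- This produces the weights Γ(ν)/Γ(ν+|M|) of the inner product on sequences. -/
theorem const_mul_superRatio (hν : (p : ℝ) < ν) (M : Finset (Fin q)) :
    ((Real.Gamma ν / (4 * Real.pi ^ p * Real.Gamma (ν + q - p)) : ℝ) : ℂ) * (superRatio p q ν M : ℂ) =
      ((Real.Gamma ν / Real.Gamma (ν + (M.card : ℝ)) : ℝ) : ℂ) := by
  have h1 := (gamma_top_pos (q := q) hν).ne'
  rw [← Complex.ofReal_mul, superRatio]
  congr 1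
  field_simp

theorem superIntegrand_toGrassmann_eq (hν : (p : ℝ) < ν) (Φ Ψ : HolComponents p q) (z : CSpace p) :
    superIntegrand ν Φ Ψ.toGrassmann z = ∑ M, (superRatio p q ν M : ℂ) *
      ((starRingEnd ℂ) (Φ M z) * Ψ M z * (weight p (ν + M.card) z : ℂ)) := by
  rw [superIntegrand_toGrassmann]
  refine Finset.sum_congr rfl fun M _ => ?_
  rw [superPowCoeff_compl_eq_weight hν]
  push_cast
  ring

theorem superIntegrand_mul_eq (hν : (p : ℝ) < ν) {F : SuperComponents p q} (hinv : IsQuasiParabolic F)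
    (Φ Ψ : HolComponents p q) {z : CSpace p} (hz : z ∈ siegelDomain p) :
    superIntegrand ν Φ (fun z => F.toGrassmann z * Ψ.toGrassmann z) z =
      ∑ M, (superRatio p q ν M : ℂ) *
        ((starRingEnd ℂ) (Φ M z) * Ψ M z * liftSymbol (toeplitzSymbol ν F M) z) := by
  rw [superIntegrand_mul ν F Φ Ψ z fun I J h => hinv.eq_zero hz h]
  refine Finset.sum_congr rfl fun M _ => ?_
  rw [liftSymbol_toeplitzSymbol hν hinv M hz]
  have h1 := (Real.Gamma_pos_of_pos (pos_of_natCast_lt (lt_add_card hν M))).ne'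
  have h2 := (gamma_top_pos (q := q) hν).ne'
  have e : (superRatio p q ν M : ℂ) * ((Real.Gamma (ν + M.card) /
      (4 * Real.pi ^ p * Real.Gamma (ν + q - p)) : ℝ) : ℂ) = 1 := by
    rw [← Complex.ofReal_mul, ← Complex.ofReal_one, superRatio]
    congr 1
    field_simp
  linear_combination (-((starRingEnd ℂ) (Φ M z) * Ψ M z * componentSymbol ν F M z)) * e

theorem isLinearMap_bargmannAdj (hν : (p : ℝ) < ν) :
    IsLinearMap ℂ (bargmannAdj ν : SeqSpace p q → HolComponents p q) where
  map_add a b := by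
    funext M
    exact compAdj_add (pos_of_natCast_lt (lt_add_card hν M)) (a M) (b M)
  map_smul c a := by
    funext M
    exact compAdj_smul (pos_of_natCast_lt (lt_add_card hν M)) c (a M)

theorem superInner_bargmannAdj (hp : 1 ≤ p) (hν : (p : ℝ) < ν) (a b : SeqSpace p q) :
    IntegrableOn (superIntegrand ν (bargmannAdj ν a) (bargmannAdj ν b).toGrassmann)
        (siegelDomain p) ∧
      superInner ν (bargmannAdj ν a) (bargmannAdj ν b).toGrassmann = seqInner ν a b := by
  have hP := fun M : Finset (Fin q) => isPaired hp (lt_add_card hν M) (a M) (b M)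
  have hI := fun M : Finset (Fin q) => (hP M).1.const_mul (superRatio p q ν M : ℂ)
  have e : superIntegrand ν (bargmannAdj ν a) (bargmannAdj ν b).toGrassmann = fun z =>
      ∑ M, (superRatio p q ν M : ℂ) * ((starRingEnd ℂ) (compAdj (ν + M.card) (a M) z) * compAdj (ν + M.card) (b M) z *
        (weight p (ν + M.card) z : ℂ)) :=
    funext fun z => superIntegrand_toGrassmann_eq hν _ _ z
  constructor
  · rw [e]
    exact integrable_finsetSum _ fun M _ => hI M
  · rw [superInner, e]
    simp only
    rw [integral_finsetSum _ fun M _ => hI M, Finset.mul_sum, seqInner]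
    refine Finset.sum_congr rfl fun M _ => ?_
    rw [integral_const_mul, ← mul_assoc, const_mul_superRatio hν]
    congr 1
    exact (hP M).2

theorem bargmannAdj_mem_superBergman (hp : 1 ≤ p) (hν : (p : ℝ) < ν) (b : SeqSpace p q) :
    bargmannAdj ν b ∈ superBergman p q ν :=
  ⟨fun M => differentiableOn_compAdj (pos_of_natCast_lt (lt_add_card hν M)) (b M),
    fun M _ hz => compAdj_of_notMem (b M) hz, (superInner_bargmannAdj hp hν b b).1⟩

/-- The integrand of (Ψ|Ψ) is a sum of nonnegative terms, so there is no cancellation and each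
component is square integrable. -/
theorem memLp_of_mem_superBergman (hν : (p : ℝ) < ν) {Ψ : HolComponents p q}
    (hΨ : Ψ ∈ superBergman p q ν) (M : Finset (Fin q)) : MemLp (Ψ M) 2 (compMeasure p (ν + M.card)) := by
  obtain ⟨hd, _, hi⟩ := hΨ
  have hl := lt_add_card hν M
  have hm : AEStronglyMeasurable (Ψ M) (volume.restrict (siegelDomain p)) :=
    (hd M).continuousOn.aestronglyMeasurable (measurableSet_siegelDomain p)
  have hm' : AEStronglyMeasurable (Ψ M) (compMeasure p (ν + M.card)) :=
    hm.mono_ac (withDensity_absolutelyContinuous _ _)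
  rw [memLp_two_iff_integrable_sq_norm hm']
  have key : Integrable (fun z => ((‖Ψ M z‖ ^ 2 : ℝ) : ℂ)) (compMeasure p (ν + M.card)) := by
    rw [integrable_compMeasure_iff hl]
    refine (hi.norm.const_mul (superRatio p q ν M)⁻¹).mono' ?_
      ((ae_restrict_iff' (measurableSet_siegelDomain p)).2 (ae_of_all _ fun z hz => ?_))
    · exact (Complex.continuous_ofReal.comp_aestronglyMeasurable (hm.norm.pow 2)).mul
        (Complex.measurable_ofReal.comp measurable_weight).aestronglyMeasurable
    · have hw := fun K : Finset (Fin q) => weight_pos (lt_add_card hν K) hz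
      have hr := fun K : Finset (Fin q) => superRatio_pos hν K
      have e : superIntegrand ν Ψ Ψ.toGrassmann z =
          ((∑ K, superRatio p q ν K * (‖Ψ K z‖ ^ 2 * weight p (ν + K.card) z) : ℝ) : ℂ) := by
        rw [superIntegrand_toGrassmann_eq hν]
        simp only [Complex.conj_mul']
        push_cast
        rfl
      have hnn : ∀ K : Finset (Fin q),
          0 ≤ superRatio p q ν K * (‖Ψ K z‖ ^ 2 * weight p (ν + K.card) z) := fun K => by
        have := hw K
        have := hr K
        positivity
      rw [e, Complex.norm_real, Real.norm_of_nonneg (Finset.sum_nonneg fun K _ => hnn K), norm_mul,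
        Complex.norm_real, Complex.norm_real, Real.norm_of_nonneg (by positivity),
        Real.norm_of_nonneg (hw M).le, ← div_eq_inv_mul, le_div_iff₀ (hr M), mul_comm]
      exact Finset.single_le_sum (f := fun K : Finset (Fin q) =>
        superRatio p q ν K * (‖Ψ K z‖ ^ 2 * weight p (ν + K.card) z))
        (fun K _ => hnn K) (Finset.mem_univ M)
  refine key.norm.congr (ae_of_all _ fun z => ?_)
  simp only [Complex.norm_real, norm_pow, norm_norm]

theorem range_bargmannAdj (hp : 1 ≤ p) (hν : (p : ℝ) < ν) :
    Set.range (bargmannAdj ν : SeqSpace p q → HolComponents p q) = superBergman p q ν := by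
  refine Subset.antisymm ?_ fun Ψ hΨ => ?_
  · rintro _ ⟨b, rfl⟩
    exact bargmannAdj_mem_superBergman hp hν b
  · choose b hb using fun M => exists_compAdj_eq hp (lt_add_card hν M) (hΨ.1 M) (hΨ.2.1 M)
      (memLp_of_mem_superBergman hν hΨ M)
    exact ⟨b, funext hb⟩

/-- The form is a weighted sum of component forms. Test functions with one nonzero component
separate them, and the positive weights are the same on both sides. -/
theorem mem_transformedToeplitzGraph_iff (hp : 1 ≤ p) (hν : (p : ℝ) < ν) {F : SuperComponents p q}
    (hinv : IsQuasiParabolic F) (b c : SeqSpace p q) :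
    (b, c) ∈ transformedToeplitzGraph ν F ↔
      ∀ M, IsCompToeplitz (ν + M.card) (toeplitzSymbol ν F M) (b M) (c M) := by
  have e : ∀ a : SeqSpace p q, EqOn (superIntegrand ν (bargmannAdj ν a)
      (fun z => F.toGrassmann z * (bargmannAdj ν b).toGrassmann z)) (fun z =>
      ∑ M : Finset (Fin q), (superRatio p q ν M : ℂ) * ((starRingEnd ℂ) (compAdj (ν + M.card) (a M) z) *
        compAdj (ν + M.card) (b M) z * liftSymbol (toeplitzSymbol ν F M) z)) (siegelDomain p) :=
    fun a z hz => superIntegrand_mul_eq hν hinv _ _ hz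
  constructor
  · rintro ⟨_, _, h⟩ M a
    -- The test function R^* a with a concentrated in the component M.
    obtain ⟨h1, h2⟩ := h _ (bargmannAdj_mem_superBergman hp hν (Pi.single M a))
    have hr : (superRatio p q ν M : ℂ) ≠ 0 := Complex.ofReal_ne_zero.2 (superRatio_pos hν M).ne'
    have e' : EqOn (superIntegrand ν (bargmannAdj ν (Pi.single M a))
        (fun z => F.toGrassmann z * (bargmannAdj ν b).toGrassmann z)) (fun z =>
        (superRatio p q ν M : ℂ) * ((starRingEnd ℂ) (compAdj (ν + M.card) a z) *
          compAdj (ν + M.card) (b M) z * liftSymbol (toeplitzSymbol ν F M) z)) (siegelDomain p) := by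
      intro z hz
      rw [e _ hz]
      simp only
      rw [Finset.sum_eq_single M, Pi.single_eq_same]
      · intro K _ hK
        have h0 : compAdj (ν + K.card) (0 : CompSpace p) = 0 := by
          simpa using compAdj_smul (pos_of_natCast_lt (lt_add_card hν K)) (0 : ℂ) (0 : CompSpace p)
        rw [Pi.single_eq_of_ne hK, h0]
        simp
      · simp
    rw [(superInner_bargmannAdj hp hν _ c).2, superInner,
      setIntegral_congr_fun (measurableSet_siegelDomain p) e', integral_const_mul, ← mul_assoc,
      const_mul_superRatio hν, seqInner, Finset.sum_eq_single M (fun K _ hK => by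
        rw [Pi.single_eq_of_ne hK, inner_zero_left, mul_zero]) (by simp), Pi.single_eq_same] at h2
    have hg : ((Real.Gamma ν / Real.Gamma (ν + (M.card : ℝ)) : ℝ) : ℂ) ≠ 0 := by
      rw [Ne, Complex.ofReal_eq_zero]
      exact (div_pos (Real.Gamma_pos_of_pos (pos_of_natCast_lt hν))
        (Real.Gamma_pos_of_pos (pos_of_natCast_lt (lt_add_card hν M)))).ne'
    refine ⟨?_, mul_left_cancel₀ hg h2⟩
    rw [integrableOn_congr_fun e' (measurableSet_siegelDomain p)] at h1
    refine (h1.const_mul (superRatio p q ν M : ℂ)⁻¹).congr (ae_of_all _ fun z => ?_)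
    simp only
    rw [inv_mul_cancel_left₀ hr]
  · intro h
    refine ⟨bargmannAdj_mem_superBergman hp hν b, bargmannAdj_mem_superBergman hp hν c,
      fun Φ hΦ => ?_⟩
    -- Surjectivity of R^* turns an arbitrary test function Φ into some R^* a.
    rw [← range_bargmannAdj hp hν] at hΦ
    obtain ⟨a, rfl⟩ := hΦ
    have hI := fun M : Finset (Fin q) => ((h M) (a M)).1.const_mul (superRatio p q ν M : ℂ)
    constructor
    · rw [integrableOn_congr_fun (e a) (measurableSet_siegelDomain p)]
      exact integrable_finsetSum _ fun M _ => hI M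
    · rw [(superInner_bargmannAdj hp hν a c).2, superInner,
        setIntegral_congr_fun (measurableSet_siegelDomain p) (e a),
        integral_finsetSum _ fun M _ => hI M, Finset.mul_sum, seqInner]
      refine Finset.sum_congr rfl fun M _ => ?_
      rw [integral_const_mul, ← mul_assoc, const_mul_superRatio hν, ((h M) (a M)).2]

end SuperSpace

/-! ### Closure of the graph. -/

section Closure

variable {p q : ℕ} {ν : ℝ}

/-- Convergence in L² gives almost everywhere convergence along a subsequence, and c = γb passes to
the pointwise limit without any bound on γ. -/
theorem isClosed_multiplicationGraph (ν : ℝ) (F : SuperComponents p q) :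
    IsClosed (multiplicationGraph ν F) := by
  refine IsSeqClosed.isClosed fun u x hu hx M n => ?_
  have hcomp : ∀ {u : ℕ → SeqSpace p q} {y : SeqSpace p q}, Tendsto u atTop (𝓝 y) →
      Tendsto (fun j => u j M n) atTop (𝓝 (y M n)) := by
    intro u y h
    have h1 := (tendsto_pi_nhds.1 h) M
    exact ((lp.evalCLM ℂ (fun _ : Fin (p - 1) → ℕ => HalfLineL2) 2 n).continuous.tendsto _).comp h1
  have h1 := tendstoInMeasure_of_tendsto_Lp (hcomp ((continuous_fst.tendsto x).comp hx))
  have h2 := tendstoInMeasure_of_tendsto_Lp (hcomp ((continuous_snd.tendsto x).comp hx))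
  obtain ⟨k, hk, hk'⟩ := h1.exists_seq_tendsto_ae
  -- A further subsequence, so that both coordinates converge along the same indices.
  obtain ⟨k₂, hk₂, hk₂'⟩ := (h2.comp hk.tendsto_atTop).exists_seq_tendsto_ae
  have h3 : ∀ᵐ ξ ∂(volume.restrict (Ioi (0 : ℝ))), ∀ j, ((u j).2 M n : ℝ → ℂ) ξ =
      gammaSymbol ν F n ξ M * ((u j).1 M n : ℝ → ℂ) ξ := ae_all_iff.2 fun j => hu j M n
  filter_upwards [hk', hk₂', h3] with ξ t1 t2 t3
  have t4 := (t1.comp hk₂.tendsto_atTop).const_mul (gammaSymbol ν F n ξ M)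
  refine tendsto_nhds_unique t2 (t4.congr fun j => ?_)
  simp only [Function.comp]
  exact (t3 _).symm

theorem mem_multiplicationGraph_iff {F : SuperComponents p q} (hp : 1 ≤ p) (hν : (p : ℝ) < ν)
    (hmeas : ∀ I J, Measurable (fun z : siegelDomain p => F I J z))
    (hbdd : ∃ C : ℝ, ∀ I J, ∀ z ∈ siegelDomain p, ‖F I J z‖ ≤ C) (b c : SeqSpace p q) :
    (b, c) ∈ multiplicationGraph ν F ↔ ∀ M n, (c M n : ℝ → ℂ) =ᵐ[volume.restrict (Ioi (0 : ℝ))]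
      fun ξ => specGamma (ν + M.card) (toeplitzSymbol ν F M) n ξ * (b M n : ℝ → ℂ) ξ := by
  refine forall_congr' fun M => forall_congr' fun n => ?_
  have e : (fun ξ => specGamma (ν + M.card) (toeplitzSymbol ν F M) n ξ * (b M n : ℝ → ℂ) ξ)
      =ᵐ[volume.restrict (Ioi (0 : ℝ))] fun ξ => gammaSymbol ν F n ξ M * (b M n : ℝ → ℂ) ξ := by
    filter_upwards [ae_restrict_mem measurableSet_Ioi] with ξ hξ
    rw [specGamma_toeplitzSymbol hp hν hmeas hbdd M n hξ]
  exact ⟨fun h => h.trans e.symm, fun h => h.trans e⟩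

/-- The approximating sequences for the different M are run in parallel, and convergence in the
product is coordinatewise. -/
theorem multiplicationGraph_subset_closure {F : SuperComponents p q} (hp : 1 ≤ p) (hν : (p : ℝ) < ν)
    (hmeas : ∀ I J, Measurable (fun z : siegelDomain p => F I J z))
    (hbdd : ∃ C : ℝ, ∀ I J, ∀ z ∈ siegelDomain p, ‖F I J z‖ ≤ C) (hinv : IsQuasiParabolic F) :
    multiplicationGraph ν F ⊆ closure (transformedToeplitzGraph ν F) := by
  rintro ⟨b, c⟩ h
  rw [mem_multiplicationGraph_iff hp hν hmeas hbdd] at h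
  have key := fun M => mem_closure_compToeplitzGraph hp (lt_add_card hν M)
    (isBergmanSymbol_toeplitzSymbol hν hmeas hbdd hinv M) (h M)
  choose u hu hlim using fun M => mem_closure_iff_seq_limit.1 (key M)
  refine mem_closure_iff_seq_limit.2 ⟨fun j => (fun M => (u M j).1, fun M => (u M j).2),
    fun j => (mem_transformedToeplitzGraph_iff hp hν hinv _ _).2 fun M => hu M j, ?_⟩
  exact (tendsto_pi_nhds.2 fun M => (continuous_fst.tendsto _).comp (hlim M)).prodMk_nhds
    (tendsto_pi_nhds.2 fun M => (continuous_snd.tendsto _).comp (hlim M))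

end Closure

end
-- The main theorem.
theorem mainTheorem2 (p q : ℕ) (hp : 1 ≤ p) (ν : ℝ) (hν : (p : ℝ) < ν)
    (F : SuperComponents p q)
    (hmeas : ∀ I J, Measurable (fun z : siegelDomain p => F I J z))
    (hbdd : ∃ C : ℝ, ∀ I J, ∀ z ∈ siegelDomain p, ‖F I J z‖ ≤ C)
    (hinv : IsQuasiParabolic F) :
    -- the formula for `R^*` converges absolutely
    (∀ (b : SeqSpace p q) (M : Finset (Fin q)), ∀ z ∈ siegelDomain p,
      (∀ n, IntegrableOn (bargmannAdjIntegrand ν b M n z) (Ioi (0 : ℝ))) ∧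
      Summable (fun n => ∫ ξ in Ioi (0 : ℝ), bargmannAdjIntegrand ν b M n z ξ)) ∧
    -- `R^*` is an isometric isomorphism onto the super Bergman space
    IsLinearMap ℂ (bargmannAdj ν : SeqSpace p q → HolComponents p q) ∧
    Set.range (bargmannAdj ν : SeqSpace p q → HolComponents p q) = superBergman p q ν ∧
    (∀ a b : SeqSpace p q,
      IntegrableOn (superIntegrand ν (bargmannAdj ν a) (bargmannAdj ν b).toGrassmann)
        (siegelDomain p) ∧
      superInner ν (bargmannAdj ν a) (bargmannAdj ν b).toGrassmann = seqInner ν a b) ∧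
    -- its inverse is `R`
    (∀ b : SeqSpace p q, IsBargmannTransform ν (bargmannAdj ν b) b) ∧
    -- the integrals in `γ_{F,ν}` converge absolutely
    (∀ (M K : Finset (Fin q)), M ⊆ K → ∀ n : Fin (p - 1) → ℕ, ∀ ξ > (0 : ℝ),
      IntegrableOn (gammaIntegrand F (K \ M) (ν + K.card - p) n ξ) (posOrthant p)) ∧
    -- `R T_F R^*` acts as multiplication by `γ_{F,ν}`; its closure is the maximal such operator
    transformedToeplitzGraph ν F ⊆ multiplicationGraph ν F ∧
    closure (transformedToeplitzGraph ν F) = multiplicationGraph ν F ∧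
    -- and there is nothing to close, everything being bounded, when the multipliers are bounded
    ((∃ C : ℝ, ∀ I, ∀ z ∈ siegelDomain p, siegelHeight z ^ I.card * ‖F I I z‖ ≤ C) →
      transformedToeplitzGraph ν F = multiplicationGraph ν F ∧
      (∀ a : SeqSpace p q, ∃ c, (a, c) ∈ transformedToeplitzGraph ν F) ∧
      ∃ C : ℝ, ∀ M n, ∀ ξ > (0 : ℝ), ‖gammaSymbol ν F n ξ M‖ ≤ C) := by
  have hG := fun M : Finset (Fin q) => isBergmanSymbol_toeplitzSymbol hν hmeas hbdd hinv M
  have hsub : transformedToeplitzGraph ν F ⊆ multiplicationGraph ν F := by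
    rintro ⟨b, c⟩ h
    rw [mem_multiplicationGraph_iff hp hν hmeas hbdd]
    rw [mem_transformedToeplitzGraph_iff hp hν hinv] at h
    exact fun M n => (h M).ae_eq hp (lt_add_card hν M) (hG M) n
  refine ⟨fun b M z hz => ?_, isLinearMap_bargmannAdj hν, range_bargmannAdj hp hν,
    superInner_bargmannAdj hp hν, isBargmannTransform_bargmannAdj hp hν,
    fun M K _ n ξ hξ => integrableOn_gammaIntegrand hν hmeas hbdd _ K n hξ, hsub,
    Subset.antisymm (closure_minimal hsub (isClosed_multiplicationGraph ν F))
      (multiplicationGraph_subset_closure hp hν hmeas hbdd hinv), ?_⟩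
  · have hl := pos_of_natCast_lt (lt_add_card hν M)
    exact ⟨fun n => integrableOn_bargmannKernel_mul hl hz n (b M n), summable_compAdj hl hz (b M)⟩
  · rintro ⟨C, hC⟩
    obtain ⟨C', hC'⟩ := norm_toeplitzSymbol_le hν hC
    have htot : ∀ a : SeqSpace p q, ∃ c, (a, c) ∈ transformedToeplitzGraph ν F := by
      intro a
      -- The symbol is at most C' times the weight, so its quotient by the weight maps Tb into L²
      -- for every b, and the projection represents the form.
      have h := fun M : Finset (Fin q) => isCompToeplitz_adjoint hp (lt_add_card hν M)
        (memLp_symbolQuot_of_le hp (lt_add_card hν M) (hG M).measurable (hC' M) (a M))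
      exact ⟨_, (mem_transformedToeplitzGraph_iff hp hν hinv _ _).2 h⟩
    refine ⟨Subset.antisymm hsub ?_, htot, C', fun M n ξ hξ => ?_⟩
    · rintro ⟨b, c⟩ h
      obtain ⟨c', hc'⟩ := htot b
      have h' := hsub hc'
      -- Multiplication is single valued: an operator defined everywhere and contained in it
      -- coincides with it.
      have : c = c' := by
        funext M
        refine lp.ext (funext fun n => Lp.ext ?_)
        exact (h M n).trans (h' M n).symm
      rwa [this]
    · rw [← specGamma_toeplitzSymbol hp hν hmeas hbdd M n hξ]
      exact norm_specGamma_le hp (lt_add_card hν M) (hC' M) n hξ
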